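/- Let $m\ge 0$ be an integer and let $\tau_m$ be the irreducible unitary representation of $SO(3)$ on the $(2m+1)$-dimensional space $H_m$ of complex harmonic homogeneous polynomials of degree $m$ on $\mathbb{R}^3$, $(\tau_m(k)p)(x)=p(k^{-1}x)$. Let $\tau$ be a finite-dimensional representation of $SO(3)$ on $V$. Let $L^1_\tau$ and $L^\infty_\tau$ be the spaces of integrable, respectively essentially bounded, functions $F:\mathbb{R}^3\to \mathrm{End}(V)$ such that, for every $k\in SO(3)$, $F(kx)=\tau(k)F(x)\tau(k)^{-1}$ for almost every $x$. A non-trivial $\Phi\in L^\infty_{\tau}$ is called a $\tau$-spherical function if $F\mapsto \frac1{\dim V}\int_{\mathbb{R}^3}\mathrm{Tr}[F(x)\Phi(-x)]\,dx$ is a homomorphism of the convolution algebra $L^1_{\tau}$ into $\mathbb{C}$; for the trivial one-dimensional representation these are the classical spherical functions of the Gelfand pair $(SO(3)\ltimes\mathbb{R}^3,SO(3))$. A $\tau$-spherical function is said to have Laplace eigenvalue $c$ if it is smooth and $\Delta\Phi=c\,\Phi$ (entrywise). Let $\mathbb{D}_{\tau_m}=(\mathbb{D}(\mathbb{R}^3)\otimes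 \mathrm{End}(H_m))^{SO(3)}$ be the algebra of translation-invariant differential operators on smooth $H_m$-valued functions on $\mathbb{R}^3$ that commute with $u\mapsto\tau_m(k)u(k^{-1}\,\cdot)$ for all $k\in SO(3)$; they act on $\mathrm{End}(H_m)$-valued functions column by column. With the basis $Y_1,Y_2,Y_3$ of $\mathfrak{so}(3)$ given by $Y_i v=v\times e_i$, put $d\tau_m(x)=\sum_i x_i\,d\tau_m(Y_i)$ for $x\in\mathbb{R}^3$, and $D_\tau=\sum_{i=1}^3 d\tau_m(Y_i)\,\partial/\partial x_i$. For $s>0$ and an integer $-m\le j\le m$ put $$\Phi_{s,j}(x)=(2m+1)\int_{S^2}e^{-\sqrt{-1}\,s\langle x,\xi\rangle}P_j(\xi)\,d\sigma(\xi),\qquad P_j(\xi)=\prod_{l=-m,\ l\ne j}^{m}\frac{\sqrt{-1}\,d\tau_m(\xi)+l\,I}{l-j},$$ where $\sigma$ is the normalized rotation-invariant measure on the unit sphere $S^2$. Then for every $s>0$ the following hold. (1) There is exactly one classical spherical function $\varphi_s$ with Laplace eigenvalue $-s^2$. (2) The vector space $\mathbb{D}_{\tau_m}\varphi_s=\{D(\varphi_s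 I): D\in\mathbb{D}_{\tau_m}\}$ has dimension $2m+1$ and is spanned by the functions $D_\tau^l(\varphi_s I)$, $0\le l\le 2m$. (3) The $\tau_m$-spherical functions with Laplace eigenvalue $-s^2$ are exactly the functions $\Phi_{s,j}$, $-m\le j\le m$, and their linear span is $\mathbb{D}_{\tau_m}\varphi_s$. -/

import Mathlib

open MeasureTheory MvPolynomial
open scoped ContDiff ComplexConjugate

noncomputable section

namespace TauSph

/-- Euclidean space `ℝ³`. -/
abbrev E3 : Type := EuclideanSpace ℝ (Fin 3)

/-- The rotation group `SO(3)`. -/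
abbrev SO3 : Type := Matrix.specialOrthogonalGroup (Fin 3) ℝ

/-- The natural action of `k ∈ SO(3)` on `ℝ³`. -/
def rot (k : SO3) : E3 →L[ℝ] E3 := Matrix.toEuclideanCLM (𝕜 := ℝ) k.1

/-! ### Spherical functions of type `τ` on `ℝ³`, for a representation `τ` of `SO(3)` -/

section Spherical

variable {V : Type*} [NormedAddCommGroup V] [NormedSpace ℂ V]

/-- `F (k x) = τ(k) F(x) τ(k)⁻¹` for every `k`, as an identity of classes of measurable
functions (almost everywhere in `x`). -/
def IsEquivariant (τ : SO3 →* (V →L[ℂ] V)) (F : E3 → (V →L[ℂ] V)) : Prop :=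
  ∀ k : SO3, ∀ᵐ x : E3, F (rot k x) = τ k * F x * τ k⁻¹

/-- `F ∈ L¹_τ(ℝ³)`. -/
def MemL1 (τ : SO3 →* (V →L[ℂ] V)) (F : E3 → (V →L[ℂ] V)) : Prop :=
  Integrable F volume ∧ IsEquivariant τ F

/-- `Φ ∈ L^∞_τ(ℝ³)`. -/
def MemLinf (τ : SO3 →* (V →L[ℂ] V)) (Φ : E3 → (V →L[ℂ] V)) : Prop :=
  MemLp Φ ⊤ volume ∧ IsEquivariant τ Φ

/-- The convolution `(F * G)(x) = ∫ F(x - y) G(y) dy`. -/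
def conv (F G : E3 → (V →L[ℂ] V)) (x : E3) : V →L[ℂ] V :=
  ∫ y : E3, F (x - y) * G y

/-- `𝓕(F)(Φ) = (1 / d_τ) ∫ Tr[F(x) Φ(-x)] dx`. -/
def sphTransform (Φ F : E3 → (V →L[ℂ] V)) : ℂ :=
  (1 / (Module.finrank ℂ V : ℂ)) *
    ∫ x : E3, LinearMap.trace ℂ V (F x * Φ (-x) : V →L[ℂ] V).toLinearMap

/-- `Φ` is a `τ`-spherical function: a non-trivial element of `L^∞_τ(ℝ³)` such that
`F ↦ 𝓕(F)(Φ)` is a homomorphism of the convolution algebra `L¹_τ(ℝ³)` into `ℂ` (the map is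
linear in `F` in any case). -/
def IsSpherical (τ : SO3 →* (V →L[ℂ] V)) (Φ : E3 → (V →L[ℂ] V)) : Prop :=
  MemLinf τ Φ ∧ ¬ (Φ =ᵐ[volume] 0) ∧
    ∀ F G : E3 → (V →L[ℂ] V), MemL1 τ F → MemL1 τ G →
      sphTransform Φ (conv F G) = sphTransform Φ F * sphTransform Φ G

/-- A smooth eigenfunction of the (componentwise) Laplace operator with eigenvalue `c`. -/
def HasLaplaceEigenvalue {W : Type*} [NormedAddCommGroup W] [NormedSpace ℂ W]
    (f : E3 → W) (c : ℂ) : Prop :=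
  ContDiff ℝ ∞ f ∧ ∀ x, Laplacian.laplacian f x = c • f x

/-- A classical spherical function of the Gelfand pair `(SO(3) ⋉ ℝ³, SO(3))`: the case of the
trivial one-dimensional representation. -/
def IsClassicalSpherical (φ : E3 → ℂ) : Prop :=
  IsSpherical (1 : SO3 →* (ℂ →L[ℂ] ℂ)) (fun x => φ x • (1 : ℂ →L[ℂ] ℂ))

end Spherical

/-! ### Invariant differential operators on vector-valued functions -/

section DiffOp

/-- The space `C^∞(ℝ³, W)`. -/
def Smooth (W : Type*) [NormedAddCommGroup W] [NormedSpace ℂ W] : Submodule ℂ (E3 → W) where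
  carrier := {f | ContDiff ℝ ∞ f}
  add_mem' {f g} hf hg := by
    have hf' : ContDiff ℝ ∞ f := hf
    have hg' : ContDiff ℝ ∞ g := hg
    exact hf'.add hg'
  zero_mem' := (contDiff_const : ContDiff ℝ ∞ fun _ : E3 => (0 : W))
  smul_mem' c f hf := by
    have hf' : ContDiff ℝ ∞ f := hf
    exact hf'.const_smul c

theorem Smooth.contDiff {W : Type*} [NormedAddCommGroup W] [NormedSpace ℂ W] (f : Smooth W) :
    ContDiff ℝ ∞ f.1 := f.2

variable {V : Type*} [NormedAddCommGroup V] [NormedSpace ℂ V]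

/-- The partial derivative `∂/∂x_i` on `C^∞(ℝ³, V)`. -/
def pd (i : Fin 3) : Module.End ℂ (Smooth V) where
  toFun f := ⟨fun x => fderiv ℝ f.1 x (EuclideanSpace.single i 1),
    ((Smooth.contDiff f).fderiv_right (m := ∞) le_rfl).clm_apply contDiff_const⟩
  map_add' f g := by
    ext x
    have hf : DifferentiableAt ℝ f.1 x := (Smooth.contDiff f).differentiable (by simp) x
    have hg : DifferentiableAt ℝ g.1 x := (Smooth.contDiff g).differentiable (by simp) x
    change fderiv ℝ (f.1 + g.1) x _ = fderiv ℝ f.1 x _ + fderiv ℝ g.1 x _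
    rw [fderiv_add hf hg]; rfl
  map_smul' c f := by
    ext x
    have hf : DifferentiableAt ℝ f.1 x := (Smooth.contDiff f).differentiable (by simp) x
    change fderiv ℝ (c • f.1) x _ = c • fderiv ℝ f.1 x _
    rw [fderiv_const_smul hf]; rfl

/-- Pointwise application of a fixed endomorphism `A` of `V`. -/
def coef (A : V →L[ℂ] V) : Module.End ℂ (Smooth V) where
  toFun f := ⟨fun x => A (f.1 x), (A.restrictScalars ℝ).contDiff.comp (Smooth.contDiff f)⟩
  map_add' f g := by ext x; exact map_add A _ _
  map_smul' c f := by ext x; exact map_smul A _ _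

/-- The action of `k ∈ SO(3)` on `V`-valued functions, `u ↦ τ(k) u(k⁻¹ x)`. -/
def kAct (τ : SO3 →* (V →L[ℂ] V)) (k : SO3) : Module.End ℂ (Smooth V) where
  toFun f := ⟨fun x => τ k (f.1 (rot k⁻¹ x)),
    ((τ k).restrictScalars ℝ).contDiff.comp ((Smooth.contDiff f).comp (rot k⁻¹).contDiff)⟩
  map_add' f g := by ext x; exact map_add (τ k) _ _
  map_smul' c f := by ext x; exact map_smul (τ k) _ _

variable (V) in
/-- `𝔻(ℝ³) ⊗ End(V)`: the translation-invariant differential operators on `V`-valued functions,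
i.e. the algebra generated by the `∂/∂x_i` and the constant endomorphisms of `V`. -/
def invDiffOp : Subalgebra ℂ (Module.End ℂ (Smooth V)) :=
  Algebra.adjoin ℂ (Set.range pd ∪ Set.range coef)

/-- `𝔻_τ = (𝔻(ℝ³) ⊗ End(V))^{SO(3)}`: those operators that commute with the action of `SO(3)`. -/
def DD (τ : SO3 →* (V →L[ℂ] V)) : Subalgebra ℂ (Module.End ℂ (Smooth V)) :=
  invDiffOp V ⊓ Subalgebra.centralizer ℂ (Set.range (kAct τ))

/-- A function with values in `End(V)`, applied to a fixed vector. -/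
def column (F : Smooth (V →L[ℂ] V)) (v : V) : Smooth V :=
  ⟨fun x => F.1 x v, ((ContinuousLinearMap.apply ℂ V v).restrictScalars ℝ).contDiff.comp (Smooth.contDiff F)⟩

/-- The action of an operator `D` on a smooth `End(V)`-valued function `F`, column by column:
`(D F)(x) v = (D (F(·) v))(x)`. It is linear in `D`. -/
def applyEnd [FiniteDimensional ℂ V] (F : Smooth (V →L[ℂ] V)) :
    Module.End ℂ (Smooth V) →ₗ[ℂ] (E3 → (V →L[ℂ] V)) where
  toFun D x := LinearMap.toContinuousLinearMap
    { toFun := fun v => (D (column F v)).1 x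
      map_add' := fun v w => by
        have h : column F (v + w) = column F v + column F w := by
          ext y; exact map_add (F.1 y) v w
        rw [h, map_add]; rfl
      map_smul' := fun c v => by
        have h : column F (c • v) = c • column F v := by
          ext y; exact map_smul (F.1 y) c v
        rw [h, map_smul]; rfl }
  map_add' D D' := by ext x v; rfl
  map_smul' c D := by ext x v; rfl

/-- The function `φ I`, for a smooth scalar function `φ`. -/
def scalarId (φ : E3 → ℂ) (h : ContDiff ℝ ∞ φ) : Smooth (V →L[ℂ] V) :=
  ⟨fun x => φ x • (1 : V →L[ℂ] V), h.smul contDiff_const⟩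

/-- `𝔻_τ φ = {D(φ I) : D ∈ 𝔻_τ}`. -/
def DDφ [FiniteDimensional ℂ V] (τ : SO3 →* (V →L[ℂ] V)) (φ : E3 → ℂ) (h : ContDiff ℝ ∞ φ) :
    Submodule ℂ (E3 → (V →L[ℂ] V)) :=
  (Subalgebra.toSubmodule (DD τ)).map (applyEnd (scalarId φ h))

end DiffOp

/-! ### The irreducible representations `τ_m` of `SO(3)` on harmonic polynomials -/

section Tau

/-- The Laplace operator on complex polynomials in three variables. -/
def polyLaplacian : MvPolynomial (Fin 3) ℂ →ₗ[ℂ] MvPolynomial (Fin 3) ℂ :=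
  ∑ i : Fin 3, (pderiv i).toLinearMap ∘ₗ (pderiv i).toLinearMap

/-- `H_m`: the harmonic homogeneous polynomials of degree `m` on `ℝ³`. -/
def harm (m : ℕ) : Submodule ℂ (MvPolynomial (Fin 3) ℂ) :=
  homogeneousSubmodule (Fin 3) ℂ m ⊓ LinearMap.ker polyLaplacian

theorem mem_harm {m : ℕ} {p : MvPolynomial (Fin 3) ℂ} :
    p ∈ harm m ↔ p.IsHomogeneous m ∧ ∑ i : Fin 3, pderiv i (pderiv i p) = 0 := by
  simp [harm, polyLaplacian, LinearMap.sum_apply]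

/-- The multi-indices of degree `m`. -/
abbrev idx (m : ℕ) : Finset (Fin 3 →₀ ℕ) := Finset.finsuppAntidiag Finset.univ m

theorem coeff_eq_zero_of_notMem_idx {m : ℕ} (p : harm m) {α : Fin 3 →₀ ℕ} (h : α ∉ idx m) :
    coeff α p.1 = 0 := by
  by_contra hne
  apply h
  have := (mem_harm.1 p.2).1 hne
  rw [Finset.mem_finsuppAntidiag]
  refine ⟨?_, Finset.subset_univ _⟩
  simpa [Finsupp.weight_apply, Finsupp.sum_fintype] using this

/-- The inner product `⟨p, q⟩ = (\bar p(∂) q)(0) = ∑ α! \bar{p_α} q_α` on `H_m`. -/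
@[reducible]
def innerCore (m : ℕ) : InnerProductSpace.Core ℂ (harm m) where
  inner p q := ∑ α ∈ idx m, ((∏ i, (α i).factorial : ℕ) : ℂ) * (conj (coeff α p.1) * coeff α q.1)
  conj_inner_symm p q := by
    simp only [map_sum, map_mul, Complex.conj_conj, map_natCast]
    exact Finset.sum_congr rfl fun α _ => by ring
  re_inner_nonneg p := by
    rw [map_sum]
    refine Finset.sum_nonneg fun α _ => ?_
    rw [← Complex.normSq_eq_conj_mul_self, ← Complex.ofReal_natCast, ← Complex.ofReal_mul]
    simp only [RCLike.re_eq_complex_re, Complex.ofReal_re]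
    exact mul_nonneg (Nat.cast_nonneg _) (Complex.normSq_nonneg _)
  add_left p q r := by
    simp only [Submodule.coe_add, coeff_add, map_add, add_mul, mul_add, Finset.sum_add_distrib]
  smul_left p q c := by
    simp only [Submodule.coe_smul, coeff_smul, smul_eq_mul, map_mul, Finset.mul_sum]
    exact Finset.sum_congr rfl fun α _ => by ring
  definite p hp := by
    have key : ∑ α ∈ idx m, ((∏ i, (α i).factorial : ℕ) : ℝ) * Complex.normSq (coeff α p.1) = 0 := by
      have h2 : ((∑ α ∈ idx m, ((∏ i, (α i).factorial : ℕ) : ℝ) * Complex.normSq (coeff α p.1) : ℝ) : ℂ)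
          = 0 := by
        rw [← hp]
        simp only [Complex.ofReal_sum, Complex.ofReal_mul, Complex.ofReal_natCast,
          Complex.normSq_eq_conj_mul_self]
      exact_mod_cast h2
    rw [Finset.sum_eq_zero_iff_of_nonneg
      (fun α _ => mul_nonneg (Nat.cast_nonneg _) (Complex.normSq_nonneg _))] at key
    ext α
    by_cases hα : α ∈ idx m
    · have hpos : ((∏ i, (α i).factorial : ℕ) : ℝ) ≠ 0 := by
        exact_mod_cast (Finset.prod_ne_zero_iff.2 fun i _ => Nat.factorial_ne_zero _)
      have := (mul_eq_zero.1 (key α hα)).resolve_left hpos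
      simpa using this
    · simpa using coeff_eq_zero_of_notMem_idx p hα

/-- The Hilbert space `V_{τ_m} = H_m` of the representation `τ_m`. -/
def H (m : ℕ) : Type := harm m

instance (m : ℕ) : NormedAddCommGroup (H m) := (innerCore m).toNormedAddCommGroup

instance (m : ℕ) : InnerProductSpace ℂ (H m) :=
  @InnerProductSpace.ofCore ℂ (harm m) _ _ _ (innerCore m).toCore

/-- The linear operator on `H_m` given by an operator on polynomials that preserves `H_m`. -/
def restrictH (m : ℕ) (f : MvPolynomial (Fin 3) ℂ →ₗ[ℂ] MvPolynomial (Fin 3) ℂ)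
    (hf : ∀ p ∈ harm m, f p ∈ harm m) : H m →ₗ[ℂ] H m where
  toFun p := (⟨f p.1, hf p.1 p.2⟩ : harm m)
  map_add' p q := Subtype.ext (map_add f p.1 q.1)
  map_smul' c p := Subtype.ext (map_smul f c p.1)

instance (m : ℕ) : FiniteDimensional ℂ (H m) := by
  let f : H m →ₗ[ℂ] (idx m → ℂ) :=
    { toFun := fun p α => coeff α.1 p.1
      map_add' := fun p q => by ext α; exact coeff_add α.1 p.1 q.1
      map_smul' := fun c p => by ext α; exact coeff_smul α.1 c p.1 }
  refine FiniteDimensional.of_injective f fun p q hpq => Subtype.ext ?_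
  ext α
  by_cases hα : α ∈ idx m
  · exact congrFun hpq ⟨α, hα⟩
  · rw [coeff_eq_zero_of_notMem_idx p hα, coeff_eq_zero_of_notMem_idx q hα]

/-- The substitution `p ↦ p(A x)`. -/
def subst (A : Matrix (Fin 3) (Fin 3) ℝ) : MvPolynomial (Fin 3) ℂ →ₐ[ℂ] MvPolynomial (Fin 3) ℂ :=
  aeval fun a => ∑ b, C (A a b : ℂ) * X b

theorem pderiv_subst (A : Matrix (Fin 3) (Fin 3) ℝ) (i : Fin 3) (p : MvPolynomial (Fin 3) ℂ) :
    pderiv i (subst A p) = ∑ a, C (A a i : ℂ) * subst A (pderiv a p) := by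
  induction p using MvPolynomial.induction_on with
  | C c => simp [subst, algebraMap_eq]
  | add p q hp hq => simp [hp, hq, mul_add, Finset.sum_add_distrib]
  | mul_X p j hp =>
    have hX : pderiv i (subst A (X j)) = C (A j i : ℂ) := by
      simp [subst, pderiv_X, Pi.single_apply]
    rw [map_mul, pderiv_mul, hp, hX]
    have h : ∀ a, C (A a i : ℂ) * subst A (pderiv a (p * X j)) =
        C (A a i : ℂ) * subst A (pderiv a p) * subst A (X j) +
          if a = j then subst A p * C (A j i : ℂ) else 0 := by
      intro a
      rw [pderiv_mul, map_add, map_mul, map_mul]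
      by_cases haj : a = j
      · rw [haj, pderiv_X_self, map_one, if_pos rfl]; ring
      · rw [pderiv_X_of_ne (Ne.symm haj), map_zero, if_neg haj]; ring
    rw [Finset.sum_congr rfl fun a _ => h a, Finset.sum_add_distrib, Finset.sum_mul]
    simp

theorem subst_mem_harm {m : ℕ} {A : Matrix (Fin 3) (Fin 3) ℝ} (hA : A * A.transpose = 1)
    {p : MvPolynomial (Fin 3) ℂ} (hp : p ∈ harm m) : subst A p ∈ harm m := by
  rw [mem_harm] at hp ⊢
  refine ⟨?_, ?_⟩
  · have := hp.1.aeval (fun a => ∑ b, C (A a b : ℂ) * X b) (n := 1) fun a =>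
      IsHomogeneous.sum _ _ _ fun b _ => by
        simpa using (isHomogeneous_C (Fin 3) (A a b : ℂ)).mul (isHomogeneous_X ℂ b)
    simpa [subst] using this
  · have hA' : ∀ a b : Fin 3, ∑ i, (A a i : ℂ) * (A b i : ℂ) = if a = b then 1 else 0 := by
      intro a b
      have := congrFun (congrFun hA a) b
      simp only [Matrix.mul_apply, Matrix.transpose_apply, Matrix.one_apply] at this
      have h2 := congrArg (fun r : ℝ => (r : ℂ)) this
      split_ifs at h2 ⊢ <;> simpa using h2
    calc ∑ i, pderiv i (pderiv i (subst A p))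
        = ∑ i, ∑ a, ∑ b, C ((A a i : ℂ) * (A b i : ℂ)) * subst A (pderiv b (pderiv a p)) := by
          refine Finset.sum_congr rfl fun i _ => ?_
          rw [pderiv_subst, map_sum]
          refine Finset.sum_congr rfl fun a _ => ?_
          rw [pderiv_C_mul, pderiv_subst, Finset.mul_sum]
          exact Finset.sum_congr rfl fun b _ => by rw [C_mul, mul_assoc]
      _ = ∑ a, ∑ b, C (∑ i, (A a i : ℂ) * (A b i : ℂ)) * subst A (pderiv b (pderiv a p)) := by
          rw [Finset.sum_comm]
          refine Finset.sum_congr rfl fun a _ => ?_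
          rw [Finset.sum_comm]
          refine Finset.sum_congr rfl fun b _ => ?_
          rw [map_sum, Finset.sum_mul]
      _ = subst A (∑ a, pderiv a (pderiv a p)) := by
          rw [map_sum]
          refine Finset.sum_congr rfl fun a _ => ?_
          rw [Finset.sum_eq_single a (fun b _ hb => by simp [hA', Ne.symm hb]) (by simp)]
          simp [hA']
      _ = 0 := by rw [hp.2, map_zero]

theorem SO3.inv_mul_transpose (k : SO3) :
    (k⁻¹ : SO3).1 * (k⁻¹ : SO3).1.transpose = 1 := (k⁻¹ : SO3).2.1.2

theorem subst_mul (A B : Matrix (Fin 3) (Fin 3) ℝ) (p : MvPolynomial (Fin 3) ℂ) :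
    subst (A * B) p = subst B (subst A p) := by
  have : subst (A * B) = (subst B).comp (subst A) := by
    ext1 a
    simp only [subst, aeval_X, AlgHom.comp_apply, map_sum, map_mul, algHom_C, algebraMap_eq,
      Matrix.mul_apply, Finset.mul_sum, Complex.ofReal_sum, Complex.ofReal_mul, Finset.sum_mul]
    rw [Finset.sum_comm]
    exact Finset.sum_congr rfl fun i _ => Finset.sum_congr rfl fun j _ => by ring
  rw [this]; rfl

theorem subst_one (p : MvPolynomial (Fin 3) ℂ) : subst 1 p = p := by
  have : subst 1 = AlgHom.id ℂ _ := by
    ext1 a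
    simp [subst, Matrix.one_apply, apply_ite]
  rw [this]; rfl

/-- The representation `τ_m` of `SO(3)` on `H_m`: `(τ_m(k) p)(x) = p(k⁻¹ x)`. -/
def tau (m : ℕ) : SO3 →* (H m →L[ℂ] H m) where
  toFun k := LinearMap.toContinuousLinearMap
    (restrictH m (subst (k⁻¹ : SO3).1).toLinearMap
      fun _ hp => subst_mem_harm (SO3.inv_mul_transpose k) hp)
  map_one' := by
    ext1 p
    apply Subtype.ext
    change subst ((1 : SO3)⁻¹ : SO3).1 p.1 = p.1
    rw [inv_one]; exact subst_one _
  map_mul' k l := by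
    ext1 p
    apply Subtype.ext
    change subst ((k * l)⁻¹ : SO3).1 p.1 = subst (k⁻¹ : SO3).1 (subst (l⁻¹ : SO3).1 p.1)
    rw [mul_inv_rev, ← subst_mul]; rfl

/-- The basis `Y_1, Y_2, Y_3` of `so(3)`. -/
def Y : Fin 3 → Matrix (Fin 3) (Fin 3) ℝ :=
  ![!![0, 0, 0; 0, 0, 1; 0, -1, 0], !![0, 0, -1; 0, 0, 0; 1, 0, 0], !![0, 1, 0; -1, 0, 0; 0, 0, 0]]

/-- The infinitesimal action on polynomials of a matrix `A`: the derivative at `t = 0` of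
`p(exp(-tA) x)`, that is `-∑ (A x)_a ∂_a p`. -/
def infAct (A : Matrix (Fin 3) (Fin 3) ℝ) :
    MvPolynomial (Fin 3) ℂ →ₗ[ℂ] MvPolynomial (Fin 3) ℂ :=
  -∑ a, ∑ b, LinearMap.mulLeft ℂ (C (A a b : ℂ) * X b) ∘ₗ (pderiv a).toLinearMap

theorem infAct_apply (A : Matrix (Fin 3) (Fin 3) ℝ) (p : MvPolynomial (Fin 3) ℂ) :
    infAct A p = -∑ a, ∑ b, C (A a b : ℂ) * X b * pderiv a p := by
  simp [infAct, LinearMap.sum_apply, mul_assoc]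

attribute [local instance] Matrix.linftyOpNormedRing Matrix.linftyOpNormedAlgebra in
/-- `infAct A p` is the derivative of `p(exp(-tA) x)` at `t = 0`. -/
theorem hasDerivAt_eval_exp (A : Matrix (Fin 3) (Fin 3) ℝ) (x : Fin 3 → ℝ)
    (p : MvPolynomial (Fin 3) ℂ) :
    HasDerivAt
      (fun t : ℝ => eval (fun a => (((NormedSpace.exp (t • (-A))).mulVec x a : ℝ) : ℂ)) p)
      (eval (fun a => (x a : ℂ)) (infAct A p)) 0 := by
  have hexp : HasDerivAt (fun t : ℝ => NormedSpace.exp (t • (-A))) (-A) 0 := by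
    have h := hasDerivAt_exp_smul_const (𝕂 := ℝ) (-A) (0 : ℝ)
    rw [zero_smul, NormedSpace.exp_zero, one_mul] at h
    exact h
  have hcoord : ∀ a, HasDerivAt
      (fun t : ℝ => (((NormedSpace.exp (t • (-A))).mulVec x a : ℝ) : ℂ))
      (-∑ b, (A a b : ℂ) * x b) 0 := by
    intro a
    let L : Matrix (Fin 3) (Fin 3) ℝ →ₗ[ℝ] ℝ :=
      { toFun := fun M => M.mulVec x a
        map_add' := fun M N => by simp [Matrix.add_mulVec]
        map_smul' := fun c M => by simp [Matrix.smul_mulVec] }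
    have h1 := (LinearMap.toContinuousLinearMap L).hasFDerivAt.comp_hasDerivAt 0 hexp
    have h2 : HasDerivAt (fun t : ℝ => (((NormedSpace.exp (t • (-A))).mulVec x a : ℝ) : ℂ))
      (((-A).mulVec x a : ℝ) : ℂ) 0 := h1.ofReal_comp
    have h3 : (((-A).mulVec x a : ℝ) : ℂ) = -∑ b, (A a b : ℂ) * x b := by
      simp [Matrix.mulVec, dotProduct]
    rwa [h3] at h2
  simp only [infAct_apply]
  induction p using MvPolynomial.induction_on with
  | C c => simpa using hasDerivAt_const (0 : ℝ) c
  | add p q hp hq =>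
    simp only [map_add, mul_add, Finset.sum_add_distrib, neg_add]
    exact hp.add hq
  | mul_X p j hp =>
    simp only [map_mul, eval_X]
    refine (hp.mul (hcoord j)).congr_deriv ?_
    simp only [zero_smul, NormedSpace.exp_zero, Matrix.one_mulVec, pderiv_mul, pderiv_X]
    fin_cases j <;> (simp [Fin.sum_univ_three]; ring)

theorem pderiv_comm (i j : Fin 3) (p : MvPolynomial (Fin 3) ℂ) :
    pderiv i (pderiv j p) = pderiv j (pderiv i p) := by
  induction p using MvPolynomial.induction_on with
  | C c => simp
  | add p q hp hq => simp [hp, hq]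
  | mul_X p k hp =>
    simp only [pderiv_mul, map_add, hp, pderiv_X, Pi.single_apply]
    split_ifs <;> simp <;> ring

theorem laplacian_X_mul_pderiv (a b : Fin 3) {p : MvPolynomial (Fin 3) ℂ}
    (hp : ∑ i : Fin 3, pderiv i (pderiv i p) = 0) :
    ∑ i : Fin 3, pderiv i (pderiv i (X a * pderiv b p)) = 2 * pderiv a (pderiv b p) := by
  have h : ∀ i : Fin 3, pderiv i (pderiv i (X a * pderiv b p)) =
      (if i = a then 2 * pderiv a (pderiv b p) else 0) + X a * pderiv b (pderiv i (pderiv i p)) := by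
    intro i
    rw [pderiv_mul, map_add, pderiv_mul, pderiv_mul, pderiv_comm b i, pderiv_comm b i]
    by_cases hia : i = a
    · subst hia; simp; ring
    · simp [pderiv_X_of_ne (Ne.symm hia), hia]
  rw [Finset.sum_congr rfl fun i _ => h i, Finset.sum_add_distrib, ← Finset.mul_sum, ← map_sum, hp]
  simp

theorem rotField_mem_harm {m : ℕ} (a b : Fin 3) {p : MvPolynomial (Fin 3) ℂ} (hp : p ∈ harm m) :
    X a * pderiv b p - X b * pderiv a p ∈ harm m := by
  rw [mem_harm] at hp ⊢
  refine ⟨?_, ?_⟩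
  · have h : ∀ c d : Fin 3, (X c * pderiv d p).IsHomogeneous m := by
      intro c d
      rcases Nat.eq_zero_or_pos m with rfl | hm
      · have h0 : pderiv d p = 0 := by
          rw [(totalDegree_eq_zero_iff_eq_C.1 (Nat.le_zero.1 hp.1.totalDegree_le)), pderiv_C]
        rw [h0, mul_zero]; exact isHomogeneous_zero _ _ _
      · have := (isHomogeneous_X ℂ c).mul (hp.1.pderiv (i := d))
        rwa [Nat.add_sub_cancel' hm] at this
    exact (h a b).sub (h b a)
  · simp only [map_sub, Finset.sum_sub_distrib]
    rw [laplacian_X_mul_pderiv a b hp.2, laplacian_X_mul_pderiv b a hp.2, pderiv_comm, sub_self]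

theorem infAct_mem_harm {m : ℕ} (i : Fin 3) {p : MvPolynomial (Fin 3) ℂ} (hp : p ∈ harm m) :
    infAct (Y i) p ∈ harm m := by
  have key : infAct (Y i) p = X (i + 1) * pderiv (i + 2) p - X (i + 2) * pderiv (i + 1) p := by
    rw [infAct_apply]
    fin_cases i <;> (simp [Y, Fin.sum_univ_three]; ring)
  rw [key]
  exact rotField_mem_harm _ _ hp

/-- The derived representation `dτ_m` on the basis vector `Y_i` of `so(3)`. -/
def dtauY (m : ℕ) (i : Fin 3) : H m →L[ℂ] H m :=
  LinearMap.toContinuousLinearMap (restrictH m (infAct (Y i)) fun _ hp => infAct_mem_harm i hp)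

/-- `dτ_m(x) = ∑ x_i dτ_m(Y_i)`. -/
def dtau (m : ℕ) (x : E3) : H m →L[ℂ] H m := ∑ i, (x i : ℂ) • dtauY m i

/-- The operator `D_τ = ∑ dτ_m(Y_i) ∂/∂x_i`. -/
def Dtau (m : ℕ) : Module.End ℂ (Smooth (H m)) := ∑ i, coef (dtauY m i) * pd i

/-- The projection `P_j(ξ)`, for `ξ` in the unit sphere and `-m ≤ j ≤ m`, of `V_{τ_m}` onto the
eigenspace of `dτ_m(ξ)` with eigenvalue `√-1 j`, written as the Lagrange interpolation product
`∏_{l ≠ j} (√-1 dτ_m(ξ) + l I) / (l - j)` over `-m ≤ l ≤ m`. -/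
def proj (m : ℕ) (j : ℤ) (ξ : E3) : H m →L[ℂ] H m :=
  (((Finset.Icc (-(m : ℤ)) m).erase j).toList.map fun l =>
    ((l - j : ℤ) : ℂ)⁻¹ • (Complex.I • dtau m ξ + (l : ℂ) • (1 : H m →L[ℂ] H m))).prod

/-- `Φ_{s,j}(x) = (2m+1) ∫_{S²} e^{-√-1 s⟨x,ξ⟩} P_j(ξ) dσ(ξ)`, where `σ` is the normalized
rotation-invariant measure on the unit sphere. -/
def Phi (m : ℕ) (s : ℝ) (j : ℤ) (x : E3) : H m →L[ℂ] H m :=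
  (2 * m + 1 : ℂ) • ⨍ ξ : Metric.sphere (0 : E3) 1,
    Complex.exp (-Complex.I * s * (inner ℝ x ξ.1 : ℝ)) • proj m j ξ.1 ∂(volume : Measure E3).toSphere

end Tau

end TauSph

end

open MeasureTheory MvPolynomial
open scoped ContDiff ComplexConjugate

noncomputable section

namespace TauSph

/-! ### The Lie algebra action on polynomials -/

/-! Everything is read off on the sphere of frequencies of length `s`. Ladder operators show that
for a unit vector `ξ` the operator `dτ_m(ξ)` has the simple spectrum `√-1 n`, `-m ≤ n ≤ m`, and that
whatever commutes with the stabilizer of `ξ` is diagonal in the same basis, hence a combination of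
the rank one projections `P_j(ξ)` (`exists_basis_diag`, `CommStab.eq_sum_proj`).

The Fourier transform of `F ∈ L¹_τ` at `sξ` commutes with the stabilizer of `ξ`, and convolution
becomes multiplication. The transform of `F` against `Φ_{s,j}` is `Tr(F̂(ξ) P_j(ξ))` for any `ξ`,
that is, a diagonal entry of `F̂(ξ)`, so it is multiplicative (`IsZonal.isSpherical`). These `2m+1`
characters are distinct, hence linearly independent, so the only spherical functions in the span of
the `Φ_{s,j}` are the `Φ_{s,j}` (`eq_zonal_of_isSpherical`).

It remains to see that every smooth equivariant `f` with `Δf = -s²f` lies in that span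
(`exists_eq_zonal_projSum`). The functions `Tr(D_τ^l f)` are radial solutions of the Helmholtz
equation, so their values at the origin determine them (`eq_zero_of_radial_helmholtz`). As `D_τ
Φ_{s,j} = s j Φ_{s,j}`, a Vandermonde system produces a combination of the `Φ_{s,j}` with the same
values for `l ≤ 2m`. The difference `Ψ` satisfies `Tr(D_τ^l Ψ) = 0` for `l ≤ 2m`, and then `Ψ = 0`
(`eq_zero_of_tr_DtauEnd_pow`): factors `D_τ` are traded for factors `dτ_m(x)` through a divergence
identity, until `Tr(dτ_m(x)^a Ψ(x)) = 0` for `a ≤ 2m`, which kills a diagonal matrix when `x ≠ 0`.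

Finally, an invariant operator acts on plane waves through an equivariant symbol, necessarily of the
form `∑ c_j P_j`, so `𝔻_τ φ_s` lies in the span of the `Φ_{s,j}` (`applyEnd_mem_span_zonal`).
Conversely `φ_s I` is a multiple of `∑ Φ_{s,j}`, and since the eigenvalues `s j` are distinct, the
functions `D_τ^l(φ_s I)`, `l ≤ 2m`, recover each summand (`zonal_mem_span_Dtau_pow`). -/

theorem infAct_Y (i : Fin 3) (p : MvPolynomial (Fin 3) ℂ) :
    infAct (Y i) p = X (i + 1) * pderiv (i + 2) p - X (i + 2) * pderiv (i + 1) p := by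
  rw [infAct_apply]
  fin_cases i <;> (simp [Y, Fin.sum_univ_three]; ring)

/-- The minus sign comes from the convention `Y_i v = v × e_i`, which is the negative of the usual
generator. Indices are cyclic in `Fin 3`. -/
theorem infAct_Y_comm (i : Fin 3) (p : MvPolynomial (Fin 3) ℂ) :
    infAct (Y i) (infAct (Y (i + 1)) p) - infAct (Y (i + 1)) (infAct (Y i) p) =
      -infAct (Y (i + 2)) p := by
  simp only [infAct_Y, map_sub, pderiv_mul, pderiv_X]
  fin_cases i <;>
  · simp only [Fin.isValue, Fin.zero_eta, Fin.mk_one, Fin.reduceFinMk, Fin.reduceAdd, zero_add, Pi.single_apply,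
      pderiv_comm 1 0, pderiv_comm 2 0, pderiv_comm 2 1]
    simp
    ring

/-- Chain rule: the flow of `A` followed by `B` is `B` followed by the flow of `B A B⁻¹`. -/
theorem infAct_subst (A B B' : Matrix (Fin 3) (Fin 3) ℝ) (h : B' * B = 1)
    (p : MvPolynomial (Fin 3) ℂ) :
    infAct A (subst B p) = subst B (infAct (B * A * B') p) := by
  have hC : ∀ c : ℂ, subst B (C c) = C c := fun c => by simp [subst, algebraMap_eq]
  have hX : ∀ b, subst B (X b) = ∑ e, C (B b e : ℂ) * X e := fun b => by simp [subst]
  have hmul : ∀ (M N : Matrix (Fin 3) (Fin 3) ℝ) i j, (M * N) i j = ∑ k, M i k * N k j :=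
    fun M N i j => Matrix.mul_apply
  rw [infAct_apply, infAct_apply, map_neg, map_sum, neg_inj]
  have h2 : ∀ c, subst B (∑ b, C ((B * A * B') c b : ℂ) * X b * pderiv c p) =
      ∑ e, C ((B * A) c e : ℂ) * X e * subst B (pderiv c p) := by
    intro c
    have h3 : B * A = B * A * B' * B := by rw [Matrix.mul_assoc (B * A), h, Matrix.mul_one]
    conv_rhs => rw [h3]
    simp only [map_sum, map_mul, hC, hX, hmul _ B, Finset.mul_sum, Finset.sum_mul,
      Complex.ofReal_sum, Complex.ofReal_mul]
    rw [Finset.sum_comm]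
    exact Finset.sum_congr rfl fun i _ => Finset.sum_congr rfl fun j _ => by ring
  simp only [h2, pderiv_subst, Finset.mul_sum, hmul B A, Finset.sum_mul, map_sum,
    Complex.ofReal_sum, Complex.ofReal_mul, map_mul]
  calc _ = ∑ b, ∑ a, ∑ c, C (A a b : ℂ) * X b * (C (B c a : ℂ) * subst B (pderiv c p)) :=
        Finset.sum_comm
    _ = ∑ b, ∑ c, ∑ a, C (A a b : ℂ) * X b * (C (B c a : ℂ) * subst B (pderiv c p)) :=
        Finset.sum_congr rfl fun b _ => Finset.sum_comm
    _ = ∑ c, ∑ b, ∑ a, C (A a b : ℂ) * X b * (C (B c a : ℂ) * subst B (pderiv c p)) :=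
        Finset.sum_comm
    _ = _ := Finset.sum_congr rfl fun i _ => Finset.sum_congr rfl fun j _ =>
        Finset.sum_congr rfl fun k _ => by ring

theorem SO3.adjugate (k : SO3) : k.1.adjugate = k.1.transpose := by
  have h1 : k.1.det = 1 := k.2.2
  have h2 : k.1 * k.1.transpose = 1 := k.2.1.2
  calc k.1.adjugate = k.1.adjugate * (k.1 * k.1.transpose) := by rw [h2, Matrix.mul_one]
    _ = k.1.transpose := by rw [← Matrix.mul_assoc, Matrix.adjugate_mul, h1, one_smul, Matrix.one_mul]

theorem SO3.coe_inv (k : SO3) : (k⁻¹ : SO3).1 = k.1.transpose := rfl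

theorem SO3.transpose_mul (k : SO3) : k.1.transpose * k.1 = 1 := k.2.1.1

theorem SO3.mul_transpose (k : SO3) : k.1 * k.1.transpose = 1 := k.2.1.2

/-- This is `k(v × w) = kv × kw` in matrix form. For a rotation the cofactors equal the entries
(`SO3.adjugate`), and those nine scalar identities are all that is needed. -/
theorem SO3.sum_smul_Y (k : SO3) (a : Fin 3) :
    ∑ i, k.1 i a • Y i = k.1 * Y a * k.1.transpose := by
  have h : (∑ i, k.1 i a • Y i) * k.1 = k.1 * Y a := by
    have hadj := SO3.adjugate k
    rw [Matrix.adjugate_fin_three] at hadj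
    have e : ∀ i j, _ := fun i j => congrFun (congrFun hadj i) j
    have e00 := e 0 0
    have e01 := e 0 1
    have e02 := e 0 2
    have e10 := e 1 0
    have e11 := e 1 1
    have e12 := e 1 2
    have e20 := e 2 0
    have e21 := e 2 1
    have e22 := e 2 2
    simp at e00 e01 e02 e10 e11 e12 e20 e21 e22
    ext i j
    fin_cases a <;> fin_cases i <;> fin_cases j <;>
      simp [Y, Matrix.mul_apply, Fin.sum_univ_three] <;> linarith
  rw [← h, Matrix.mul_assoc, SO3.mul_transpose, Matrix.mul_one]

theorem rot_apply (k : SO3) (x : E3) (i : Fin 3) : rot k x i = ∑ a, k.1 i a * x a := by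
  simp [rot, Matrix.mulVec, dotProduct]

theorem infAct_sum {ι : Type*} (s : Finset ι) (A : ι → Matrix (Fin 3) (Fin 3) ℝ) (c : ι → ℝ)
    (p : MvPolynomial (Fin 3) ℂ) :
    infAct (∑ i ∈ s, c i • A i) p = ∑ i ∈ s, (c i : ℂ) • infAct (A i) p := by
  induction s using Finset.cons_induction with
  | empty => simp [infAct_apply]
  | cons i s hi ih =>
    rw [Finset.sum_cons, Finset.sum_cons, ← ih]
    simp only [infAct_apply, Matrix.add_apply, Matrix.smul_apply, smul_eq_mul, Complex.ofReal_add,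
      Complex.ofReal_mul, map_add, map_mul, add_mul, Finset.sum_add_distrib, neg_add, smul_neg,
      Finset.smul_sum, smul_eq_C_mul, mul_assoc]

/-- The inclusion of `H_m` into the polynomials. -/
def toPoly (m : ℕ) : H m →ₗ[ℂ] MvPolynomial (Fin 3) ℂ where
  toFun p := p.1
  map_add' _ _ := rfl
  map_smul' _ _ := rfl

theorem toPoly_injective (m : ℕ) : Function.Injective (toPoly m) := Subtype.val_injective

theorem toPoly_tau (m : ℕ) (k : SO3) (p : H m) :
    toPoly m (tau m k p) = subst (k⁻¹ : SO3).1 (toPoly m p) := rfl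

theorem toPoly_dtauY (m : ℕ) (i : Fin 3) (p : H m) :
    toPoly m (dtauY m i p) = infAct (Y i) (toPoly m p) := rfl

theorem tau_mul_dtauY (m : ℕ) (k : SO3) (a : Fin 3) :
    tau m k * dtauY m a = (∑ i, (k.1 i a : ℂ) • dtauY m i) * tau m k := by
  refine ContinuousLinearMap.ext fun p => toPoly_injective m ?_
  simp only [mul_apply_eq_comp, sum_apply,
    smul_apply, map_sum, map_smul, toPoly_tau, toPoly_dtauY]
  rw [← infAct_sum, SO3.sum_smul_Y,
    infAct_subst _ (k⁻¹ : SO3).1 k.1 (SO3.mul_transpose k), SO3.coe_inv]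
  rw [← Matrix.mul_assoc, ← Matrix.mul_assoc, SO3.transpose_mul, Matrix.one_mul,
    Matrix.mul_assoc, SO3.transpose_mul, Matrix.mul_one]

theorem tau_mul_dtau (m : ℕ) (k : SO3) (x : E3) :
    tau m k * dtau m x = dtau m (rot k x) * tau m k := by
  simp only [dtau, Finset.mul_sum, mul_smul_comm, tau_mul_dtauY, rot_apply, Complex.ofReal_sum,
    Complex.ofReal_mul, Finset.sum_mul, Finset.smul_sum, Finset.sum_smul, smul_mul_assoc]
  rw [Finset.sum_comm]
  exact Finset.sum_congr rfl fun i _ => Finset.sum_congr rfl fun j _ => by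
    rw [smul_smul, mul_comm]

theorem dtauY_comm (m : ℕ) (i : Fin 3) :
    dtauY m i * dtauY m (i + 1) - dtauY m (i + 1) * dtauY m i = -dtauY m (i + 2) := by
  ext1 p
  exact toPoly_injective m (infAct_Y_comm i p.1)

/-! ### Ladder operators and the dimension of `H_m` -/

/-- The raising operator. -/
def raise (m : ℕ) : H m →L[ℂ] H m := Complex.I • dtauY m 0 + dtauY m 1

/-- The lowering operator. -/
def lower (m : ℕ) : H m →L[ℂ] H m := Complex.I • dtauY m 0 - dtauY m 1

theorem raise_mul_lower (m : ℕ) :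
    raise m * lower m = lower m * raise m + (2 * Complex.I) • dtauY m 2 := by
  have h := dtauY_comm m 0
  simp only [zero_add] at h
  have h' : dtauY m 2 = dtauY m 1 * dtauY m 0 - dtauY m 0 * dtauY m 1 := by
    rw [← neg_sub (dtauY m 0 * _), h, neg_neg]
  rw [h']
  simp only [raise, lower, add_mul, mul_add, mul_sub, sub_mul, smul_sub, smul_add, smul_mul_assoc, mul_smul_comm]
  module

/-- Calling weight the eigenvalue of `√-1 dτ_m(Y_3)` (index `2` here), this says that `lower`
decreases the weight by one. -/
theorem dtauY_two_mul_lower (m : ℕ) :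
    dtauY m 2 * lower m = lower m * dtauY m 2 + Complex.I • lower m := by
  have h1 := dtauY_comm m 1
  have h2 := dtauY_comm m 2
  simp only [Fin.reduceAdd, Fin.isValue] at h1 h2
  have h3 : Complex.I • lower m = -dtauY m 0 - Complex.I • dtauY m 1 := by
    rw [lower, smul_sub, smul_smul, Complex.I_mul_I, neg_one_smul]
  rw [h3, ← h1, sub_eq_add_neg (_ - _), ← smul_neg, ← h2]
  simp only [lower, mul_sub, sub_mul, smul_sub, smul_mul_assoc, mul_smul_comm]
  abel

/-- The highest weight vector `(x₁ - √-1 x₂)^m`. -/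
def highest (m : ℕ) : H m := (⟨(X 0 - C Complex.I * X 1) ^ m, by
  rw [mem_harm]
  refine ⟨?_, ?_⟩
  · have h : (X 0 - C Complex.I * X 1 : MvPolynomial (Fin 3) ℂ).IsHomogeneous 1 :=
      (isHomogeneous_X ℂ 0).sub (by
        simpa using (isHomogeneous_C (Fin 3) Complex.I).mul (isHomogeneous_X ℂ 1))
    simpa using h.pow m
  · have hI : (C Complex.I * C Complex.I : MvPolynomial (Fin 3) ℂ) = -1 := by
      rw [← C_mul, Complex.I_mul_I]; simp
    simp only [Fin.sum_univ_three, pderiv_pow, map_sub, pderiv_mul, pderiv_X, pderiv_C, Pi.single_apply]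
    simp
    linear_combination (m * (m - 1 : ℕ) * (X 0 - C Complex.I * X 1) ^ (m - 1 - 1)) * hI⟩ : harm m)

theorem toPoly_highest (m : ℕ) :
    toPoly m (highest m) = (X 0 - C Complex.I * X 1) ^ m := rfl

theorem dtauY_two_lower_pow (m k : ℕ) :
    dtauY m 2 ((lower m ^ k) (highest m)) =
      (-Complex.I * ((m : ℂ) - k)) • (lower m ^ k) (highest m) := by
  induction k with
  | zero =>
    apply toPoly_injective
    rw [map_smul, pow_zero]
    change infAct (Y 2) ((X 0 - C Complex.I * X 1) ^ m) =
      (_ : ℂ) • (X 0 - C Complex.I * X 1 : MvPolynomial (Fin 3) ℂ) ^ m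
    rw [infAct_Y]
    simp only [Fin.isValue, Fin.reduceAdd, pderiv_pow, map_sub, pderiv_mul, pderiv_X, pderiv_C, Pi.single_apply]
    simp [smul_eq_C_mul]
    rcases m with _ | m
    · simp
    · have hI : (C Complex.I * C Complex.I : MvPolynomial (Fin 3) ℂ) = -1 := by
        rw [← C_mul, Complex.I_mul_I]; simp
      simp [pow_succ]
      linear_combination
        (-((m : MvPolynomial (Fin 3) ℂ) + 1) * (X 0 - C Complex.I * X 1) ^ m * X 1 : MvPolynomial (Fin 3) ℂ) * hI
  | succ k ih =>
    have h := congrArg (fun A : H m →L[ℂ] H m => A ((lower m ^ k) (highest m)))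
      (dtauY_two_mul_lower m)
    simp only [mul_apply_eq_comp, add_apply, smul_apply, ih, map_smul] at h
    rw [pow_succ', mul_apply_eq_comp, h]
    push_cast
    module

/-- The constants obey `c_k = c_{k-1} + 2(m - k)`, by commuting `raise` past one `lower`, starting
from a vector that `raise` annihilates. Since `(k + 1)(2m - k)` is nonzero for `k < 2m`, the chain
of lowered vectors survives up to step `2m`. -/
theorem raise_lower_pow (m k : ℕ) :
    raise m ((lower m ^ (k + 1)) (highest m)) =
      ((k + 1 : ℂ) * (2 * m - k)) • (lower m ^ k) (highest m) := by
  have h := fun k => congrArg (fun A : H m →L[ℂ] H m => A ((lower m ^ k) (highest m)))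
    (raise_mul_lower m)
  simp only [mul_apply_eq_comp, add_apply, smul_apply, dtauY_two_lower_pow] at h
  induction k with
  | zero =>
    have h0 : raise m (highest m) = 0 := by
      apply toPoly_injective
      change Complex.I • infAct (Y 0) ((X 0 - C Complex.I * X 1) ^ m)
        + infAct (Y 1) ((X 0 - C Complex.I * X 1) ^ m) = 0
      rw [infAct_Y, infAct_Y]
      have hI : (C Complex.I * C Complex.I : MvPolynomial (Fin 3) ℂ) = -1 := by
        rw [← C_mul, Complex.I_mul_I]; simp
      simp only [Fin.isValue, Fin.reduceAdd, pderiv_pow, map_sub, pderiv_mul, pderiv_X, pderiv_C, Pi.single_apply]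
      simp [smul_eq_C_mul]
      linear_combination (m * (X 0 - C Complex.I * X 1) ^ (m - 1) * X 2) * hI
    have := h 0
    rw [zero_add, pow_one]
    simp only [pow_zero, one_apply_eq_self, h0, map_zero, zero_add, smul_smul] at this ⊢
    rw [this]
    congr 1
    push_cast
    linear_combination (-2 * m : ℂ) * Complex.I_mul_I
  | succ k ih =>
    rw [pow_succ', mul_apply_eq_comp, h, ih, map_smul, smul_smul, ← mul_apply_eq_comp, ← pow_succ',
      ← add_smul]
    congr 1
    push_cast
    linear_combination (-2 * (m - (k + 1)) : ℂ) * Complex.I_mul_I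

theorem highest_ne_zero (m : ℕ) : highest m ≠ 0 := by
  intro h
  have h1 : (X 0 - C Complex.I * X 1 : MvPolynomial (Fin 3) ℂ) ^ m = 0 := congrArg (toPoly m) h
  have h2 := congrArg (eval ![1, 0, 0]) h1
  simp at h2

theorem lower_pow_ne_zero (m k : ℕ) (hk : k ≤ 2 * m) : (lower m ^ k) (highest m) ≠ 0 := by
  induction k with
  | zero => exact highest_ne_zero m
  | succ k ih =>
    intro h0
    have h := raise_lower_pow m k
    rw [h0, map_zero] at h
    rcases smul_eq_zero.1 h.symm with h1 | h1
    · rcases mul_eq_zero.1 h1 with h2 | h2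
      · exact absurd h2 (by exact_mod_cast Nat.succ_ne_zero k)
      · have : (2 * m : ℂ) = k := sub_eq_zero.1 h2
        have : 2 * m = k := by exact_mod_cast this
        omega
    · exact ih (by omega) h1

/-- The coefficient of `x^β` in `Δp = 0` expresses the coefficient at `β + 2ε₂` through those at `β
+ 2ε₀` and `β + 2ε₁`, whose exponent of the last variable is smaller by two. Induction on that
exponent. -/
theorem harm_zero_of_coeff {m : ℕ} (p : MvPolynomial (Fin 3) ℂ) (hp : p ∈ harm m)
    (h : ∀ α : Fin 3 →₀ ℕ, α 2 ≤ 1 → coeff α p = 0) : p = 0 := by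
  have key : ∀ n : ℕ, ∀ α : Fin 3 →₀ ℕ, α 2 = n → coeff α p = 0 := by
    intro n
    induction n using Nat.strong_induction_on with
    | _ n ih =>
      intro α hα
      rcases Nat.lt_or_ge n 2 with hn | hn
      · exact h α (by omega)
      · obtain ⟨β, rfl⟩ : ∃ β : Fin 3 →₀ ℕ, α = β + Finsupp.single 2 1 + Finsupp.single 2 1 := by
          refine ⟨α - Finsupp.single 2 2, ?_⟩
          rw [add_assoc, ← Finsupp.single_add, tsub_add_cancel_of_le]
          simp; omega
        have h1 := congrArg (coeff β) (mem_harm.1 hp).2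
        simp only [Fin.sum_univ_three, coeff_add, coeff_pderiv, coeff_zero] at h1
        rw [ih (β 2) (by simp at hα; omega) _ (by simp), ih (β 2) (by simp at hα; omega) _ (by simp)] at h1
        simp at h1
        rcases h1 with (h1 | h1) | h1
        · exact h1
        · exact absurd h1 (by exact_mod_cast (by omega : β 2 + 1 + 1 ≠ 0))
        · exact absurd h1 (by exact_mod_cast (by omega : β 2 + 1 ≠ 0))
  ext α
  simpa using key _ α rfl

/-- The free coefficients are the `m + 1` with last exponent `0` and the `m` with last exponent `1`.
Only the upper bound is needed: the weight vectors supply the lower one. -/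
theorem finrank_H_le (m : ℕ) : Module.finrank ℂ (H m) ≤ 2 * m + 1 := by
  let g : (Fin (m + 1) ⊕ Fin m) → (Fin 3 →₀ ℕ) := Sum.elim
    (fun a => Finsupp.single 0 a.1 + Finsupp.single 1 (m - a.1))
    (fun a => Finsupp.single 0 a.1 + Finsupp.single 1 (m - 1 - a.1) + Finsupp.single 2 1)
  let f : H m →ₗ[ℂ] (Fin (m + 1) ⊕ Fin m → ℂ) :=
    { toFun := fun p α => coeff (g α) p.1
      map_add' := fun p q => by ext α; exact coeff_add (g α) p.1 q.1
      map_smul' := fun c p => by ext α; exact coeff_smul (g α) c p.1 }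
  have hf : Function.Injective f := by
    rw [← LinearMap.ker_eq_bot, LinearMap.ker_eq_bot']
    intro p hp
    refine Subtype.ext (harm_zero_of_coeff p.1 p.2 fun α hα => ?_)
    by_cases hm : α 0 + α 1 + α 2 = m
    · rcases Nat.le_one_iff_eq_zero_or_eq_one.1 hα with h2 | h2
      · have h3 := congrFun hp (Sum.inl ⟨α 0, by omega⟩)
        change coeff (Finsupp.single 0 (α 0) + Finsupp.single 1 (m - α 0)) p.1 = 0 at h3
        convert h3
        ext i; fin_cases i <;> simp <;> omega
      · have h3 := congrFun hp (Sum.inr ⟨α 0, by omega⟩)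
        change coeff (Finsupp.single 0 (α 0) + Finsupp.single 1 (m - 1 - α 0) + Finsupp.single 2 1) p.1 = 0 at h3
        convert h3
        ext i; fin_cases i <;> simp <;> omega
    · refine coeff_eq_zero_of_notMem_idx p fun h => hm ?_
      have := (Finset.mem_finsuppAntidiag.1 h).1
      simpa [Fin.sum_univ_three] using this
  have := LinearMap.finrank_le_finrank_of_injective hf
  simp at this
  omega

/-! ### Rotations -/

/-- The third basis vector. -/
abbrev e3 : E3 := EuclideanSpace.single 2 1

theorem norm_e3 : ‖e3‖ = 1 := by simp

/-- The rotation by the angle `t` about the third axis. -/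
def rotZ (t : ℝ) : SO3 :=
  ⟨!![Real.cos t, -Real.sin t, 0; Real.sin t, Real.cos t, 0; 0, 0, 1], by
    have h := Real.sin_sq_add_cos_sq t
    rw [Matrix.mem_specialOrthogonalGroup_iff, Matrix.mem_orthogonalGroup_iff]
    refine ⟨?_, ?_⟩
    · ext i j
      fin_cases i <;> fin_cases j <;>
        simp [Matrix.mul_apply, Fin.sum_univ_three] <;> linarith
    · simp [Matrix.det_fin_three]; linarith⟩

theorem rot_rotZ (t : ℝ) : rot (rotZ t) e3 = e3 := by
  ext i
  rw [rot_apply]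
  fin_cases i <;> simp [rotZ]

/-- The rotation by the angle `π` about the axis spanned by the unit vector `u`. -/
def halfTurn (u : E3) (hu : ‖u‖ = 1) : SO3 :=
  ⟨Matrix.of fun i j => 2 * u i * u j - if i = j then 1 else 0, by
    have h : u 0 ^ 2 + u 1 ^ 2 + u 2 ^ 2 = 1 := by
      have := EuclideanSpace.real_norm_sq_eq u
      rw [hu, Fin.sum_univ_three] at this
      linarith
    rw [Matrix.mem_specialOrthogonalGroup_iff, Matrix.mem_orthogonalGroup_iff]
    refine ⟨?_, ?_⟩
    · ext i j
      simp only [Matrix.mul_apply, Fin.sum_univ_three, Matrix.of_apply]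
      fin_cases i <;> fin_cases j <;> simp
      · linear_combination (4 * u 0 * u 0) * h
      · linear_combination (4 * u 0 * u 1) * h
      · linear_combination (4 * u 0 * u 2) * h
      · linear_combination (4 * u 1 * u 0) * h
      · linear_combination (4 * u 1 * u 1) * h
      · linear_combination (4 * u 1 * u 2) * h
      · linear_combination (4 * u 2 * u 0) * h
      · linear_combination (4 * u 2 * u 1) * h
      · linear_combination (4 * u 2 * u 2) * h
    · simp [Matrix.det_fin_three]; linear_combination 2 * h⟩

theorem rot_halfTurn (u : E3) (hu : ‖u‖ = 1) (v : E3) :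
    rot (halfTurn u hu) v = (2 * inner ℝ u v : ℝ) • u - v := by
  ext i
  rw [rot_apply]
  simp only [halfTurn, Matrix.of_apply, PiLp.sub_apply, PiLp.smul_apply, smul_eq_mul,
    PiLp.inner_apply, Fin.sum_univ_three]
  fin_cases i <;> simp <;> ring

theorem rot_mul (k l : SO3) (x : E3) : rot (k * l) x = rot k (rot l x) := by
  simp [rot]

theorem rot_one (x : E3) : rot 1 x = x := by
  simp [rot]

theorem rot_inv_rot (k : SO3) (x : E3) : rot k⁻¹ (rot k x) = x := by
  rw [← rot_mul, inv_mul_cancel, rot_one]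

theorem rot_rot_inv (k : SO3) (x : E3) : rot k (rot k⁻¹ x) = x := by
  rw [← rot_mul, mul_inv_cancel, rot_one]

theorem inner_rot_rot (k : SO3) (x y : E3) : inner ℝ (rot k x) (rot k y) = inner ℝ x y := by
  have h := SO3.transpose_mul k
  have e : ∀ i j, ∑ a, k.1 a i * k.1 a j = if i = j then 1 else 0 := fun i j => by
    have := congrFun (congrFun h i) j
    simpa [Matrix.mul_apply, Matrix.one_apply] using this
  have e00 := e 0 0
  have e01 := e 0 1
  have e02 := e 0 2
  have e11 := e 1 1
  have e12 := e 1 2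
  have e22 := e 2 2
  simp only [PiLp.inner_apply, rot_apply, Fin.sum_univ_three, RCLike.inner_apply, conj_trivial] at *
  simp at e00 e01 e02 e11 e12 e22
  linear_combination (x 0 * y 0) * e00 + (x 0 * y 1 + x 1 * y 0) * e01 +
    (x 0 * y 2 + x 2 * y 0) * e02 + (x 1 * y 1) * e11 + (x 1 * y 2 + x 2 * y 1) * e12 +
    (x 2 * y 2) * e22

theorem norm_rot (k : SO3) (x : E3) : ‖rot k x‖ = ‖x‖ := by
  rw [norm_eq_sqrt_real_inner, norm_eq_sqrt_real_inner, inner_rot_rot]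

/-- A rotation as a linear isometric automorphism of `ℝ³`. -/
def rotIso (k : SO3) : E3 ≃ₗᵢ[ℝ] E3 where
  toFun := rot k
  invFun := rot k⁻¹
  left_inv := rot_inv_rot k
  right_inv := rot_rot_inv k
  map_add' := map_add _
  map_smul' := map_smul _
  norm_map' := norm_rot k

/-- The half-turn about the bisector of `e3` and `ξ` exchanges them. For `ξ = -e3` there is no
bisector, and a half-turn about the first axis serves. -/
theorem exists_rot_e3 (ξ : E3) (hξ : ‖ξ‖ = 1) : ∃ k : SO3, rot k e3 = ξ := by
  by_cases h : ξ = -e3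
  · refine ⟨halfTurn (EuclideanSpace.single 0 1) (by simp), ?_⟩
    rw [rot_halfTurn, h, EuclideanSpace.inner_single_left]
    simp
  · have hne : e3 + ξ ≠ 0 := fun h0 => h (eq_neg_of_add_eq_zero_right h0)
    have hn : ‖e3 + ξ‖ ≠ 0 := norm_ne_zero_iff.2 hne
    refine ⟨halfTurn (‖e3 + ξ‖⁻¹ • (e3 + ξ)) (by rw [norm_smul, norm_inv, norm_norm, inv_mul_cancel₀ hn]), ?_⟩
    rw [rot_halfTurn, inner_smul_left, smul_smul]
    have h2 : ‖e3 + ξ‖ ^ 2 = 2 * inner ℝ (e3 + ξ) e3 := by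
      rw [norm_add_sq_real, inner_add_left, norm_e3, hξ, real_inner_self_eq_norm_sq, norm_e3,
        real_inner_comm]
      ring
    have h3 : 2 * ((starRingEnd ℝ) ‖e3 + ξ‖⁻¹ * inner ℝ (e3 + ξ) e3) * ‖e3 + ξ‖⁻¹ = 1 := by
      simp only [conj_trivial]
      field_simp
      linarith
    rw [h3, one_smul, add_sub_cancel_left]

theorem exists_rot (ξ η : E3) (hξ : ‖ξ‖ = 1) (hη : ‖η‖ = 1) : ∃ k : SO3, rot k ξ = η := by
  obtain ⟨k, rfl⟩ := exists_rot_e3 ξ hξ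
  obtain ⟨l, rfl⟩ := exists_rot_e3 η hη
  exact ⟨l * k⁻¹, by rw [rot_mul, rot_inv_rot]⟩

/-! ### The weight basis -/

/-- Conjugation by the rotation mixes `dτ_m(Y_1)` and `dτ_m(Y_2)` as a plane rotation, of which
`lower` is an eigenvector. It is the integrated form of the weight shift, and avoids exponentiating
`dτ_m`. -/
theorem tau_rotZ_lower (m : ℕ) (t : ℝ) :
    tau m (rotZ t) * lower m = Complex.exp (-(t * Complex.I)) • (lower m * tau m (rotZ t)) := by
  have h0 := tau_mul_dtauY m (rotZ t) 0
  have h1 := tau_mul_dtauY m (rotZ t) 1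
  simp only [rotZ, Fin.sum_univ_three] at h0 h1
  simp at h0 h1
  have hexp : Complex.exp (-(t * Complex.I)) = Complex.cos t - Complex.sin t * Complex.I := by
    rw [← neg_mul, Complex.exp_mul_I, Complex.cos_neg, Complex.sin_neg]; ring
  change tau m (rotZ t) * _ = _ at h0
  change tau m (rotZ t) * _ = _ at h1
  rw [hexp, lower, mul_sub, mul_smul_comm, h0, h1]
  change Complex.I • (_ * tau m (rotZ t)) - _ * tau m (rotZ t) = _
  generalize tau m (rotZ t) = U
  simp only [add_mul, sub_mul, smul_add, smul_sub, smul_mul_assoc, smul_smul, sub_smul, neg_mul]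
  have hI : Complex.sin t * Complex.I * Complex.I = - Complex.sin t := by
    rw [mul_assoc, Complex.I_mul_I]; ring
  rw [hI]
  module

theorem tau_rotZ_lower_pow (m k : ℕ) (t : ℝ) :
    tau m (rotZ t) ((lower m ^ k) (highest m)) =
      Complex.exp ((m - k : ℂ) * (t * Complex.I)) • (lower m ^ k) (highest m) := by
  induction k with
  | zero =>
    apply toPoly_injective
    rw [toPoly_tau, map_smul, pow_zero, one_apply_eq_self, toPoly_highest]
    have h : subst ((rotZ t)⁻¹ : SO3).1 (X 0 - C Complex.I * X 1) =
        C (Complex.exp (t * Complex.I)) * (X 0 - C Complex.I * X 1) := by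
      have hI : (C Complex.I * C Complex.I : MvPolynomial (Fin 3) ℂ) = -1 := by
        rw [← C_mul, Complex.I_mul_I]; simp
      rw [SO3.coe_inv, Complex.exp_mul_I]
      simp [subst, rotZ, Fin.sum_univ_three, algebraMap_eq]
      linear_combination (C (Complex.sin t) * X 1) * hI
    rw [map_pow, h, mul_pow, ← map_pow, smul_eq_C_mul, ← Complex.exp_nat_mul]
    simp
  | succ k ih =>
    have h := congrArg (fun A : H m →L[ℂ] H m => A ((lower m ^ k) (highest m)))
      (tau_rotZ_lower m t)
    simp only [mul_apply_eq_comp, smul_apply, ih, map_smul, smul_smul, ← Complex.exp_add] at h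
    rw [pow_succ', mul_apply_eq_comp, h]
    congr 2
    push_cast
    ring

theorem dtau_e3 (m : ℕ) : dtau m e3 = dtauY m 2 := by
  simp [dtau]

/-- The `2m + 1` lowered vectors have distinct eigenvalues, so they are independent and fill `H_m`
by the dimension bound. The stabilizer of `e3` acts on them by distinct characters, so its commutant
is diagonal. -/
theorem exists_weight_basis_e3 (m : ℕ) :
    ∃ w : Module.Basis (Fin (2 * m + 1)) ℂ (H m),
      (∀ k, dtau m e3 (w k) = (Complex.I * ((k : ℂ) - m)) • w k) ∧
      ∀ B : H m →L[ℂ] H m, (∀ g : SO3, rot g e3 = e3 → B * tau m g = tau m g * B) →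
        ∀ k, ∃ β : ℂ, B (w k) = β • w k := by
  have hinj : Function.Injective fun k : Fin (2 * m + 1) => -Complex.I * ((m : ℂ) - (k : ℕ)) := by
    intro k l h
    have h1 := mul_left_cancel₀ (neg_ne_zero.2 Complex.I_ne_zero) h
    have h2 : ((k : ℕ) : ℂ) = (l : ℕ) := by simpa using h1
    exact Fin.ext (by exact_mod_cast h2)
  have hli : LinearIndependent ℂ fun k : Fin (2 * m + 1) => (lower m ^ (k : ℕ)) (highest m) :=
    Module.End.eigenvectors_linearIndependent' (dtauY m 2).toLinearMap _ hinj _ fun k =>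
      ⟨Module.End.mem_eigenspace_iff.2 (dtauY_two_lower_pow m k),
        lower_pow_ne_zero m k (by omega)⟩
  have hcard : Fintype.card (Fin (2 * m + 1)) = Module.finrank ℂ (H m) := by
    refine le_antisymm hli.fintype_card_le_finrank ?_
    simpa using finrank_H_le m
  let w := basisOfLinearIndependentOfCardEqFinrank hli hcard
  have hw : ∀ k, w k = (lower m ^ (k : ℕ)) (highest m) := fun k => by simp [w]
  refine ⟨w, fun k => ?_, fun B hB k => ⟨w.repr (B (w k)) k, ?_⟩⟩
  · rw [dtau_e3, hw, dtauY_two_lower_pow]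
    congr 1
    ring
  · have hrep : ∀ l, l ≠ k → w.repr (B (w k)) l = 0 := by
      intro l hl
      -- One rotation suffices, by one radian: its eigenvalues `e^{√-1 (m - k)}` are pairwise
      -- distinct, because a coincidence would make `π` rational.
      have h1 : B (tau m (rotZ 1) (w k)) = tau m (rotZ 1) (B (w k)) :=
        congrArg (fun A : H m →L[ℂ] H m => A (w k)) (hB (rotZ 1) (rot_rotZ 1))
      have ht : ∀ k, tau m (rotZ 1) (w k) = Complex.exp ((m - (k : ℕ) : ℂ) * Complex.I) • w k := by
        intro k
        rw [hw, tau_rotZ_lower_pow]; simp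
      have h2 : ∀ u, w.repr (tau m (rotZ 1) u) l =
          Complex.exp ((m - (l : ℕ) : ℂ) * Complex.I) * w.repr u l := by
        intro u
        conv_lhs => rw [← w.sum_repr u]
        simp only [map_sum, map_smul, ht, Finsupp.coe_finsetSum, Finset.sum_apply,
          Finsupp.smul_apply, w.repr_self, smul_eq_mul]
        rw [Finset.sum_eq_single l]
        · simp; ring
        · intro j _ hj
          simp [hj]
        · simp
      have h3 := congrArg (fun u => w.repr u l) h1
      simp only [ht, map_smul, Finsupp.smul_apply, smul_eq_mul, h2] at h3
      rcases mul_eq_mul_right_iff.1 h3 with h4 | h4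
      · exfalso
        obtain ⟨n, hn⟩ := Complex.exp_eq_exp_iff_exists_int.1 h4
        have h5 : ((l : ℕ) : ℂ) - (k : ℕ) = n * (2 * Real.pi) := by
          refine mul_right_cancel₀ Complex.I_ne_zero ?_
          linear_combination hn
        have h6 : ((l : ℕ) : ℝ) - (k : ℕ) = n * (2 * Real.pi) := by exact_mod_cast h5
        rcases eq_or_ne n 0 with rfl | hn0
        · apply hl
          simp at h6
          exact Fin.ext (by exact_mod_cast sub_eq_zero.1 h6)
        · refine irrational_pi ⟨((l : ℕ) - (k : ℕ) : ℚ) / (2 * n), ?_⟩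
          have : (n : ℝ) ≠ 0 := by exact_mod_cast hn0
          push_cast
          rw [h6]
          field_simp
      · exact h4
    conv_lhs => rw [← w.sum_repr (B (w k))]
    exact Finset.sum_eq_single k (fun l _ hl => by rw [hrep l hl, zero_smul]) (by simp)

/-- Transport of the basis at `e3` by a rotation taking `e3` to `ξ`, which also conjugates the
stabilizers. -/
theorem exists_weight_basis (m : ℕ) (ξ : E3) (hξ : ‖ξ‖ = 1) :
    ∃ w : Module.Basis (Fin (2 * m + 1)) ℂ (H m),
      (∀ k, dtau m ξ (w k) = (Complex.I * ((k : ℂ) - m)) • w k) ∧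
      ∀ B : H m →L[ℂ] H m, (∀ g : SO3, rot g ξ = ξ → B * tau m g = tau m g * B) →
        ∀ k, ∃ β : ℂ, B (w k) = β • w k := by
  obtain ⟨k, rfl⟩ := exists_rot_e3 ξ hξ
  obtain ⟨w, hw, hB⟩ := exists_weight_basis_e3 m
  have hinv : ∀ (k : SO3) (u : H m), tau m k⁻¹ (tau m k u) = u := fun k u => by
    rw [← mul_apply_eq_comp, ← map_mul, inv_mul_cancel, map_one]; rfl
  have hinv' : ∀ (k : SO3) (u : H m), tau m k (tau m k⁻¹ u) = u := fun k u => by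
    rw [← mul_apply_eq_comp, ← map_mul, mul_inv_cancel, map_one]; rfl
  let T : H m ≃ₗ[ℂ] H m := LinearEquiv.ofLinearMap (tau m k).toLinearMap (tau m k⁻¹).toLinearMap
    (LinearMap.ext (hinv' k)) (LinearMap.ext (hinv k))
  refine ⟨w.map T, fun l => ?_, fun B hBk l => ?_⟩
  · have h := congrArg (fun A : H m →L[ℂ] H m => A (w l)) (tau_mul_dtau m k e3)
    simp only [mul_apply_eq_comp, hw, map_smul] at h
    exact h.symm
  · obtain ⟨β, hβ⟩ := hB (tau m k⁻¹ * B * tau m k) (fun g hg => by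
      have h := hBk (k * g * k⁻¹) (by rw [rot_mul, rot_mul, rot_inv_rot, hg])
      rw [map_mul, map_mul] at h
      have h1 : tau m k⁻¹ * tau m k = 1 := by rw [← map_mul, inv_mul_cancel, map_one]
      calc tau m k⁻¹ * B * tau m k * tau m g
          = tau m k⁻¹ * (B * (tau m k * tau m g * tau m k⁻¹)) * tau m k := by
            simp only [mul_assoc, h1, mul_one]
        _ = tau m k⁻¹ * (tau m k * tau m g * tau m k⁻¹ * B) * tau m k := by rw [h]
        _ = (tau m k⁻¹ * tau m k) * (tau m g * (tau m k⁻¹ * B * tau m k)) := by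
            simp only [mul_assoc]
        _ = _ := by rw [h1, one_mul]) l
    refine ⟨β, ?_⟩
    have h2 := congrArg (tau m k) hβ
    simp only [mul_apply_eq_comp, hinv', map_smul] at h2
    exact h2

theorem finrank_H (m : ℕ) : Module.finrank ℂ (H m) = 2 * m + 1 := by
  obtain ⟨w, -⟩ := exists_weight_basis_e3 m
  rw [Module.finrank_eq_card_basis w, Fintype.card_fin]

/-! ### Traces and the projections `P_j(ξ)` -/

section Trace

variable {V : Type*} [NormedAddCommGroup V] [NormedSpace ℂ V] [FiniteDimensional ℂ V]

/-- The trace as a continuous linear form on `V →L[ℂ] V`. -/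
def tr : (V →L[ℂ] V) →L[ℂ] ℂ :=
  LinearMap.toContinuousLinearMap (LinearMap.trace ℂ V ∘ₗ ContinuousLinearMap.coeLM ℂ)

theorem tr_apply (B : V →L[ℂ] V) : tr B = LinearMap.trace ℂ V B.toLinearMap := rfl

theorem tr_mul_comm (A B : V →L[ℂ] V) : tr (A * B) = tr (B * A) :=
  LinearMap.trace_mul_comm ℂ A.toLinearMap B.toLinearMap

theorem tr_conj (τ : SO3 →* (V →L[ℂ] V)) (k : SO3) (B : V →L[ℂ] V) :
    tr (τ k * B * τ k⁻¹) = tr B := by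
  rw [tr_mul_comm, ← mul_assoc, ← map_mul, inv_mul_cancel, map_one, one_mul]

theorem tr_one : tr (1 : V →L[ℂ] V) = Module.finrank ℂ V :=
  LinearMap.trace_one ℂ V

theorem tr_of_diag {ι : Type*} [Fintype ι] (w : Module.Basis ι ℂ V) (B : V →L[ℂ] V)
    (β : ι → ℂ) (h : ∀ k, B (w k) = β k • w k) : tr B = ∑ k, β k := by
  classical
  rw [tr_apply, LinearMap.trace_eq_matrix_trace ℂ w, Matrix.trace]
  refine Finset.sum_congr rfl fun k _ => ?_
  rw [Matrix.diag_apply, LinearMap.toMatrix_apply]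
  change w.repr (B (w k)) k = _
  rw [h]
  simp

/-- `B` commutes with the stabilizer of `x` in `SO(3)`. -/
def CommStab (τ : SO3 →* (V →L[ℂ] V)) (x : E3) (B : V →L[ℂ] V) : Prop :=
  ∀ g : SO3, rot g x = x → B * τ g = τ g * B

omit [FiniteDimensional ℂ V] in
theorem CommStab.of_smul {τ : SO3 →* (V →L[ℂ] V)} {x : E3} {B : V →L[ℂ] V} (c : ℝ)
    (hB : CommStab τ (c • x) B) : CommStab τ x B := fun g hg => hB g (by rw [map_smul, hg])

end Trace

theorem dtau_smul (m : ℕ) (c : ℝ) (x : E3) : dtau m (c • x) = (c : ℂ) • dtau m x := by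
  simp only [dtau, PiLp.smul_apply, smul_eq_mul, Complex.ofReal_mul, mul_smul, Finset.smul_sum]

theorem continuous_dtau (m : ℕ) : Continuous (dtau m) := by
  unfold dtau
  fun_prop

theorem continuous_proj (m : ℕ) (j : ℤ) : Continuous (proj m j) := by
  unfold proj
  refine continuous_list_prod _ fun l _ => ?_
  have := continuous_dtau m
  fun_prop

theorem tau_mul_proj (m : ℕ) (j : ℤ) (k : SO3) (ξ : E3) :
    tau m k * proj m j ξ = proj m j (rot k ξ) * tau m k := by
  unfold proj
  induction ((Finset.Icc (-(m : ℤ)) m).erase j).toList with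
  | nil => simp
  | cons l L ih =>
    rw [List.map_cons, List.prod_cons, List.map_cons, List.prod_cons, mul_assoc, ← ih,
      ← mul_assoc, ← mul_assoc]
    congr 1
    simp only [mul_smul_comm, smul_mul_assoc, mul_add, add_mul, tau_mul_dtau, mul_one, one_mul]

/-- On a vector with eigenvalue `√-1 n` the factor indexed by `l` acts as `(l - n)/(l - j)`: every
factor is `1` if `n = j`, and otherwise the factor `l = n` vanishes. -/
theorem proj_apply_weight (m : ℕ) (j : ℤ) (ξ : E3) (n : ℤ) (hn : n ∈ Finset.Icc (-(m : ℤ)) m)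
    (u : H m) (hu : dtau m ξ u = (Complex.I * (n : ℂ)) • u) :
    proj m j ξ u = if n = j then u else 0 := by
  have h : ∀ L : List ℤ, (L.map fun l =>
      ((l - j : ℤ) : ℂ)⁻¹ • (Complex.I • dtau m ξ + (l : ℂ) • (1 : H m →L[ℂ] H m))).prod u =
      (L.map fun l => ((l - j : ℤ) : ℂ)⁻¹ * ((l - n : ℤ) : ℂ)).prod • u := by
    intro L
    induction L with
    | nil => simp
    | cons l L ih =>
      simp only [List.map_cons, List.prod_cons, mul_apply_eq_comp, ih, map_smul, smul_apply,
        add_apply, hu, one_apply_eq_self, smul_smul, ← add_smul]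
      congr 1
      generalize (L.map fun l => ((l - j : ℤ) : ℂ)⁻¹ * ((l - n : ℤ) : ℂ)).prod = q
      push_cast
      linear_combination (n * ((l : ℂ) - j)⁻¹ * q) * Complex.I_mul_I
  rw [proj, h, Finset.prod_map_toList]
  split_ifs with hnj
  · rw [Finset.prod_eq_one, one_smul]
    intro l hl
    rw [hnj, inv_mul_cancel₀]
    exact_mod_cast sub_ne_zero.2 (Finset.ne_of_mem_erase hl)
  · rw [Finset.prod_eq_zero (Finset.mem_erase.2 ⟨hnj, hn⟩), zero_smul]
    simp

/-- The index `-m ≤ j ≤ m` attached to `k ∈ {0, …, 2m}`. -/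
def wt (m : ℕ) (k : Fin (2 * m + 1)) : ℤ := (k : ℤ) - m

theorem wt_injective (m : ℕ) : Function.Injective (wt m) := fun k l h => by
  apply Fin.ext
  unfold wt at h
  omega

theorem wt_mem (m : ℕ) (k : Fin (2 * m + 1)) : wt m k ∈ Finset.Icc (-(m : ℤ)) m := by
  have := k.2
  rw [Finset.mem_Icc]
  unfold wt
  omega

theorem range_wt (m : ℕ) : Set.range (wt m) = Set.Icc (-(m : ℤ)) m := by
  ext j
  refine ⟨?_, fun hj => ?_⟩
  · rintro ⟨k, rfl⟩
    simpa using wt_mem m k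
  · rw [Set.mem_Icc] at hj
    exact ⟨⟨(j + m).toNat, by omega⟩, by simp only [wt]; omega⟩

/-- A basis of `H_m` in which `dτ_m(ξ)` is diagonal, and so is everything that commutes with
the stabilizer of `ξ`. -/
theorem exists_basis_diag (m : ℕ) (ξ : E3) (hξ : ‖ξ‖ = 1) :
    ∃ w : Module.Basis (Fin (2 * m + 1)) ℂ (H m),
      (∀ k, dtau m ξ (w k) = (Complex.I * (wt m k : ℂ)) • w k) ∧
      (∀ j k, proj m (wt m j) ξ (w k) = if k = j then w k else 0) ∧
      ∀ B : H m →L[ℂ] H m, CommStab (tau m) ξ B → ∃ β : Fin (2 * m + 1) → ℂ,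
        (∀ k, B (w k) = β k • w k) := by
  obtain ⟨w, hw, hB⟩ := exists_weight_basis m ξ hξ
  have hw' : ∀ k, dtau m ξ (w k) = (Complex.I * (wt m k : ℂ)) • w k := fun k => by
    rw [hw]; simp [wt]
  refine ⟨w, hw', fun j k => ?_, fun B h => Classical.axiomOfChoice (hB B h)⟩
  rw [proj_apply_weight m _ ξ _ (wt_mem m k) _ (hw' k)]
  simp only [(wt_injective m).eq_iff]

theorem CommStab.eq_sum_proj {m : ℕ} {ξ : E3} (hξ : ‖ξ‖ = 1) {B : H m →L[ℂ] H m}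
    (hB : CommStab (tau m) ξ B) :
    B = ∑ j, tr (B * proj m (wt m j) ξ) • proj m (wt m j) ξ := by
  obtain ⟨w, -, hp, h⟩ := exists_basis_diag m ξ hξ
  obtain ⟨β, hβ⟩ := h B hB
  have htr : ∀ j, tr (B * proj m (wt m j) ξ) = β j := fun j => by
    rw [tr_of_diag w _ (fun k => if k = j then β k else 0) fun k => by
      rw [mul_apply_eq_comp, hp]
      split_ifs
      · exact hβ k
      · simp]
    simp
  simp only [htr]
  apply ContinuousLinearMap.coe_injective
  refine w.ext fun k => ?_
  simp [hp, hβ]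

/-- `Tr(B P_j(ξ))` is the `j`-th diagonal entry, and diagonal entries of diagonal matrices multiply.
This is the source of the homomorphism property of `Φ_{s,j}`. -/
theorem tr_mul_proj_mul {m : ℕ} {ξ : E3} (hξ : ‖ξ‖ = 1) {B C : H m →L[ℂ] H m}
    (hB : CommStab (tau m) ξ B) (hC : CommStab (tau m) ξ C) (j : Fin (2 * m + 1)) :
    tr (B * C * proj m (wt m j) ξ) = tr (B * proj m (wt m j) ξ) * tr (C * proj m (wt m j) ξ) := by
  obtain ⟨w, -, hp, h⟩ := exists_basis_diag m ξ hξ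
  have htr : ∀ (B : H m →L[ℂ] H m) (β : Fin (2 * m + 1) → ℂ), (∀ k, B (w k) = β k • w k) →
      tr (B * proj m (wt m j) ξ) = β j := fun B β hβ => by
    rw [tr_of_diag w _ (fun k => if k = j then β k else 0) fun k => by
      rw [mul_apply_eq_comp, hp]
      split_ifs
      · exact hβ k
      · simp]
    simp
  obtain ⟨β, hβ⟩ := h B hB
  obtain ⟨γ, hγ⟩ := h C hC
  rw [htr B β hβ, htr C γ hγ, htr (B * C) (fun k => β k * γ k)]
  intro k
  rw [mul_apply_eq_comp, hγ, map_smul, hβ, smul_smul, mul_comm]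

theorem tr_proj {m : ℕ} {ξ : E3} (hξ : ‖ξ‖ = 1) (j : Fin (2 * m + 1)) :
    tr (proj m (wt m j) ξ) = 1 := by
  obtain ⟨w, -, hp, -⟩ := exists_basis_diag m ξ hξ
  rw [tr_of_diag w _ (fun k => if k = j then 1 else 0) fun k => by rw [hp]; split_ifs <;> simp]
  simp

theorem dtau_mul_proj {m : ℕ} {ξ : E3} (hξ : ‖ξ‖ = 1) (j : Fin (2 * m + 1)) :
    dtau m ξ * proj m (wt m j) ξ = (Complex.I * (wt m j : ℂ)) • proj m (wt m j) ξ := by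
  obtain ⟨w, hw, hp, -⟩ := exists_basis_diag m ξ hξ
  apply ContinuousLinearMap.coe_injective
  refine w.ext fun k => ?_
  change dtau m ξ (proj m (wt m j) ξ (w k)) =
    (Complex.I * (wt m j : ℂ)) • proj m (wt m j) ξ (w k)
  rw [hp]
  split_ifs with hk
  · rw [hw, hk]
  · simp

theorem sum_proj {m : ℕ} {ξ : E3} (hξ : ‖ξ‖ = 1) : ∑ j, proj m (wt m j) ξ = 1 := by
  obtain ⟨w, hw, hp, -⟩ := exists_basis_diag m ξ hξ
  apply ContinuousLinearMap.coe_injective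
  refine w.ext fun k => ?_
  simp [hp]

theorem CommStab.commute_dtau_of_norm {m : ℕ} {ξ : E3} (hξ : ‖ξ‖ = 1) {B : H m →L[ℂ] H m}
    (hB : CommStab (tau m) ξ B) : dtau m ξ * B = B * dtau m ξ := by
  obtain ⟨w, hw, -, h⟩ := exists_basis_diag m ξ hξ
  obtain ⟨β, hβ⟩ := h B hB
  apply ContinuousLinearMap.coe_injective
  refine w.ext fun k => ?_
  change dtau m ξ (B (w k)) = B (dtau m ξ (w k))
  rw [hβ, hw, map_smul, map_smul, hβ, hw, smul_smul, smul_smul, mul_comm]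

theorem CommStab.commute_dtau {m : ℕ} {x : E3} {B : H m →L[ℂ] H m}
    (hB : CommStab (tau m) x B) : dtau m x * B = B * dtau m x := by
  rcases eq_or_ne x 0 with rfl | hx
  · have h0 : dtau m 0 = 0 := by simpa using dtau_smul m 0 0
    rw [h0, zero_mul, mul_zero]
  have hn : ‖x‖ ≠ 0 := norm_ne_zero_iff.2 hx
  have hx' : x = ‖x‖ • (‖x‖⁻¹ • x) := by rw [smul_smul, mul_inv_cancel₀ hn, one_smul]
  have hξ : ‖‖x‖⁻¹ • x‖ = 1 := by rw [norm_smul, norm_inv, norm_norm, inv_mul_cancel₀ hn]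
  have hd : dtau m x = (‖x‖ : ℂ) • dtau m (‖x‖⁻¹ • x) := by rw [← dtau_smul, ← hx']
  have h := CommStab.commute_dtau_of_norm hξ (CommStab.of_smul ‖x‖ (by rwa [← hx']))
  rw [hd, smul_mul_assoc, mul_smul_comm, h]

/-- Both operators are diagonal, so the traces are the moments of the diagonal of `B` at the nodes
`√-1 |x| n`, which are distinct because `x ≠ 0`. A Vandermonde argument concludes. -/
theorem CommStab.eq_zero_of_tr {m : ℕ} {x : E3} (hx : x ≠ 0) {B : H m →L[ℂ] H m}
    (hB : CommStab (tau m) x B) (h : ∀ a ≤ 2 * m, tr (dtau m x ^ a * B) = 0) : B = 0 := by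
  have hn : ‖x‖ ≠ 0 := norm_ne_zero_iff.2 hx
  have hx' : x = ‖x‖ • (‖x‖⁻¹ • x) := by rw [smul_smul, mul_inv_cancel₀ hn, one_smul]
  have hξ : ‖‖x‖⁻¹ • x‖ = 1 := by rw [norm_smul, norm_inv, norm_norm, inv_mul_cancel₀ hn]
  obtain ⟨w, hw, -, hd⟩ := exists_basis_diag m _ hξ
  obtain ⟨β, hβ⟩ := hd B (CommStab.of_smul ‖x‖ (by rwa [← hx']))
  have hdx : dtau m x = (‖x‖ : ℂ) • dtau m (‖x‖⁻¹ • x) := by rw [← dtau_smul, ← hx']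
  have hxw : ∀ k, dtau m x (w k) = (‖x‖ * (Complex.I * (wt m k : ℂ))) • w k := fun k => by
    rw [hdx, smul_apply, hw, smul_smul]
  have hpow : ∀ a k, (dtau m x ^ a) (w k) = (‖x‖ * (Complex.I * (wt m k : ℂ))) ^ a • w k := by
    intro a k
    induction a with
    | zero => simp
    | succ a ih => rw [pow_succ', mul_apply_eq_comp, ih, map_smul, hxw, smul_smul, pow_succ]
  have hβ0 : β = 0 := by
    refine Matrix.eq_zero_of_forall_pow_sum_mul_pow_eq_zero
      (f := fun k => (‖x‖ * (Complex.I * (wt m k : ℂ)))) ?_ fun a => ?_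
    · intro k l hkl
      have h1 := mul_left_cancel₀ Complex.I_ne_zero
        (mul_left_cancel₀ (Complex.ofReal_ne_zero.2 hn) hkl)
      exact wt_injective m (by exact_mod_cast h1)
    · have := h a (by omega)
      rwa [tr_of_diag w _ (fun k => β k * (‖x‖ * (Complex.I * (wt m k : ℂ))) ^ (a : ℕ)) fun k => by
        rw [mul_apply_eq_comp, hβ, map_smul, hpow, smul_smul]] at this
  apply ContinuousLinearMap.coe_injective
  refine w.ext fun k => ?_
  simp [hβ, hβ0]

/-! ### Superpositions of plane waves -/

/-- The unit sphere of `ℝ³`. -/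
abbrev S2 : Type := Metric.sphere (0 : E3) 1

theorem norm_S2 (ξ : S2) : ‖ξ.1‖ = 1 := by simp

/-- The plane wave `e^{-√-1 s⟨x,ξ⟩}`. -/
def planeWave (s : ℝ) (x : E3) (ξ : S2) : ℂ :=
  Complex.exp (-Complex.I * s * (inner ℝ x ξ.1 : ℝ))

theorem norm_planeWave (s : ℝ) (x : E3) (ξ : S2) : ‖planeWave s x ξ‖ = 1 := by
  rw [planeWave, Complex.norm_exp]
  simp

theorem continuous_planeWave (s : ℝ) : Continuous fun p : E3 × S2 => planeWave s p.1 p.2 := by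
  unfold planeWave
  fun_prop

theorem continuous_planeWave_right (s : ℝ) (x : E3) : Continuous (planeWave s x) :=
  (continuous_planeWave s).comp (Continuous.prodMk_right x)

section

variable {W : Type*} [NormedAddCommGroup W] [NormedSpace ℂ W]

/-- The superposition `∫ e^{-√-1 s⟨x,ξ⟩} B(ξ) dμ(ξ)` of plane waves. -/
def wave (s : ℝ) (μ : Measure S2) (B : S2 → W) (x : E3) : W :=
  ∫ ξ, planeWave s x ξ • B ξ ∂μ

theorem hasFDerivAt_planeWave_smul (s : ℝ) (b : W) (ξ : S2) (x : E3) :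
    HasFDerivAt (fun x => planeWave s x ξ • b)
      (planeWave s x ξ • ((-Complex.I * s) • (innerSL ℝ ξ.1).smulRight b)) x := by
  have h1 : HasFDerivAt (fun x : E3 => -Complex.I * s * ((inner ℝ x ξ.1 : ℝ) : ℂ))
      ((-Complex.I * s) • (Complex.ofRealCLM.comp (innerSL ℝ ξ.1))) x := by
    have h2 : HasFDerivAt (fun x : E3 => ((inner ℝ x ξ.1 : ℝ) : ℂ))
        (Complex.ofRealCLM.comp (innerSL ℝ ξ.1)) x := by
      have h3 := (Complex.ofRealCLM.comp (innerSL ℝ ξ.1)).hasFDerivAt (x := x)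
      refine h3.congr_of_eventuallyEq (Filter.Eventually.of_forall fun y => ?_)
      simp [real_inner_comm]
    exact h2.const_mul _
  refine (h1.cexp.smul_const b).congr_fderiv ?_
  ext v
  simp only [planeWave, ContinuousLinearMap.smulRight_apply, smul_apply, smul_smul,
    ContinuousLinearMap.comp_apply, Complex.ofRealCLM_apply, smul_eq_mul]
  rw [← Complex.coe_smul, smul_smul]

theorem continuous_gradSymbol (s : ℝ) {B : S2 → W} (hB : Continuous B) :
    Continuous fun ξ : S2 => (-Complex.I * s) • (innerSL ℝ ξ.1).smulRight (B ξ) := by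
  have h1 : Continuous fun ξ : S2 => (innerSL ℝ ξ.1 : E3 →L[ℝ] ℝ) :=
    (innerSL ℝ (E := E3)).continuous.comp continuous_subtype_val
  have h2 : Continuous fun ξ : S2 => (innerSL ℝ ξ.1 : E3 →L[ℝ] ℝ).smulRight (B ξ) :=
    (ContinuousLinearMap.smulRightL ℝ E3 W).continuous₂.comp (h1.prodMk hB)
  exact h2.const_smul (-Complex.I * s : ℂ)

variable [CompleteSpace W] (s : ℝ) (μ : Measure S2) [IsFiniteMeasure μ] {B : S2 → W}

omit [NormedSpace ℂ W] [CompleteSpace W] in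
theorem integrable_of_continuous (hB : Continuous B) : Integrable B μ := by
  obtain ⟨C, hC⟩ := isCompact_univ.exists_bound_of_continuousOn hB.continuousOn
  exact Integrable.of_bound hB.aestronglyMeasurable C
    (Filter.Eventually.of_forall fun ξ => hC ξ trivial)

omit [CompleteSpace W] in
theorem continuous_planeWave_smul (hB : Continuous B) (x : E3) :
    Continuous fun ξ => planeWave s x ξ • B ξ :=
  (continuous_planeWave_right s x).smul hB

omit [CompleteSpace W] in
theorem integrable_wave (hB : Continuous B) (x : E3) :
    Integrable (fun ξ => planeWave s x ξ • B ξ) μ :=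
  integrable_of_continuous μ (continuous_planeWave_smul s hB x)

-- Differentiation under the integral sign. The derivative is again a `wave`, with amplitude in `E3
-- →L[ℝ] W`, so the statement can be iterated.
omit [CompleteSpace W] in
theorem hasFDerivAt_wave (hB : Continuous B) (x : E3) :
    HasFDerivAt (wave s μ B)
      (wave s μ (fun ξ => (-Complex.I * s) • (innerSL ℝ ξ.1).smulRight (B ξ)) x) x := by
  have hB' := continuous_gradSymbol s hB
  obtain ⟨C, hC⟩ := isCompact_univ.exists_bound_of_continuousOn hB'.continuousOn
  refine hasFDerivAt_integral_of_dominated_of_fderiv_le (bound := fun _ => C)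
    (F' := fun x ξ => planeWave s x ξ • ((-Complex.I * s) • (innerSL ℝ ξ.1).smulRight (B ξ)))
    (Metric.ball_mem_nhds x one_pos) ?_ (integrable_wave s μ hB x) ?_ ?_ (integrable_const C) ?_
  · exact Filter.Eventually.of_forall fun y => (integrable_wave s μ hB y).aestronglyMeasurable
  · exact (continuous_planeWave_smul s hB' x).aestronglyMeasurable
  · refine Filter.Eventually.of_forall fun ξ y _ => ?_
    rw [norm_smul, norm_planeWave, one_mul]
    exact hC ξ trivial
  · exact Filter.Eventually.of_forall fun ξ y _ => hasFDerivAt_planeWave_smul s (B ξ) ξ y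

end

theorem contDiff_wave_nat (s : ℝ) (μ : Measure S2) [IsFiniteMeasure μ] (n : ℕ) :
    -- `W` is quantified inside the induction, since each derivative changes the target space.
    ∀ {W : Type*} [NormedAddCommGroup W] [NormedSpace ℂ W] [CompleteSpace W] {B : S2 → W},
      Continuous B → ContDiff ℝ n (wave s μ B) := by
  induction n with
  | zero =>
    intro W _ _ _ B hB
    exact contDiff_zero.2 (continuous_iff_continuousAt.2 fun x =>
      (hasFDerivAt_wave s μ hB x).continuousAt)
  | succ n ih =>
    intro W _ _ _ B hB
    refine (contDiff_succ_iff_hasFDerivAt (n := n)).2 ⟨_, ?_, hasFDerivAt_wave s μ hB⟩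
    exact ih (continuous_gradSymbol s hB)

section

variable {W : Type*} [NormedAddCommGroup W] [NormedSpace ℂ W] [CompleteSpace W] (s : ℝ)
  (μ : Measure S2) [IsFiniteMeasure μ] {B : S2 → W}

theorem contDiff_wave (hB : Continuous B) : ContDiff ℝ ∞ (wave s μ B) :=
  contDiff_infty.2 fun n => contDiff_wave_nat s μ n hB

/-- The superposition of plane waves as an element of `C^∞(ℝ³, W)`. -/
def smoothWave : C(S2, W) →ₗ[ℂ] Smooth W where
  toFun B := ⟨wave s μ B, contDiff_wave s μ B.continuous⟩
  map_add' B C := by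
    apply Subtype.ext
    funext x
    change wave s μ (B + C) x = wave s μ B x + wave s μ C x
    rw [wave, wave, wave, ← integral_add (integrable_wave s μ B.continuous x)
      (integrable_wave s μ C.continuous x)]
    simp
  map_smul' c B := by
    apply Subtype.ext
    funext x
    change wave s μ (c • B) x = c • wave s μ B x
    rw [wave, wave, ← integral_smul]
    simp only [ContinuousMap.coe_smul, Pi.smul_apply, smul_comm c]

theorem smoothWave_apply (B : C(S2, W)) (x : E3) :
    (smoothWave s μ B).1 x = ∫ ξ, planeWave s x ξ • B ξ ∂μ := rfl

/-- Multiplication of a continuous function on the sphere by `-√-1 s ξ_i`. -/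
def symbolPd (i : Fin 3) : C(S2, ℂ) :=
  ⟨fun ξ => -Complex.I * s * (ξ.1 i : ℂ), by fun_prop⟩

theorem pd_smoothWave (i : Fin 3) (B : C(S2, W)) :
    pd i (smoothWave s μ B) = smoothWave s μ (symbolPd s i • B) := by
  apply Subtype.ext
  funext x
  change fderiv ℝ (wave s μ B) x (EuclideanSpace.single i 1) = ∫ ξ, _ ∂μ
  have hB' := continuous_gradSymbol s B.continuous
  rw [(hasFDerivAt_wave s μ B.continuous x).fderiv, wave,
    ContinuousLinearMap.integral_apply (integrable_wave s μ hB' x)]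
  refine integral_congr_ae (Filter.Eventually.of_forall fun ξ => ?_)
  simp only [smul_apply, ContinuousLinearMap.smulRight_apply, innerSL_apply_apply,
    EuclideanSpace.inner_single_right, ContinuousMap.coe_smul', Pi.smul_apply', symbolPd,
    ContinuousMap.coe_mk, ← Complex.coe_smul, smul_smul]
  simp [mul_assoc]

theorem coef_smoothWave (A : W →L[ℂ] W) (B : C(S2, W)) :
    coef A (smoothWave s μ B) = smoothWave s μ ((A : C(W, W)).comp B) := by
  apply Subtype.ext
  funext x
  change A (∫ ξ, _ ∂μ) = ∫ ξ, _ ∂μ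
  rw [← ContinuousLinearMap.integral_comp_comm A (integrable_wave s μ B.continuous x)]
  refine integral_congr_ae (Filter.Eventually.of_forall fun ξ => ?_)
  simp

omit [CompleteSpace W] in
theorem laplacian_eq_sum_pd (f : Smooth W) (x : E3) :
    Laplacian.laplacian f.1 x = ∑ i, (pd i (pd i f)).1 x := by
  rw [InnerProductSpace.laplacian_eq_iteratedFDeriv_orthonormalBasis f.1
    (EuclideanSpace.basisFun (Fin 3) ℝ)]
  refine Finset.sum_congr rfl fun i _ => ?_
  rw [iteratedFDeriv_two_apply]
  have hd : DifferentiableAt ℝ (fderiv ℝ f.1) x :=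
    ((Smooth.contDiff f).fderiv_right (m := ∞) le_rfl).differentiable (by simp) x
  change _ = fderiv ℝ (fun y => fderiv ℝ f.1 y (EuclideanSpace.single i 1)) x _
  rw [fderiv_clm_apply hd (differentiableAt_const _)]
  simp

/-- The Laplace operator on `C^∞(ℝ³, W)`. -/
def lap : Module.End ℂ (Smooth W) := ∑ i, pd i * pd i

omit [CompleteSpace W] in
theorem hasLaplaceEigenvalue_iff (f : Smooth W) (c : ℂ) :
    HasLaplaceEigenvalue f.1 c ↔ lap f = c • f := by
  have h : ∀ x, Laplacian.laplacian f.1 x = (lap f).1 x := fun x => by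
    rw [laplacian_eq_sum_pd, lap, LinearMap.sum_apply]
    simp
  constructor
  · intro hf
    apply Subtype.ext
    funext x
    rw [← h, hf.2]
    rfl
  · intro hf
    refine ⟨f.2, fun x => ?_⟩
    rw [h, hf]
    rfl

theorem sum_sq_S2 (ξ : S2) : (ξ.1 0) ^ 2 + (ξ.1 1) ^ 2 + (ξ.1 2) ^ 2 = 1 := by
  have := EuclideanSpace.real_norm_sq_eq ξ.1
  rw [norm_S2, Fin.sum_univ_three] at this
  linarith

theorem lap_smoothWave (B : C(S2, W)) :
    lap (smoothWave s μ B) = (-(s : ℂ) ^ 2) • smoothWave s μ B := by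
  simp only [lap, LinearMap.sum_apply, Module.End.mul_apply, pd_smoothWave, ← map_sum, ← map_smul]
  congr 1
  ext ξ
  have h : ((ξ.1 0 : ℂ)) ^ 2 + (ξ.1 1 : ℂ) ^ 2 + (ξ.1 2 : ℂ) ^ 2 = 1 := by
    simpa using congrArg (fun r : ℝ => (r : ℂ)) (sum_sq_S2 ξ)
  simp only [Fin.sum_univ_three, ContinuousMap.add_apply, ContinuousMap.coe_smul',
    ContinuousMap.coe_smul, Pi.smul_apply, Pi.smul_apply', smul_smul, ← add_smul, symbolPd,
    ContinuousMap.coe_mk]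
  congr 1
  linear_combination (s ^ 2 * ((ξ.1 0 : ℂ) ^ 2 + (ξ.1 1 : ℂ) ^ 2 + (ξ.1 2 : ℂ) ^ 2)) *
    Complex.I_mul_I - (s : ℂ) ^ 2 * h

end

/-! ### Rotations of the sphere and invariance -/

/-- The action of `SO(3)` on the unit sphere. -/
def rotS (k : SO3) (ξ : S2) : S2 := ⟨rot k ξ.1, by simp [norm_rot]⟩

theorem continuous_rotS (k : SO3) : Continuous (rotS k) :=
  ((rot k).continuous.comp continuous_subtype_val).subtype_mk _

theorem rotS_inv_rotS (k : SO3) (ξ : S2) : rotS k⁻¹ (rotS k ξ) = ξ :=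
  Subtype.ext (rot_inv_rot k ξ.1)

theorem rotS_rotS_inv (k : SO3) (ξ : S2) : rotS k (rotS k⁻¹ ξ) = ξ :=
  Subtype.ext (rot_rot_inv k ξ.1)

theorem exists_rotS (ξ η : S2) : ∃ k : SO3, rotS k ξ = η := by
  obtain ⟨k, hk⟩ := exists_rot ξ.1 η.1 (norm_S2 ξ) (norm_S2 η)
  exact ⟨k, Subtype.ext hk⟩

theorem planeWave_rot (s : ℝ) (k : SO3) (x : E3) (ξ : S2) :
    planeWave s (rot k x) (rotS k ξ) = planeWave s x ξ := by
  simp only [planeWave, rotS, inner_rot_rot]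

-- The measure of a subset of the sphere is, up to a constant, the volume of the cone over it, and
-- rotations preserve Lebesgue measure and commute with forming cones.
open scoped Pointwise in
theorem measurePreserving_rotS_toSphere (k : SO3) :
    MeasurePreserving (rotS k) (volume : Measure E3).toSphere (volume : Measure E3).toSphere := by
  refine ⟨(continuous_rotS k).measurable, ?_⟩
  ext A hA
  rw [Measure.map_apply (continuous_rotS k).measurable hA, Measure.toSphere_apply' _ hA,
    Measure.toSphere_apply' _ ((continuous_rotS k).measurable hA)]
  have h : Set.Ioo (0 : ℝ) 1 • ((↑) '' (rotS k ⁻¹' A) : Set E3) =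
      rotIso k ⁻¹' (Set.Ioo (0 : ℝ) 1 • ((↑) '' A)) := by
    ext x
    simp only [Set.mem_smul, Set.mem_image, Set.mem_preimage]
    constructor
    · rintro ⟨r, hr, -, ⟨ξ, hξ, rfl⟩, rfl⟩
      exact ⟨r, hr, _, ⟨_, hξ, rfl⟩, (map_smul (rot k) r ξ.1).symm⟩
    · rintro ⟨r, hr, -, ⟨ξ, hξ, rfl⟩, hx⟩
      refine ⟨r, hr, _, ⟨rotS k⁻¹ ξ, by rwa [rotS_rotS_inv], rfl⟩, ?_⟩
      change r • rot k⁻¹ ξ.1 = x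
      rw [← map_smul, hx]
      exact rot_inv_rot k x
  rw [h, (rotIso k).measurePreserving.measure_preimage_emb
    (rotIso k).toHomeomorph.measurableEmbedding]

/-- The normalized rotation-invariant measure on the unit sphere. -/
def sig : Measure S2 :=
  ((volume : Measure E3).toSphere Set.univ)⁻¹ • (volume : Measure E3).toSphere

instance : IsProbabilityMeasure sig := by
  have : NeZero ((volume : Measure E3).toSphere) := ⟨Measure.toSphere_ne_zero _⟩
  unfold sig
  infer_instance

theorem measurePreserving_rotS (k : SO3) : MeasurePreserving (rotS k) sig sig :=
  (measurePreserving_rotS_toSphere k).smul_measure _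

theorem completeSpace_H (m : ℕ) : CompleteSpace (H m) := FiniteDimensional.complete ℂ _

attribute [local instance] completeSpace_H

section

variable {W : Type*} [NormedAddCommGroup W] [NormedSpace ℂ W] [CompleteSpace W]

/-- Functions fixed by the action `u ↦ ρ(k) u(k⁻¹ x)`. -/
def IsEquiv (ρ : SO3 →* (W →L[ℂ] W)) (f : E3 → W) : Prop :=
  ∀ k x, f (rot k x) = ρ k (f x)

theorem isEquiv_wave (ρ : SO3 →* (W →L[ℂ] W)) (s : ℝ) (B : C(S2, W))
    (hB : ∀ k ξ, B (rotS k ξ) = ρ k (B ξ)) : IsEquiv ρ (smoothWave s sig B).1 := by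
  intro k x
  rw [smoothWave_apply, smoothWave_apply, ← (measurePreserving_rotS k).integral_comp
    ((MeasurableEquiv.mk ⟨rotS k, rotS k⁻¹, rotS_inv_rotS k, rotS_rotS_inv k⟩
      (continuous_rotS k).measurable (continuous_rotS k⁻¹).measurable).measurableEmbedding),
    ← ContinuousLinearMap.integral_comp_comm _ (integrable_wave s sig B.continuous x)]
  refine integral_congr_ae (Filter.Eventually.of_forall fun ξ => ?_)
  simp only [planeWave_rot, hB, map_smul]

/-- The operator `∑ ε_i ∂/∂x_i`. -/
def firstOrder (ε : Fin 3 → (W →L[ℂ] W)) : Module.End ℂ (Smooth W) := ∑ i, coef (ε i) * pd i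

omit [CompleteSpace W] in
theorem firstOrder_apply (ε : Fin 3 → (W →L[ℂ] W)) (f : Smooth W) (x : E3) :
    (firstOrder ε f).1 x = ∑ i, ε i (fderiv ℝ f.1 x (EuclideanSpace.single i 1)) := by
  simp only [firstOrder, LinearMap.sum_apply, AddSubmonoidClass.coe_finsetSum, Finset.sum_apply]
  rfl

/-- The symbol of `∑ ε_i ∂_i` is `-√-1 s ∑ ξ_i ε_i`. On amplitudes that are eigenvectors for `√-1 c`
it is the scalar `s c`. -/
theorem firstOrder_smoothWave (ε : Fin 3 → (W →L[ℂ] W)) (s : ℝ) (μ : Measure S2)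
    [IsFiniteMeasure μ] (B : C(S2, W)) (c : ℂ)
    (hB : ∀ ξ, ∑ i, (ξ.1 i : ℂ) • ε i (B ξ) = (Complex.I * c) • B ξ) :
    firstOrder ε (smoothWave s μ B) = (s * c) • smoothWave s μ B := by
  simp only [firstOrder, LinearMap.sum_apply, Module.End.mul_apply, pd_smoothWave,
    coef_smoothWave, ← map_sum, ← map_smul]
  congr 1
  ext ξ
  have h : ∀ i, ((ε i : C(W, W)).comp (symbolPd s i • B)) ξ =
      (-Complex.I * s) • (ξ.1 i : ℂ) • ε i (B ξ) := fun i => by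
    change ε i ((-Complex.I * s * (ξ.1 i : ℂ)) • B ξ) = _
    rw [map_smul, smul_smul]
  rw [ContinuousMap.sum_apply, ContinuousMap.smul_apply]
  simp only [h]
  rw [← Finset.smul_sum, hB, smul_smul]
  congr 1
  linear_combination (-s * c) * Complex.I_mul_I

-- The hypothesis says that the `ε_i` rotate like the coordinate vectors. So do the `∂_i`, and the
-- contraction of the two is invariant.
omit [CompleteSpace W] in
theorem kAct_firstOrder (ρ : SO3 →* (W →L[ℂ] W)) (ε : Fin 3 → (W →L[ℂ] W))
    (h : ∀ k a, ρ k * ε a = (∑ i, (k.1 i a : ℂ) • ε i) * ρ k) (k : SO3) :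
    kAct ρ k * firstOrder ε = firstOrder ε * kAct ρ k := by
  refine LinearMap.ext fun f => Subtype.ext (funext fun x => ?_)
  rw [Module.End.mul_apply, Module.End.mul_apply, firstOrder_apply]
  change ρ k ((firstOrder ε f).1 (rot k⁻¹ x)) = _
  have hd : ∀ v, fderiv ℝ (kAct ρ k f).1 x v = ρ k (fderiv ℝ f.1 (rot k⁻¹ x) (rot k⁻¹ v)) := by
    intro v
    have h1 : HasFDerivAt f.1 (fderiv ℝ f.1 (rot k⁻¹ x)) (rot k⁻¹ x) :=
      ((Smooth.contDiff f).differentiable (by simp) _).hasFDerivAt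
    have h2 := (((ρ k).restrictScalars ℝ).hasFDerivAt).comp x (h1.comp x (rot k⁻¹).hasFDerivAt)
    change fderiv ℝ (fun x => ρ k (f.1 (rot k⁻¹ x))) x v = _
    exact congrArg (fun L : E3 →L[ℝ] W => L v) h2.fderiv
  have hv : ∀ i, rot k⁻¹ (EuclideanSpace.single i 1) =
      ∑ a, k.1 i a • (EuclideanSpace.single a 1 : E3) := by
    intro i
    ext j
    rw [rot_apply]
    simp [SO3.coe_inv, Pi.single_apply]
  have hk : ∀ a u, ρ k (ε a u) = ∑ i, (k.1 i a : ℂ) • ε i (ρ k u) := fun a u => by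
    have := congrArg (fun A : W →L[ℂ] W => A u) (h k a)
    simpa [sum_apply] using this
  simp only [firstOrder_apply, map_sum, hk, hd, hv, map_smul]
  rw [Finset.sum_comm]
  refine Finset.sum_congr rfl fun i _ => Finset.sum_congr rfl fun a _ => ?_
  rw [← Complex.coe_smul, map_smul, map_smul]

end

/-! ### Symbols of invariant differential operators -/

section

variable {V : Type*} [NormedAddCommGroup V] [NormedSpace ℂ V]

/-- Pointwise application of a family of endomorphisms. -/
def symAct (p : C(S2, V →L[ℂ] V)) (B : C(S2, V)) : C(S2, V) := ⟨fun ξ => p ξ (B ξ), by fun_prop⟩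

/-- One symbol serves for all finite measures: the invariant measure gives the action on `φ_s I`,
and Dirac measures give single plane waves, on which invariance of `D` is tested. -/
theorem exists_symbol [CompleteSpace V] (s : ℝ) (D : Module.End ℂ (Smooth V))
    (hD : D ∈ invDiffOp V) :
    ∃ p : C(S2, V →L[ℂ] V), ∀ (μ : Measure S2) [IsFiniteMeasure μ] (B : C(S2, V)),
      D (smoothWave s μ B) = smoothWave s μ (symAct p B) := by
  induction hD using Algebra.adjoin_induction with
  | mem D h =>
    rcases h with ⟨i, rfl⟩ | ⟨A, rfl⟩
    · refine ⟨symbolPd s i • ContinuousMap.const _ 1, fun μ _ B => ?_⟩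
      rw [pd_smoothWave]
      congr 1
    · refine ⟨ContinuousMap.const _ A, fun μ _ B => ?_⟩
      rw [coef_smoothWave]
      rfl
  | algebraMap c =>
    refine ⟨c • ContinuousMap.const _ 1, fun μ _ B => ?_⟩
    rw [Module.algebraMap_end_apply, ← map_smul]
    congr 1
  | add D E _ _ hD hE =>
    obtain ⟨p, hp⟩ := hD
    obtain ⟨q, hq⟩ := hE
    refine ⟨p + q, fun μ _ B => ?_⟩
    rw [LinearMap.add_apply, hp, hq, ← map_add]
    congr 1
  | mul D E _ _ hD hE =>
    obtain ⟨p, hp⟩ := hD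
    obtain ⟨q, hq⟩ := hE
    refine ⟨p * q, fun μ _ B => ?_⟩
    rw [Module.End.mul_apply, hq, hp]
    congr 1

theorem planeWave_zero (s : ℝ) (ξ : S2) : planeWave s 0 ξ = 1 := by simp [planeWave]

/-- Rotating the plane wave of direction `ξ` and amplitude `v` gives the one of direction `kξ` and
amplitude `τ(k)v`. Commuting `D` with the rotation and evaluating at the origin compares the
symbols. -/
theorem symbol_equivariant [CompleteSpace V] (τ : SO3 →* (V →L[ℂ] V)) (s : ℝ)
    (D : Module.End ℂ (Smooth V)) (hD : D ∈ DD τ) (p : C(S2, V →L[ℂ] V))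
    (hp : ∀ (μ : Measure S2) [IsFiniteMeasure μ] (B : C(S2, V)),
      D (smoothWave s μ B) = smoothWave s μ (symAct p B)) (k : SO3) (ξ : S2) :
    p (rotS k ξ) * τ k = τ k * p ξ := by
  ext v
  have hdirac : ∀ (ξ : S2) (B : C(S2, V)) x,
      (smoothWave s (Measure.dirac ξ) B).1 x = planeWave s x ξ • B ξ := fun ξ B x => by
    rw [smoothWave_apply, integral_dirac]
  have h1 : kAct τ k (smoothWave s (Measure.dirac ξ) (ContinuousMap.const _ v)) =
      smoothWave s (Measure.dirac (rotS k ξ)) (ContinuousMap.const _ (τ k v)) := by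
    refine Subtype.ext (funext fun x => ?_)
    change τ k ((smoothWave s (Measure.dirac ξ) (ContinuousMap.const _ v)).1 (rot k⁻¹ x)) = _
    rw [hdirac, hdirac, map_smul, ← planeWave_rot s k, rot_rot_inv]
    rfl
  have h2 : D * kAct τ k = kAct τ k * D :=
    ((Subalgebra.mem_centralizer_iff ℂ).1 hD.2 _ ⟨k, rfl⟩).symm
  have h3 := congrArg (fun f : Smooth V => f.1 0)
    (LinearMap.congr_fun h2 (smoothWave s (Measure.dirac ξ) (ContinuousMap.const _ v)))
  simp only [Module.End.mul_apply, h1, hp] at h3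
  change _ = τ k ((smoothWave s (Measure.dirac ξ) _).1 (rot k⁻¹ 0)) at h3
  rw [hdirac, hdirac, map_zero, planeWave_zero, planeWave_zero, one_smul, one_smul] at h3
  exact h3

end

/-! ### The Casimir element and words in `dτ_m(x)` -/

/-- With `E` the Euler field, the sum of squares of the rotation fields is `|x|²Δ - E² - E`, where
`Δ = 0` and `E = m` on `H_m`. -/
theorem dtauY_casimir (m : ℕ) :
    ∑ i, dtauY m i * dtauY m i = (-(m * (m + 1)) : ℂ) • (1 : H m →L[ℂ] H m) := by
  refine ContinuousLinearMap.ext fun p => toPoly_injective m ?_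
  simp only [sum_apply, mul_apply_eq_comp, smul_apply, one_apply_eq_self, map_sum, map_smul,
    toPoly_dtauY]
  have hp := mem_harm.1 p.2
  change ∑ i, infAct (Y i) (infAct (Y i) p.1) = (-(m * (m + 1)) : ℂ) • p.1
  have he : ∑ i, X i * pderiv i p.1 = m • p.1 := hp.1.sum_X_mul_pderiv
  have hl := hp.2
  have h1 : ∀ j, pderiv j (∑ i, X i * pderiv i p.1) = m • pderiv j p.1 := fun j => by
    rw [he, map_nsmul]
  have h10 := h1 0
  have h11 := h1 1
  have h12 := h1 2
  rw [Fin.sum_univ_three] at hl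
  simp only [Fin.sum_univ_three, map_add, pderiv_mul, pderiv_X, Pi.single_apply, infAct_Y,
    map_sub, nsmul_eq_mul, smul_eq_C_mul, pderiv_comm 1 0, pderiv_comm 2 0, pderiv_comm 2 1,
    Fin.reduceAdd, Fin.isValue, zero_add] at he h10 h11 h12 ⊢
  simp at he h10 h11 h12 ⊢
  linear_combination (X 0 ^ 2 + X 1 ^ 2 + X 2 ^ 2) * hl - X 0 * h10 - X 1 * h11 - X 2 * h12
    - (m + 1) * he

section Words

variable {A : Type*} [Ring A] [Algebra ℂ A]

/-- The span of the powers `a^b`, `b < n`. -/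
def powSpan (a : A) (n : ℕ) : Submodule ℂ A := Submodule.span ℂ ((a ^ ·) '' Set.Iio n)

theorem pow_mem_powSpan (a : A) {b n : ℕ} (h : b < n) : a ^ b ∈ powSpan a n :=
  Submodule.subset_span ⟨b, h, rfl⟩

theorem powSpan_mono (a : A) {n n' : ℕ} (h : n ≤ n') : powSpan a n ≤ powSpan a n' :=
  Submodule.span_mono (Set.image_mono fun _ hb => lt_of_lt_of_le hb h)

theorem mul_mem_powSpan (a : A) {n : ℕ} {b : A} (hb : b ∈ powSpan a n) :
    a * b ∈ powSpan a (n + 1) := by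
  induction hb using Submodule.span_induction with
  | mem b hb =>
    obtain ⟨k, hk, rfl⟩ := hb
    rw [← pow_succ']
    exact pow_mem_powSpan a (Nat.succ_lt_succ hk)
  | zero => simp
  | add b c _ _ hb hc => rw [mul_add]; exact add_mem hb hc
  | smul r b _ hb => rw [mul_smul_comm]; exact Submodule.smul_mem _ _ hb

variable {e : Fin 3 → A} {c : ℂ} (x : Fin 3 → ℂ)

theorem lie_sum_smul (he : ∀ i, e i * e (i + 1) - e (i + 1) * e i = -e (i + 2)) (i : Fin 3) :
    (∑ j, x j • e j) * e i - e i * ∑ j, x j • e j =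
      x (i + 1) • e (i + 2) - x (i + 2) • e (i + 1) := by
  have h0 := he 0
  have h1 := he 1
  have h2 := he 2
  simp only [Fin.reduceAdd, Fin.isValue, zero_add] at h0 h1 h2
  rw [sub_eq_iff_eq_add] at h0 h1 h2
  fin_cases i
  · simp [Fin.sum_univ_three, add_mul, mul_add, h0, h2]
    module
  · simp [Fin.sum_univ_three, add_mul, mul_add, h0, h1]
    module
  · simp [Fin.sum_univ_three, add_mul, mul_add, h1, h2]
    module

/-- The double cross product formula for `u = ∑ x_j e_j`. It gives both the recursion for words and
the parallelism of the trace fields in `tr_parallel`. -/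
theorem lie_lie_sum_smul (he : ∀ i, e i * e (i + 1) - e (i + 1) * e i = -e (i + 2)) (i : Fin 3) :
    (∑ j, x j • e j) * ((∑ j, x j • e j) * e i - e i * ∑ j, x j • e j) -
      ((∑ j, x j • e j) * e i - e i * ∑ j, x j • e j) * (∑ j, x j • e j) =
      x i • (∑ j, x j • e j) - (∑ j, x j ^ 2) • e i := by
  have h := lie_sum_smul x he
  rw [h]
  have h2 : ∀ X : A, X * (x (i + 1) • e (i + 2) - x (i + 2) • e (i + 1)) -
      (x (i + 1) • e (i + 2) - x (i + 2) • e (i + 1)) * X =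
      x (i + 1) • (X * e (i + 2) - e (i + 2) * X) - x (i + 2) • (X * e (i + 1) - e (i + 1) * X) := by
    intro X
    simp only [mul_sub, sub_mul, mul_smul_comm, smul_mul_assoc, smul_sub]
    abel
  rw [h2, h, h]
  fin_cases i <;> simp [Fin.sum_univ_three] <;> module

/-- Put `S_a = ∑ e_i u^a e_i` and `T_a = ∑ [u, e_i] u^a e_i`. Then `S_{a+1} = u S_a - T_a` and
`T_{a+1} = u T_a - u^{a+2} + |x|² S_a`, with `S_0` the scalar Casimir and `T_0 = -u`. The two must
be carried together: both are polynomials in `u`, of degree at most `a` and `a + 1`. -/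
theorem words_mem_powSpan (he : ∀ i, e i * e (i + 1) - e (i + 1) * e i = -e (i + 2))
    (hc : ∑ i, e i * e i = c • (1 : A)) (a : ℕ) :
    ∑ i, e i * (∑ j, x j • e j) ^ a * e i ∈ powSpan (∑ j, x j • e j) (a + 1) ∧
    ∑ i, ((∑ j, x j • e j) * e i - e i * ∑ j, x j • e j) * (∑ j, x j • e j) ^ a * e i ∈
      powSpan (∑ j, x j • e j) (a + 2) := by
  have hf := lie_sum_smul x he
  have hff := lie_lie_sum_smul x he
  generalize hX1 : ∑ j, x j • e j = u at hf hff ⊢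
  induction a with
  | zero =>
    simp only [pow_zero, mul_one]
    refine ⟨?_, ?_⟩
    · rw [hc]
      exact Submodule.smul_mem _ _ (by simpa using pow_mem_powSpan u (b := 0) one_pos)
    · have h : ∑ i, (u * e i - e i * u) * e i = -u := by
        have h0 := he 0
        have h1 := he 1
        have h2 := he 2
        simp only [Fin.reduceAdd, Fin.isValue, zero_add] at h0 h1 h2
        rw [sub_eq_iff_eq_add] at h0 h1 h2
        simp only [hf]
        rw [← hX1]
        simp [Fin.sum_univ_three, sub_mul, h0, h1, h2]
        module
      rw [h]
      exact neg_mem (by simpa using pow_mem_powSpan u (b := 1) one_lt_two)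
  | succ a ih =>
    obtain ⟨hS, hT⟩ := ih
    refine ⟨?_, ?_⟩
    · have h : ∑ i, e i * u ^ (a + 1) * e i =
          u * ∑ i, e i * u ^ a * e i - ∑ i, (u * e i - e i * u) * u ^ a * e i := by
        rw [Finset.mul_sum, ← Finset.sum_sub_distrib]
        refine Finset.sum_congr rfl fun i _ => ?_
        rw [pow_succ']
        noncomm_ring
      rw [h]
      exact sub_mem (mul_mem_powSpan u hS) hT
    · have h : ∑ i, (u * e i - e i * u) * u ^ (a + 1) * e i =
          u * ∑ i, (u * e i - e i * u) * u ^ a * e i - u ^ (a + 2) +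
            (∑ j, x j ^ 2) • ∑ i, e i * u ^ a * e i := by
        have h1 : ∀ i, (u * e i - e i * u) * u ^ (a + 1) * e i =
            u * ((u * e i - e i * u) * u ^ a * e i) - u ^ (a + 1) * (x i • e i) +
              (∑ j, x j ^ 2) • (e i * u ^ a * e i) := by
          intro i
          have h2 : (u * e i - e i * u) * u =
              u * (u * e i - e i * u) - (x i • u - (∑ j, x j ^ 2) • e i) := by
            rw [← hff i]; abel
          rw [pow_succ', ← mul_assoc, h2, sub_mul, sub_mul, sub_mul, sub_mul, smul_mul_assoc,
            smul_mul_assoc, smul_mul_assoc, smul_mul_assoc, mul_smul_comm]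
          simp only [mul_assoc]
          abel
        rw [Finset.sum_congr rfl fun i _ => h1 i, Finset.sum_add_distrib, Finset.sum_sub_distrib,
          ← Finset.mul_sum, ← Finset.mul_sum, ← Finset.smul_sum, hX1, ← pow_succ]
      rw [h]
      exact add_mem (sub_mem (mul_mem_powSpan u hT) (pow_mem_powSpan u (by omega)))
        (Submodule.smul_mem _ _ (powSpan_mono u (by omega) hS))

end Words

/-! ### Vector fields parallel to the position vector -/

theorem hasFDerivAt_coord (x : E3) (i : Fin 3) :
    HasFDerivAt (fun x : E3 => (x i : ℂ))
      (Complex.ofRealCLM.comp (EuclideanSpace.proj i : E3 →L[ℝ] ℝ)) x :=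
  (Complex.ofRealCLM.comp (EuclideanSpace.proj i : E3 →L[ℝ] ℝ)).hasFDerivAt

theorem eq_sum_single (x : E3) : x = ∑ i, x i • (EuclideanSpace.single i 1 : E3) := by
  ext j
  simp [Pi.single_apply]

theorem clm_eq_sum {W : Type*} [NormedAddCommGroup W] [NormedSpace ℂ W] (L : E3 →L[ℝ] W) (x : E3) :
    L x = ∑ i, (x i : ℂ) • L (EuclideanSpace.single i 1) := by
  conv_lhs => rw [eq_sum_single x]
  simp only [map_sum, map_smul, Complex.coe_smul]

/-- If `v(x)` is parallel to `x` then `|x|² div v = T + x · ∇T` with `T = x · v`. -/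
theorem sq_mul_div_of_parallel {v : Fin 3 → E3 → ℂ} {T : E3 → ℂ}
    (hv : ∀ i, Differentiable ℝ (v i)) (hT : Differentiable ℝ T)
    (hTv : ∀ x, T x = ∑ i, (x i : ℂ) * v i x)
    (hpar : ∀ x i, (∑ j, (x j : ℂ) ^ 2) * v i x = x i * T x) (x : E3) :
    (∑ j, (x j : ℂ) ^ 2) * ∑ i, fderiv ℝ (v i) x (EuclideanSpace.single i 1) =
      T x + fderiv ℝ T x x := by
  have hsq : HasFDerivAt (fun x : E3 => ∑ j, (x j : ℂ) ^ 2)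
      (∑ j, (2 * (x j : ℂ)) • (Complex.ofRealCLM.comp (EuclideanSpace.proj j : E3 →L[ℝ] ℝ))) x := by
    refine HasFDerivAt.fun_sum fun j _ => ?_
    simpa using (hasFDerivAt_coord x j).pow 2
  -- This is `∂_i` of `|x|² v_i = x_i T`. Summing over `i` gives `3T + x·∇T - 2T`.
  have key : ∀ i, (∑ j, (x j : ℂ) ^ 2) * fderiv ℝ (v i) x (EuclideanSpace.single i 1) =
      T x + x i * fderiv ℝ T x (EuclideanSpace.single i 1) - 2 * (x i * v i x) := by
    intro i
    have h1 := hsq.mul (hv i x).hasFDerivAt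
    have h2 := (hasFDerivAt_coord x i).mul (hT x).hasFDerivAt
    have h3 : (fun y : E3 => (∑ j, (y j : ℂ) ^ 2) * v i y) = fun y => (y i : ℂ) * T y :=
      funext fun y => hpar y i
    change HasFDerivAt (fun y : E3 => (∑ j, (y j : ℂ) ^ 2) * v i y) _ x at h1
    rw [h3] at h1
    have h4 := congrArg (fun L : E3 →L[ℝ] ℂ => L (EuclideanSpace.single i 1)) (h1.unique h2)
    simp [sum_apply, apply_ite (Complex.ofReal)] at h4
    linear_combination h4
  rw [Finset.mul_sum, Finset.sum_congr rfl fun i _ => key i, Finset.sum_sub_distrib,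
    Finset.sum_add_distrib, ← Finset.mul_sum, ← hTv, clm_eq_sum (fderiv ℝ T x) x]
  simp
  ring

/-- Along a ray the hypothesis says that `t T(t x)` has derivative zero, and this function vanishes
at `t = 0`. -/
theorem eq_zero_of_euler {T : E3 → ℂ} (hT : Differentiable ℝ T)
    (h : ∀ x, T x + fderiv ℝ T x x = 0) (x : E3) : T x = 0 := by
  have hd : ∀ t : ℝ, HasDerivAt (fun t : ℝ => (t : ℂ) * T (t • x)) 0 t := by
    intro t
    have h1 : HasDerivAt (fun t : ℝ => T (t • x)) (fderiv ℝ T (t • x) x) t := by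
      have h2 : HasDerivAt (fun t : ℝ => t • x) x t := by simpa using (hasDerivAt_id t).smul_const x
      exact (hT (t • x)).hasFDerivAt.comp_hasDerivAt t h2
    refine (Complex.ofRealCLM.hasDerivAt.mul h1).congr_deriv ?_
    have h3 := h (t • x)
    rw [map_smul, ← Complex.coe_smul, smul_eq_mul] at h3
    simpa using h3
  have h0 := is_const_of_deriv_eq_zero (fun t => (hd t).differentiableAt)
    (fun t => (hd t).deriv) 1 0
  simpa using h0

/-! ### Radial solutions of the Helmholtz equation -/

theorem eq_zero_of_harmonic_oscillator {u u' : ℝ → ℂ} {s : ℝ} (hs : s ≠ 0)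
    (hu : ∀ t, HasDerivAt u (u' t) t) (hu' : ∀ t, HasDerivAt u' (-(s : ℂ) ^ 2 * u t) t)
    (h0 : u 0 = 0) (h0' : u' 0 = 0) (t : ℝ) : u t = 0 := by
  -- Factorization of the equation: `e^{-√-1 r t}(u' + √-1 r u)` is constant for `r = ±s`. The
  -- difference of the two cases isolates `u`.
  have key : ∀ r : ℝ, r ^ 2 = s ^ 2 → u' t + Complex.I * r * u t = 0 := by
    intro r hr
    have hr' : (r : ℂ) ^ 2 = (s : ℂ) ^ 2 := by exact_mod_cast hr
    have hd : ∀ t : ℝ, HasDerivAt (fun t : ℝ => Complex.exp (-Complex.I * r * t) *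
        (u' t + Complex.I * r * u t)) 0 t := by
      intro t
      have h1 : HasDerivAt (fun t : ℝ => Complex.exp (-Complex.I * r * t))
          (Complex.exp (-Complex.I * r * t) * (-Complex.I * r * 1)) t :=
        ((Complex.ofRealCLM.hasDerivAt (x := t)).const_mul (-Complex.I * r)).cexp
      refine (h1.mul ((hu' t).add ((hu t).const_mul (Complex.I * r)))).congr_deriv ?_
      simp only [Pi.add_apply]
      linear_combination Complex.exp (-Complex.I * r * t) * u t * hr' -
        Complex.exp (-Complex.I * r * t) * r ^ 2 * u t * Complex.I_mul_I
    have h2 := is_const_of_deriv_eq_zero (fun t => (hd t).differentiableAt)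
      (fun t => (hd t).deriv) t 0
    simp only [h0, h0', mul_zero, add_zero] at h2
    exact (mul_eq_zero.1 h2).resolve_left (Complex.exp_ne_zero _)
  have h1 := key s rfl
  have h2 := key (-s) (by ring)
  have h3 : (2 * Complex.I * s) * u t = 0 := by
    push_cast at h2
    linear_combination h1 - h2
  refine (mul_eq_zero.1 h3).resolve_left ?_
  simp [Complex.I_ne_zero, hs]

/-- The half-turn about the axis of `x` fixes `x` and preserves `f`, so the differential at `x`
agrees on `v` and on `2⟨x,v⟩x/|x|² - v`. -/
theorem fderiv_parallel_of_radial {f : E3 → ℂ} (hf : Differentiable ℝ f)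
    (hrot : ∀ (k : SO3) x, f (rot k x) = f x) (x : E3) (i : Fin 3) :
    (∑ j, (x j : ℂ) ^ 2) * fderiv ℝ f x (EuclideanSpace.single i 1) = x i * fderiv ℝ f x x := by
  rcases eq_or_ne x 0 with rfl | hx
  · simp
  have hn : ‖x‖ ≠ 0 := norm_ne_zero_iff.2 hx
  have hu : ‖‖x‖⁻¹ • x‖ = 1 := by rw [norm_smul, norm_inv, norm_norm, inv_mul_cancel₀ hn]
  have hk : ∀ v, rot (halfTurn _ hu) v = (2 * (‖x‖ ^ 2)⁻¹ * inner ℝ x v) • x - v := fun v => by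
    rw [rot_halfTurn, inner_smul_left, smul_smul]
    congr 2
    simp only [conj_trivial]
    field_simp
  have hkx : rot (halfTurn _ hu) x = x := by
    rw [hk, real_inner_self_eq_norm_sq, mul_assoc, inv_mul_cancel₀ (by positivity), mul_one,
      two_smul, add_sub_cancel_right]
  have h1 : fderiv ℝ f x (rot (halfTurn _ hu) (EuclideanSpace.single i 1)) =
      fderiv ℝ f x (EuclideanSpace.single i 1) := by
    have h2 : HasFDerivAt f (fderiv ℝ f x) (rot (halfTurn _ hu) x) := by
      rw [hkx]; exact (hf x).hasFDerivAt
    have h3 := h2.comp x (rot (halfTurn _ hu)).hasFDerivAt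
    have h4 : f ∘ rot (halfTurn _ hu) = f := funext fun y => hrot _ y
    rw [h4] at h3
    exact congrArg (fun L : E3 →L[ℝ] ℂ => L (EuclideanSpace.single i 1))
      (h3.unique (hf x).hasFDerivAt)
  rw [hk, map_sub, map_smul, EuclideanSpace.inner_single_right, ← Complex.coe_smul, smul_eq_mul] at h1
  have hsq : (∑ j, (x j : ℂ) ^ 2) = (‖x‖ : ℂ) ^ 2 := by
    have := congrArg (fun r : ℝ => (r : ℂ)) (EuclideanSpace.real_norm_sq_eq x)
    push_cast at this
    exact this.symm
  have hn' : (‖x‖ : ℂ) ≠ 0 := by exact_mod_cast hn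
  rw [hsq]
  push_cast at h1
  simp only [conj_trivial, one_mul] at h1
  field_simp at h1
  linear_combination -h1 / 2

/-- The classical substitution: for a unit vector `x`, `u(t) = t f(t x)` satisfies `u'' = -s² u`,
with `u(0) = 0` and `u'(0) = f(0) = 0`. The radial form of `Δ` comes from `sq_mul_div_of_parallel`
applied to the gradient of `f`. -/
theorem eq_zero_of_radial_helmholtz {s : ℝ} (hs : s ≠ 0) (f : Smooth ℂ)
    (hrot : ∀ (k : SO3) x, f.1 (rot k x) = f.1 x) (hlap : lap f = (-(s : ℂ) ^ 2) • f)
    (h0 : f.1 0 = 0) : f = 0 := by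
  have hfd : Differentiable ℝ f.1 := (Smooth.contDiff f).differentiable (by simp)
  have hpd : ∀ i, Differentiable ℝ (pd i f).1 := fun i =>
    (Smooth.contDiff (pd i f)).differentiable (by simp)
  set T : E3 → ℂ := fun x => ∑ i, (x i : ℂ) * (pd i f).1 x with hTdef
  have hTc : ContDiff ℝ ∞ T := by
    refine ContDiff.sum fun i _ => ?_
    exact ((Complex.ofRealCLM.comp (EuclideanSpace.proj i : E3 →L[ℝ] ℝ)).contDiff).mul
      (Smooth.contDiff (pd i f))
  have hTd : Differentiable ℝ T := hTc.differentiable (by simp)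
  have hTf : ∀ x, T x = fderiv ℝ f.1 x x := fun x => (clm_eq_sum (fderiv ℝ f.1 x) x).symm
  have key := sq_mul_div_of_parallel hpd hTd (fun x => rfl) fun x i => by
    rw [hTf]; exact fderiv_parallel_of_radial hfd hrot x i
  have hl : ∀ x, ∑ i, fderiv ℝ (pd i f).1 x (EuclideanSpace.single i 1) = -(s : ℂ) ^ 2 * f.1 x := by
    intro x
    have h1 := congrArg (fun g : Smooth ℂ => g.1 x) hlap
    simp only [lap, LinearMap.sum_apply, AddSubmonoidClass.coe_finsetSum, Finset.sum_apply] at h1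
    exact h1
  have hx : ∀ x : E3, ‖x‖ = 1 → ∀ t : ℝ, (t : ℂ) * f.1 (t • x) = 0 := by
    intro x hx
    have hsm : ∀ t : ℝ, HasDerivAt (fun t : ℝ => t • x) x t := fun t => by
      simpa using (hasDerivAt_id t).smul_const x
    have hf' : ∀ t : ℝ, HasDerivAt (fun t : ℝ => f.1 (t • x)) (fderiv ℝ f.1 (t • x) x) t :=
      fun t => (hfd (t • x)).hasFDerivAt.comp_hasDerivAt t (hsm t)
    have hT' : ∀ t : ℝ, HasDerivAt (fun t : ℝ => T (t • x)) (fderiv ℝ T (t • x) x) t :=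
      fun t => HasFDerivAt.comp_hasDerivAt (l := T) t (hTd (t • x)).hasFDerivAt (hsm t)
    have hTt : ∀ t : ℝ, T (t • x) = t * fderiv ℝ f.1 (t • x) x := fun t => by
      rw [hTf, map_smul, ← Complex.coe_smul, smul_eq_mul]
    have hsum : ∑ j, (x j : ℂ) ^ 2 = 1 := by
      have := congrArg (fun r : ℝ => (r : ℂ)) (EuclideanSpace.real_norm_sq_eq x)
      rw [hx] at this
      push_cast at this
      rw [← this]; norm_num
    have hode : ∀ t : ℝ, fderiv ℝ f.1 (t • x) x + fderiv ℝ T (t • x) x =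
        -(s : ℂ) ^ 2 * (t * f.1 (t • x)) := by
      have hcont1 : Continuous fun t : ℝ =>
          fderiv ℝ f.1 (t • x) x + fderiv ℝ T (t • x) x := by
        have h1 := (Smooth.contDiff f).continuous_fderiv (by simp)
        have h2 := hTc.continuous_fderiv (by simp)
        fun_prop
      have hcont2 : Continuous fun t : ℝ => -(s : ℂ) ^ 2 * (t * f.1 (t • x)) := by
        have h1 := hfd.continuous
        fun_prop
      -- The divergence identity carries a spare factor `t`. It is cancelled for `t ≠ 0`, and
      -- continuity covers `t = 0`.
      refine congrFun (Continuous.ext_on (dense_compl_singleton (0 : ℝ)) hcont1 hcont2 ?_)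
      intro t ht
      have ht' : (t : ℂ) ≠ 0 := by exact_mod_cast ht
      have h1 := key (t • x)
      rw [hl, hTt, map_smul, ← Complex.coe_smul, smul_eq_mul] at h1
      have h2 : ∑ j, (((t • x) j : ℝ) : ℂ) ^ 2 = (t : ℂ) ^ 2 := by
        simp only [PiLp.smul_apply, smul_eq_mul, Complex.ofReal_mul, mul_pow, ← Finset.mul_sum, hsum,
          mul_one]
      rw [h2] at h1
      refine mul_left_cancel₀ ht' ?_
      linear_combination -h1
    refine eq_zero_of_harmonic_oscillator (u' := fun t => f.1 (t • x) + T (t • x)) hs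
      (fun t => ?_) (fun t => ?_) (by simp) ?_
    · refine (Complex.ofRealCLM.hasDerivAt.mul (hf' t)).congr_deriv ?_
      rw [hTt]; simp
    · exact ((hf' t).add (hT' t)).congr_deriv (hode t)
    · simp [h0, hTf]
  refine Subtype.ext (funext fun y => ?_)
  rcases eq_or_ne y 0 with rfl | hy
  · exact h0
  have hn : ‖y‖ ≠ 0 := norm_ne_zero_iff.2 hy
  have h1 := hx (‖y‖⁻¹ • y) (by rw [norm_smul, norm_inv, norm_norm, inv_mul_cancel₀ hn]) ‖y‖
  rw [smul_smul, mul_inv_cancel₀ hn, one_smul] at h1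
  exact (mul_eq_zero.1 h1).resolve_left (by exact_mod_cast hn)

/-! ### Uniqueness of equivariant solutions -/

section

variable {W W' : Type*} [NormedAddCommGroup W] [NormedSpace ℂ W] [NormedAddCommGroup W']
  [NormedSpace ℂ W']

/-- Composition of smooth functions with a fixed linear map. -/
def post (A : W →L[ℂ] W') : Smooth W →ₗ[ℂ] Smooth W' where
  toFun f := ⟨fun x => A (f.1 x), (A.restrictScalars ℝ).contDiff.comp (Smooth.contDiff f)⟩
  map_add' f g := by ext x; exact map_add A _ _
  map_smul' c f := by ext x; exact map_smul A _ _

theorem pd_post (A : W →L[ℂ] W') (i : Fin 3) (f : Smooth W) : pd i (post A f) = post A (pd i f) := by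
  refine Subtype.ext (funext fun x => ?_)
  have h1 := ((A.restrictScalars ℝ).hasFDerivAt).comp x
    ((Smooth.contDiff f).differentiable (by simp) x).hasFDerivAt
  exact congrArg (fun L : E3 →L[ℝ] W' => L (EuclideanSpace.single i 1)) h1.fderiv

theorem pd_coef (A : W →L[ℂ] W) (i : Fin 3) (f : Smooth W) :
    pd i (coef A f) = coef A (pd i f) := pd_post A i f

theorem pd_comm (i j : Fin 3) (f : Smooth W) : pd i (pd j f) = pd j (pd i f) := by
  have h : ∀ (i j : Fin 3) x, (pd i (pd j f)).1 x =
      fderiv ℝ (fderiv ℝ f.1) x (EuclideanSpace.single i 1) (EuclideanSpace.single j 1) := by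
    intro i j x
    have hd : DifferentiableAt ℝ (fderiv ℝ f.1) x :=
      ((Smooth.contDiff f).fderiv_right (m := ∞) le_rfl).differentiable (by simp) x
    change fderiv ℝ (fun y => fderiv ℝ f.1 y (EuclideanSpace.single j 1)) x _ = _
    rw [fderiv_clm_apply hd (differentiableAt_const _)]
    simp
  refine Subtype.ext (funext fun x => ?_)
  rw [h, h]
  have hs : IsSymmSndFDerivAt ℝ f.1 x :=
    (Smooth.contDiff f).contDiffAt.isSymmSndFDerivAt (by
      rw [minSmoothness_of_isRCLikeNormedField]
      exact WithTop.coe_le_coe.2 le_top)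
  exact hs _ _

theorem lap_post (A : W →L[ℂ] W') (f : Smooth W) : lap (post A f) = post A (lap f) := by
  simp only [lap, LinearMap.sum_apply, Module.End.mul_apply, pd_post, map_sum]

theorem lap_firstOrder (ε : Fin 3 → (W →L[ℂ] W)) (f : Smooth W) :
    lap (firstOrder ε f) = firstOrder ε (lap f) := by
  simp only [lap, firstOrder, LinearMap.sum_apply, Module.End.mul_apply, map_sum, pd_coef]
  rw [Finset.sum_comm]
  refine Finset.sum_congr rfl fun i _ => Finset.sum_congr rfl fun j _ => ?_
  rw [pd_comm i j f, pd_comm i j (pd i f)]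

end

section

variable {V : Type*} [NormedAddCommGroup V] [NormedSpace ℂ V]

/-- The representation `B ↦ τ(k) B τ(k)⁻¹` on `End(V)`. -/
def conjRep (τ : SO3 →* (V →L[ℂ] V)) : SO3 →* ((V →L[ℂ] V) →L[ℂ] (V →L[ℂ] V)) where
  toFun k := (ContinuousLinearMap.mul ℂ (V →L[ℂ] V) (τ k)).comp
    ((ContinuousLinearMap.mul ℂ (V →L[ℂ] V)).flip (τ k⁻¹))
  map_one' := by
    refine ContinuousLinearMap.ext fun B => ?_
    change τ 1 * (B * τ 1⁻¹) = B
    rw [inv_one, map_one, mul_one, one_mul]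
  map_mul' k l := by
    refine ContinuousLinearMap.ext fun B => ?_
    change τ (k * l) * (B * τ (k * l)⁻¹) = τ k * (τ l * (B * τ l⁻¹) * τ k⁻¹)
    rw [mul_inv_rev, map_mul, map_mul]
    simp only [mul_assoc]

theorem conjRep_apply (τ : SO3 →* (V →L[ℂ] V)) (k : SO3) (B : V →L[ℂ] V) :
    conjRep τ k B = τ k * B * τ k⁻¹ := (mul_assoc _ _ _).symm

theorem IsEquiv.commStab {τ : SO3 →* (V →L[ℂ] V)} {Φ : E3 → (V →L[ℂ] V)}
    (h : IsEquiv (conjRep τ) Φ) (x : E3) : CommStab τ x (Φ x) := by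
  intro g hg
  have h1 := h g x
  rw [hg, conjRep_apply] at h1
  conv_lhs => rw [h1]
  rw [mul_assoc, ← map_mul, inv_mul_cancel, map_one, mul_one]

theorem isEquiv_iff_kAct {W : Type*} [NormedAddCommGroup W] [NormedSpace ℂ W]
    (ρ : SO3 →* (W →L[ℂ] W)) (f : Smooth W) : IsEquiv ρ f.1 ↔ ∀ k, kAct ρ k f = f := by
  constructor
  · intro h k
    refine Subtype.ext (funext fun x => ?_)
    change ρ k (f.1 (rot k⁻¹ x)) = f.1 x
    rw [← h, rot_rot_inv]
  · intro h k x
    have h1 := congrArg (fun g : Smooth W => g.1 (rot k x)) (h k)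
    change ρ k (f.1 (rot k⁻¹ (rot k x))) = f.1 (rot k x) at h1
    rw [← h1, rot_inv_rot]

end

/-- Left multiplication by `dτ_m(Y_i)`. -/
def leftMul (m : ℕ) (i : Fin 3) : (H m →L[ℂ] H m) →L[ℂ] (H m →L[ℂ] H m) :=
  ContinuousLinearMap.mul ℂ (H m →L[ℂ] H m) (dtauY m i)

/-- The operator `D_τ` on `End(H_m)`-valued functions. -/
def DtauEnd (m : ℕ) : Module.End ℂ (Smooth (H m →L[ℂ] H m)) := firstOrder (leftMul m)

theorem conjRep_mul_leftMul (m : ℕ) (k : SO3) (a : Fin 3) :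
    conjRep (tau m) k * leftMul m a =
      (∑ i, (k.1 i a : ℂ) • leftMul m i) * conjRep (tau m) k := by
  refine ContinuousLinearMap.ext fun B => ?_
  have h := tau_mul_dtauY m k a
  simp only [mul_apply_eq_comp, sum_apply, smul_apply, conjRep_apply]
  change tau m k * (dtauY m a * B) * tau m k⁻¹ =
    ∑ i, (k.1 i a : ℂ) • (dtauY m i * (tau m k * B * tau m k⁻¹))
  rw [← mul_assoc (tau m k), h]
  simp only [Finset.sum_mul, smul_mul_assoc, mul_assoc]

theorem IsEquiv.DtauEnd {m : ℕ} {f : Smooth (H m →L[ℂ] H m)}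
    (h : IsEquiv (conjRep (tau m)) f.1) : IsEquiv (conjRep (tau m)) (DtauEnd m f).1 := by
  rw [isEquiv_iff_kAct] at h ⊢
  intro k
  have h1 := LinearMap.congr_fun (kAct_firstOrder (conjRep (tau m)) (leftMul m)
    (conjRep_mul_leftMul m) k) f
  simp only [Module.End.mul_apply, h k] at h1
  exact h1

theorem IsEquiv.DtauEnd_pow {m : ℕ} {f : Smooth (H m →L[ℂ] H m)}
    (h : IsEquiv (conjRep (tau m)) f.1) (l : ℕ) :
    IsEquiv (conjRep (tau m)) ((TauSph.DtauEnd m ^ l) f).1 := by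
  induction l with
  | zero => exact h
  | succ l ih => rw [pow_succ', Module.End.mul_apply]; exact ih.DtauEnd

/-! ### Traces against powers of `dτ_m(x)` -/

theorem hasFDerivAt_dtau (m : ℕ) (x : E3) :
    HasFDerivAt (dtau m) (∑ i, (Complex.ofRealCLM.comp
      (EuclideanSpace.proj i : E3 →L[ℝ] ℝ)).smulRight (dtauY m i)) x := by
  have h := (∑ i, (Complex.ofRealCLM.comp
      (EuclideanSpace.proj i : E3 →L[ℝ] ℝ)).smulRight (dtauY m i)).hasFDerivAt (x := x)
  refine h.congr_of_eventuallyEq (Filter.Eventually.of_forall fun y => ?_)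
  simp [dtau, sum_apply]

theorem fderiv_dtau (m : ℕ) (x : E3) (i : Fin 3) :
    fderiv ℝ (dtau m) x (EuclideanSpace.single i 1) = dtauY m i := by
  rw [(hasFDerivAt_dtau m x).fderiv]
  simp [sum_apply, apply_ite Complex.ofReal]

theorem differentiable_dtau (m : ℕ) : Differentiable ℝ (dtau m) :=
  fun x => (hasFDerivAt_dtau m x).differentiableAt

theorem differentiable_dtau_pow (m a : ℕ) : Differentiable ℝ fun x => dtau m x ^ a := by
  induction a with
  | zero => simp
  | succ a ih =>
    simp only [pow_succ']
    exact (differentiable_dtau m).mul ih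

theorem dtau_words (m : ℕ) (x : E3) (a : ℕ) :
    ∑ i, dtauY m i * dtau m x ^ a * dtauY m i ∈ powSpan (dtau m x) (a + 1) :=
  (words_mem_powSpan (fun i => (x i : ℂ)) (dtauY_comm m) (dtauY_casimir m) a).1

/-- Leibniz turns the sum into words `u^b (∑ e_i u^{a-1-b} e_i)` with `u = dτ_m(x)`. Each has degree
at most `a - 1` in `u`, and this drop is what makes the induction in `tr_pow_succ_eq_zero` possible.
-/
theorem sum_fderiv_dtau_pow_mem (m a : ℕ) (x : E3) :
    ∑ i, fderiv ℝ (fun x => dtau m x ^ a) x (EuclideanSpace.single i 1) * dtauY m i ∈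
      powSpan (dtau m x) a := by
  induction a with
  | zero => simp
  | succ a ih =>
    have h : ∀ i, fderiv ℝ (fun x => dtau m x ^ (a + 1)) x (EuclideanSpace.single i 1) =
        dtau m x * fderiv ℝ (fun x => dtau m x ^ a) x (EuclideanSpace.single i 1) +
          dtauY m i * dtau m x ^ a := by
      intro i
      have h1 := ((differentiable_dtau m x).hasFDerivAt.mul'
        (differentiable_dtau_pow m a x).hasFDerivAt).fderiv
      have h2 : (dtau m * fun x => dtau m x ^ a) = fun x => dtau m x ^ (a + 1) :=
        funext fun y => (pow_succ' _ _).symm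
      rw [h2] at h1
      rw [h1, ← fderiv_dtau m x i]
      rfl
    simp only [h, add_mul, Finset.sum_add_distrib, mul_assoc, ← Finset.mul_sum]
    refine add_mem (mul_mem_powSpan _ ih) ?_
    simpa only [mul_assoc] using dtau_words m x a

theorem tr_eq_zero_of_mem_powSpan {m n : ℕ} {x : E3} {A B : H m →L[ℂ] H m}
    (hA : A ∈ powSpan (dtau m x) n) (h : ∀ b < n, tr (dtau m x ^ b * B) = 0) : tr (A * B) = 0 := by
  induction hA using Submodule.span_induction with
  | mem b hb => obtain ⟨k, hk, rfl⟩ := hb; exact h k hk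
  | zero => simp
  | add b c _ _ hb hc => rw [add_mul, map_add, hb, hc, add_zero]
  | smul r b _ hb => rw [smul_mul_assoc, map_smul, hb, smul_zero]

theorem fderiv_tr_mul {V : Type*} [NormedAddCommGroup V] [NormedSpace ℂ V]
    [FiniteDimensional ℂ V] {A B : E3 → (V →L[ℂ] V)} (hA : Differentiable ℝ A)
    (hB : Differentiable ℝ B) (c : V →L[ℂ] V) (x v : E3) :
    fderiv ℝ (fun x => tr (A x * c * B x)) x v =
      tr (fderiv ℝ A x v * c * B x) + tr (A x * (c * fderiv ℝ B x v)) := by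
  have e1 : HasFDerivAt (fun x => A x * c * B x) _ x :=
    ((hA x).hasFDerivAt.mul_const' c).mul' (hB x).hasFDerivAt
  have e2 : HasFDerivAt (fun x => tr (A x * c * B x)) _ x :=
    ((tr (V := V)).restrictScalars ℝ).hasFDerivAt.comp x e1
  rw [e2.fderiv, add_comm, ← map_add, ← mul_assoc]
  rfl

theorem tr_pow_mul_lie_mul {V : Type*} [NormedAddCommGroup V] [NormedSpace ℂ V]
    [FiniteDimensional ℂ V] {u B : V →L[ℂ] V} (hc : u * B = B * u) (a : ℕ) (f : V →L[ℂ] V) :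
    tr (u ^ a * (u * f - f * u) * B) = 0 := by
  have e1 : tr (u ^ a * (f * u) * B) = tr (u ^ a * (u * f) * B) := by
    calc tr (u ^ a * (f * u) * B) = tr ((u ^ a * f * B) * u) := by
          congr 1; simp only [mul_assoc, hc]
      _ = tr (u * (u ^ a * f * B)) := tr_mul_comm _ _
      _ = _ := by congr 1; simp only [← mul_assoc, ← pow_succ', ← pow_succ]
  rw [mul_sub, sub_mul, map_sub, e1, sub_self]

/-- When `B` commutes with `u`, cyclicity gives `Tr(u^a [u, f] B) = 0`. Taking `f = [u, e]` and
inserting the formula for the double commutator yields the relation. -/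
theorem tr_parallel {V : Type*} [NormedAddCommGroup V] [NormedSpace ℂ V]
    [FiniteDimensional ℂ V] {u e B : V →L[ℂ] V} {c d : ℂ} (hc : u * B = B * u) (a : ℕ)
    (h : u * (u * e - e * u) - (u * e - e * u) * u = c • u - d • e) :
    d * tr (u ^ a * e * B) = c * tr (u ^ (a + 1) * B) := by
  have h3 := tr_pow_mul_lie_mul hc a (u * e - e * u)
  rw [h, mul_sub, sub_mul, map_sub, mul_smul_comm, mul_smul_comm, smul_mul_assoc,
    smul_mul_assoc, map_smul, map_smul, ← pow_succ, smul_eq_mul, smul_eq_mul] at h3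
  exact (sub_eq_zero.1 h3).symm

theorem dtau_lie_lie (m : ℕ) (x : E3) (i : Fin 3) :
    dtau m x * (dtau m x * dtauY m i - dtauY m i * dtau m x) -
      (dtau m x * dtauY m i - dtauY m i * dtau m x) * dtau m x =
      (x i : ℂ) • dtau m x - (∑ j, (x j : ℂ) ^ 2) • dtauY m i := by
  have h := lie_lie_sum_smul (fun i => (x i : ℂ)) (dtauY_comm m) i
  rw [dtau]
  exact h

/-- The field `v_i = Tr(dτ_m(x)^a dτ_m(Y_i) Ψ)` is parallel to `x`, and `x·v` is the trace `T` in
the conclusion. Its divergence is a combination of traces with lower powers, zero by `h1`, plus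
`Tr(dτ_m(x)^a D_τ Ψ)`, zero by `h2`. Hence `T + x·∇T = 0`, and `T = 0`. -/
theorem tr_pow_succ_eq_zero {m : ℕ} (Ψ : Smooth (H m →L[ℂ] H m))
    (hΨ : IsEquiv (conjRep (tau m)) Ψ.1) (a : ℕ)
    (h1 : ∀ b < a, ∀ x, tr (dtau m x ^ b * Ψ.1 x) = 0)
    (h2 : ∀ x, tr (dtau m x ^ a * (DtauEnd m Ψ).1 x) = 0) (x : E3) :
    tr (dtau m x ^ (a + 1) * Ψ.1 x) = 0 := by
  have hΨd : Differentiable ℝ Ψ.1 := (Smooth.contDiff Ψ).differentiable (by simp)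
  have htr : ∀ g : E3 → (H m →L[ℂ] H m), Differentiable ℝ g → Differentiable ℝ fun x => tr (g x) :=
    fun g hg => ((tr (V := H m)).restrictScalars ℝ).differentiable.comp hg
  have hT : Differentiable ℝ fun x => tr (dtau m x ^ (a + 1) * Ψ.1 x) :=
    htr _ ((differentiable_dtau_pow m (a + 1)).mul hΨd)
  have hw : ∀ i, Differentiable ℝ fun x => dtau m x ^ a * dtauY m i * Ψ.1 x := fun i =>
    ((differentiable_dtau_pow m a).mul (differentiable_const _)).mul hΨd
  refine eq_zero_of_euler hT (fun x => ?_) x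
  have key := sq_mul_div_of_parallel (v := fun i x => tr (dtau m x ^ a * dtauY m i * Ψ.1 x))
    (fun i => htr _ (hw i)) hT ?_ ?_ x
  · rw [← key]
    refine mul_eq_zero_of_right _ ?_
    have hd : ∀ i, fderiv ℝ (fun x => tr (dtau m x ^ a * dtauY m i * Ψ.1 x)) x
        (EuclideanSpace.single i 1) =
        tr (fderiv ℝ (fun x => dtau m x ^ a) x (EuclideanSpace.single i 1) * dtauY m i * Ψ.1 x) +
        tr (dtau m x ^ a * (dtauY m i * fderiv ℝ Ψ.1 x (EuclideanSpace.single i 1))) := by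
      exact fun i => fderiv_tr_mul (differentiable_dtau_pow m a) hΨd _ x _
    simp only [hd, Finset.sum_add_distrib, ← map_sum, ← Finset.sum_mul, ← Finset.mul_sum]
    rw [tr_eq_zero_of_mem_powSpan (sum_fderiv_dtau_pow_mem m a x) (fun b hb => h1 b hb x), zero_add]
    have h3 := h2 x
    rw [DtauEnd, firstOrder_apply] at h3
    exact h3
  · intro x
    simp only [dtau, pow_succ, Finset.mul_sum, Finset.sum_mul, map_sum, mul_smul_comm,
      smul_mul_assoc, map_smul, smul_eq_mul]
  · intro x i
    exact tr_parallel (hΨ.commStab x).commute_dtau a (dtau_lie_lie m x i)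

theorem eq_zero_of_tr_DtauEnd_pow {m : ℕ} (Ψ : Smooth (H m →L[ℂ] H m))
    (hΨ : IsEquiv (conjRep (tau m)) Ψ.1)
    (h : ∀ l ≤ 2 * m, ∀ x, tr (((DtauEnd m ^ l) Ψ).1 x) = 0) : Ψ = 0 := by
  -- Strong induction on `a`, for all `l` at once: the case `(a + 1, l)` uses `(b, l)` with `b < a`
  -- and `(a, l + 1)`, so `a + l` never exceeds `2m`.
  have key : ∀ a l, a + l ≤ 2 * m → ∀ x, tr (dtau m x ^ a * ((DtauEnd m ^ l) Ψ).1 x) = 0 := by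
    intro a
    induction a using Nat.strong_induction_on with
    | _ a ih =>
      intro l hl
      rcases a with _ | a
      · intro x
        rw [pow_zero, one_mul]
        exact h l (by omega) x
      · refine tr_pow_succ_eq_zero _ (hΨ.DtauEnd_pow l) a
          (fun b hb => ih b (by omega) l (by omega)) ?_
        rw [← Module.End.mul_apply, ← pow_succ']
        exact ih a (by omega) (l + 1) (by omega)
  -- At the origin `dτ_m(x) = 0` and the traces do not separate the weights; continuity settles that
  -- point.
  refine Subtype.ext (Continuous.ext_on (dense_compl_singleton (0 : E3))
    (Smooth.contDiff Ψ).continuous continuous_const fun x hx => ?_)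
  exact (hΨ.commStab x).eq_zero_of_tr hx fun a ha => key a 0 (by omega) x

/-! ### Fourier transforms of equivariant functions -/

section

variable {V : Type*} [NormedAddCommGroup V] [NormedSpace ℂ V]

theorem planeWave_add (s : ℝ) (x y : E3) (ξ : S2) :
    planeWave s (x + y) ξ = planeWave s x ξ * planeWave s y ξ := by
  rw [planeWave, planeWave, planeWave, ← Complex.exp_add, inner_add_left]
  congr 1
  push_cast
  ring

/-- The Fourier transform `∫ e^{√-1 s⟨x,ξ⟩} F(x) dx` on the sphere of radius `s`. -/
def ft (s : ℝ) (F : E3 → (V →L[ℂ] V)) (ξ : S2) : V →L[ℂ] V :=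
  ∫ x, planeWave s (-x) ξ • F x

theorem continuous_planeWave_neg (s : ℝ) (ξ : S2) : Continuous fun x => planeWave s (-x) ξ := by
  unfold planeWave
  fun_prop

theorem integrable_planeWave_smul {W : Type*} [NormedAddCommGroup W] [NormedSpace ℂ W] (s : ℝ)
    {F : E3 → W} (hF : Integrable F) (ξ : S2) : Integrable fun x => planeWave s (-x) ξ • F x := by
  refine hF.mono ((continuous_planeWave_neg s ξ).aestronglyMeasurable.smul hF.1)
    (Filter.Eventually.of_forall fun x => ?_)
  rw [norm_smul, norm_planeWave, one_mul]

theorem ae_comp_sub_left {p : E3 → Prop} (h : ∀ᵐ y : E3, p y) (x : E3) : ∀ᵐ y : E3, p (x - y) :=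
  (Measure.measurePreserving_sub_left volume x).quasiMeasurePreserving.ae h

theorem MemL1.conv [CompleteSpace V] {τ : SO3 →* (V →L[ℂ] V)} {F G : E3 → (V →L[ℂ] V)}
    (hF : MemL1 τ F) (hG : MemL1 τ G) : MemL1 τ (conv F G) := by
  -- `∫ F(x - y) G(y) dy` is the convolution of `G` with `F` for the flipped product, since the
  -- shifted argument belongs to the second factor there.
  have hL := hG.1.ae_convolution_exists (ContinuousLinearMap.mul ℂ (V →L[ℂ] V)).flip hF.1
  refine ⟨hG.1.integrable_convolution (ContinuousLinearMap.mul ℂ (V →L[ℂ] V)).flip hF.1,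
    fun k => ?_⟩
  filter_upwards [hL] with x hi
  rw [TauSph.conv, TauSph.conv, ← (rotIso k).measurePreserving.integral_comp
    (rotIso k).toHomeomorph.measurableEmbedding, ← conjRep_apply]
  change Integrable (fun y => F (x - y) * G y) at hi
  rw [← ContinuousLinearMap.integral_comp_comm _ hi]
  refine integral_congr_ae ?_
  filter_upwards [ae_comp_sub_left (hF.2 k) x, hG.2 k] with y h1 h2
  change F (rot k x - rot k y) * G (rot k y) = _
  rw [← map_sub, h1, h2, conjRep_apply]
  have h3 : τ k⁻¹ * τ k = 1 := by rw [← map_mul, inv_mul_cancel, map_one]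
  calc τ k * F (x - y) * τ k⁻¹ * (τ k * G y * τ k⁻¹)
      = τ k * F (x - y) * (τ k⁻¹ * τ k) * (G y * τ k⁻¹) := by simp only [mul_assoc]
    _ = _ := by rw [h3, mul_one]; simp only [mul_assoc]

theorem ft_conv [CompleteSpace V] (s : ℝ) {F G : E3 → (V →L[ℂ] V)} (hF : Integrable F)
    (hG : Integrable G) (ξ : S2) : ft s (conv F G) ξ = ft s F ξ * ft s G ξ := by
  have h := integral_convolution (ContinuousLinearMap.mul ℂ (V →L[ℂ] V)).flip
    (integrable_planeWave_smul s hG ξ) (integrable_planeWave_smul s hF ξ)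
    (μ := (volume : Measure E3)) (ν := (volume : Measure E3))
  refine Eq.trans ?_ h
  refine integral_congr_ae (Filter.Eventually.of_forall fun x => ?_)
  change planeWave s (-x) ξ • (∫ y, F (x - y) * G y) = ∫ y,
    (planeWave s (-(x - y)) ξ • F (x - y)) * (planeWave s (-y) ξ • G y)
  rw [← integral_smul]
  refine integral_congr_ae (Filter.Eventually.of_forall fun y => ?_)
  simp only [smul_mul_assoc, mul_smul_comm, smul_smul, ← planeWave_add]
  congr 2
  abel

theorem ft_rot [CompleteSpace V] (s : ℝ) {τ : SO3 →* (V →L[ℂ] V)} {F : E3 → (V →L[ℂ] V)}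
    (hF : MemL1 τ F) (k : SO3) (ξ : S2) : ft s F (rotS k ξ) = conjRep τ k (ft s F ξ) := by
  rw [ft, ft, ← (rotIso k).measurePreserving.integral_comp
    (rotIso k).toHomeomorph.measurableEmbedding,
    ← ContinuousLinearMap.integral_comp_comm _ (integrable_planeWave_smul s hF.1 ξ)]
  refine integral_congr_ae ?_
  filter_upwards [hF.2 k] with x hx
  change planeWave s (-(rot k x)) _ • F (rot k x) = _
  rw [← map_neg, planeWave_rot, hx, map_smul, conjRep_apply]

theorem ft_commStab [CompleteSpace V] (s : ℝ) {τ : SO3 →* (V →L[ℂ] V)} {F : E3 → (V →L[ℂ] V)}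
    (hF : MemL1 τ F) (ξ : S2) : CommStab τ ξ.1 (ft s F ξ) := by
  intro g hg
  have h := ft_rot s hF g ξ
  rw [show rotS g ξ = ξ from Subtype.ext hg, conjRep_apply] at h
  conv_lhs => rw [h]
  rw [mul_assoc, ← map_mul, inv_mul_cancel, map_one, mul_one]

end

/-! ### Spherical functions from equivariant families of projections -/

section

variable {V : Type*} [NormedAddCommGroup V] [NormedSpace ℂ V] [FiniteDimensional ℂ V]

/-- A family of projections `P(ξ)`, `ξ ∈ S²`, that gives rise to spherical functions. -/
structure IsZonal (τ : SO3 →* (V →L[ℂ] V)) (P : C(S2, V →L[ℂ] V)) : Prop where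
  rot : ∀ k ξ, P (rotS k ξ) = conjRep τ k (P ξ)
  tr_eq : ∀ ξ, tr (P ξ) = 1
  tr_mul : ∀ ξ (B C : V →L[ℂ] V), CommStab τ ξ.1 B → CommStab τ ξ.1 C →
    tr (B * C * P ξ) = tr (B * P ξ) * tr (C * P ξ)

variable [CompleteSpace V]

/-- The spherical function `(dim V) ∫ e^{-√-1 s⟨x,ξ⟩} P(ξ) dσ(ξ)`. -/
def zonal (s : ℝ) (P : C(S2, V →L[ℂ] V)) : Smooth (V →L[ℂ] V) :=
  (Module.finrank ℂ V : ℂ) • smoothWave s sig P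

omit [FiniteDimensional ℂ V] in
theorem zonal_apply (s : ℝ) (P : C(S2, V →L[ℂ] V)) (x : E3) :
    (zonal s P).1 x = (Module.finrank ℂ V : ℂ) • ∫ ξ, planeWave s x ξ • P ξ ∂sig := rfl

omit [FiniteDimensional ℂ V] in
theorem isEquiv_zonal {τ : SO3 →* (V →L[ℂ] V)} {P : C(S2, V →L[ℂ] V)}
    (hP : ∀ k ξ, P (rotS k ξ) = conjRep τ k (P ξ)) (s : ℝ) : IsEquiv (conjRep τ) (zonal s P).1 := by
  intro k x
  change (Module.finrank ℂ V : ℂ) • (smoothWave s sig P).1 (rot k x) =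
    conjRep τ k ((Module.finrank ℂ V : ℂ) • (smoothWave s sig P).1 x)
  rw [isEquiv_wave (conjRep τ) s P hP, map_smul]

omit [FiniteDimensional ℂ V] in
theorem lap_zonal (s : ℝ) (P : C(S2, V →L[ℂ] V)) :
    lap (zonal s P) = (-(s : ℂ) ^ 2) • zonal s P := by
  rw [zonal, map_smul, lap_smoothWave, smul_comm]

theorem tr_zonal_zero {P : C(S2, V →L[ℂ] V)} (hP : ∀ ξ, tr (P ξ) = 1) (s : ℝ) :
    tr ((zonal s P).1 0) = Module.finrank ℂ V := by
  rw [zonal_apply, map_smul, ← ContinuousLinearMap.integral_comp_comm _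
    (integrable_wave s sig P.continuous 0)]
  simp [planeWave_zero, hP]

theorem memLinf_zonal {τ : SO3 →* (V →L[ℂ] V)} {P : C(S2, V →L[ℂ] V)}
    (hP : ∀ k ξ, P (rotS k ξ) = conjRep τ k (P ξ)) (s : ℝ) : MemLinf τ (zonal s P).1 := by
  refine ⟨?_, fun k => Filter.Eventually.of_forall fun x => ?_⟩
  · refine memLp_top_of_bound (Smooth.contDiff _).continuous.aestronglyMeasurable
      (‖(Module.finrank ℂ V : ℂ)‖ * ‖P‖) (Filter.Eventually.of_forall fun x => ?_)
    rw [zonal_apply, norm_smul]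
    gcongr
    refine (norm_integral_le_of_norm_le_const (C := ‖P‖)
      (Filter.Eventually.of_forall fun ξ => ?_)).trans ?_
    · rw [norm_smul, norm_planeWave, one_mul]
      exact P.norm_coe_le_norm ξ
    · simp
  · rw [isEquiv_zonal hP s, conjRep_apply]

/-- Fubini. The factor `dim V` in `zonal` cancels the `1/dim V` of the transform. -/
theorem sphTransform_zonal_eq_integral (hV : Module.finrank ℂ V ≠ 0) (s : ℝ)
    (P : C(S2, V →L[ℂ] V)) {F : E3 → (V →L[ℂ] V)} (hF : Integrable F) :
    sphTransform (zonal s P).1 F = ∫ ξ, tr (ft s F ξ * P ξ) ∂sig := by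
  have hV' : (Module.finrank ℂ V : ℂ) ≠ 0 := by exact_mod_cast hV
  have hint : Integrable (fun p : E3 × S2 => planeWave s (-p.1) p.2 • tr (F p.1 * P p.2))
      (volume.prod sig) := by
    refine (((hF.norm.comp_fst sig).const_mul (‖tr (V := V)‖)).mul_const ‖P‖).mono' ?_
      (Filter.Eventually.of_forall fun p => ?_)
    · have h1 : AEStronglyMeasurable (fun p : E3 × S2 => planeWave s (-p.1) p.2)
          (volume.prod sig) := ((continuous_planeWave s).comp
            (continuous_fst.neg.prodMk continuous_snd)).aestronglyMeasurable
      have h2 : AEStronglyMeasurable (fun p : E3 × S2 => F p.1 * P p.2) (volume.prod sig) :=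
        hF.1.comp_fst.mul (P.continuous.comp continuous_snd).aestronglyMeasurable
      exact h1.smul ((tr (V := V)).continuous.comp_aestronglyMeasurable h2)
    · rw [norm_smul, norm_planeWave, one_mul]
      refine ((tr (V := V)).le_opNorm _).trans ?_
      rw [mul_assoc]
      gcongr
      refine (norm_mul_le _ _).trans ?_
      gcongr
      exact P.norm_coe_le_norm _
  have h1 : ∀ x, LinearMap.trace ℂ V (F x * (zonal s P).1 (-x) : V →L[ℂ] V).toLinearMap =
      Module.finrank ℂ V * ∫ ξ, planeWave s (-x) ξ • tr (F x * P ξ) ∂sig := by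
    intro x
    rw [← tr_apply]
    rw [zonal_apply, mul_smul_comm, map_smul, smul_eq_mul]
    congr 1
    have h2 := ContinuousLinearMap.integral_comp_comm
      (tr.comp (ContinuousLinearMap.mul ℂ (V →L[ℂ] V) (F x)))
      (integrable_wave s sig P.continuous (-x))
    refine Eq.trans h2.symm ?_
    refine integral_congr_ae (Filter.Eventually.of_forall fun ξ => ?_)
    simp only [map_smul]
    rfl
  rw [sphTransform, integral_congr_ae (Filter.Eventually.of_forall h1), integral_const_mul,
    ← mul_assoc, one_div, inv_mul_cancel₀ hV', one_mul, integral_integral_swap hint]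
  refine integral_congr_ae (Filter.Eventually.of_forall fun ξ => ?_)
  have h2 := ContinuousLinearMap.integral_comp_comm
      (tr.comp ((ContinuousLinearMap.mul ℂ (V →L[ℂ] V)).flip (P ξ)))
      (integrable_planeWave_smul s hF ξ)
  refine Eq.trans ?_ h2
  refine integral_congr_ae (Filter.Eventually.of_forall fun x => ?_)
  simp only [map_smul]
  rfl

/-- By equivariance and transitivity the integrand `Tr(F̂(η) P(η))` is constant on the sphere, so
the average is its value at any one point. -/
theorem sphTransform_zonal (hV : Module.finrank ℂ V ≠ 0) (s : ℝ) {τ : SO3 →* (V →L[ℂ] V)}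
    {P : C(S2, V →L[ℂ] V)} (hP : ∀ k ξ, P (rotS k ξ) = conjRep τ k (P ξ))
    {F : E3 → (V →L[ℂ] V)} (hF : MemL1 τ F) (ξ : S2) :
    sphTransform (zonal s P).1 F = tr (ft s F ξ * P ξ) := by
  rw [sphTransform_zonal_eq_integral hV s P hF.1]
  have h : ∀ η, tr (ft s F η * P η) = tr (ft s F ξ * P ξ) := by
    intro η
    obtain ⟨k, rfl⟩ := exists_rotS ξ η
    rw [hP, ft_rot s hF, conjRep_apply, conjRep_apply, ← tr_conj τ k (ft s F ξ * P ξ)]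
    have h3 : τ k⁻¹ * τ k = 1 := by rw [← map_mul, inv_mul_cancel, map_one]
    congr 1
    calc _ = τ k * ft s F ξ * (τ k⁻¹ * τ k) * (P ξ * τ k⁻¹) := by simp only [mul_assoc]
      _ = _ := by rw [h3, mul_one]; simp only [mul_assoc]
  simp [h]

theorem IsZonal.isSpherical (hV : Module.finrank ℂ V ≠ 0) {s : ℝ} {τ : SO3 →* (V →L[ℂ] V)}
    {P : C(S2, V →L[ℂ] V)} (hP : IsZonal τ P) : IsSpherical τ (zonal s P).1 := by
  refine ⟨memLinf_zonal hP.rot s, fun h => ?_, fun F G hF hG => ?_⟩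
  · have h0 : (zonal s P).1 = 0 :=
      (Continuous.ae_eq_iff_eq volume (Smooth.contDiff _).continuous continuous_const).1 h
    have h1 := tr_zonal_zero hP.tr_eq s
    rw [h0] at h1
    simp only [Pi.zero_apply, map_zero] at h1
    exact hV (by exact_mod_cast h1.symm)
  · let ξ : S2 := ⟨e3, by simp⟩
    rw [sphTransform_zonal hV s hP.rot (hF.conv hG) ξ, sphTransform_zonal hV s hP.rot hF ξ,
      sphTransform_zonal hV s hP.rot hG ξ, ft_conv s hF.1 hG.1]
    exact hP.tr_mul ξ _ _ (ft_commStab s hF ξ) (ft_commStab s hG ξ)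

end

/-! ### Gaussian test functions -/

/-- The Gaussian `e^{-|x|²}`. -/
def gauss (x : E3) : ℂ := Complex.exp (-1 * (‖x‖ : ℂ) ^ 2)

theorem planeWave_neg (s : ℝ) (x : E3) (ξ : S2) :
    planeWave s (-x) ξ = Complex.exp (Complex.I * s * (inner ℝ ξ.1 x : ℝ)) := by
  rw [planeWave, inner_neg_left, real_inner_comm]
  congr 1
  push_cast
  ring

theorem norm_gauss (x : E3) : ‖gauss x‖ = Real.exp (-‖x‖ ^ 2) := by
  rw [gauss, Complex.norm_exp]
  congr 1
  rw [neg_one_mul, Complex.neg_re, ← Complex.ofReal_pow, Complex.ofReal_re]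

theorem integrable_gauss : Integrable gauss := by
  have h := GaussianFourier.integrable_cexp_neg_mul_sq_norm_add (b := 1) (by simp) 0 (0 : E3)
  refine h.congr (Filter.Eventually.of_forall fun x => ?_)
  simp only [gauss, zero_mul, add_zero]

theorem gauss_rot (k : SO3) (x : E3) : gauss (rot k x) = gauss x := by
  simp only [gauss, norm_rot]

theorem continuous_gauss : Continuous gauss := by
  unfold gauss
  fun_prop

/-- The Fourier transform of the Gaussian on the sphere of radius `s`. -/
def gaussHat (s : ℝ) : ℂ :=
  (Real.pi / 1 : ℂ) ^ (Module.finrank ℝ E3 / 2 : ℂ) * Complex.exp ((Complex.I * s) ^ 2 / (4 * 1))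

theorem gaussHat_ne_zero (s : ℝ) : gaussHat s ≠ 0 := by
  refine mul_ne_zero ?_ (Complex.exp_ne_zero _)
  rw [Complex.cpow_ne_zero_iff_of_exponent_ne_zero]
  · simp [Real.pi_ne_zero]
  · simp

theorem integral_planeWave_mul_gauss (s : ℝ) (ξ : S2) :
    ∫ x, planeWave s (-x) ξ * gauss x = gaussHat s := by
  have h := GaussianFourier.integral_cexp_neg_mul_sq_norm_add (b := 1) (by simp)
    (Complex.I * s) ξ.1
  rw [norm_S2] at h
  rw [gaussHat]
  simp only [Complex.ofReal_one, one_pow, mul_one] at h ⊢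
  rw [← h]
  refine integral_congr_ae (Filter.Eventually.of_forall fun x => ?_)
  simp only [planeWave_neg, gauss, ← Complex.exp_add]
  congr 1
  ring

theorem integrable_coord_mul_gauss (i : Fin 3) : Integrable fun x : E3 => (x i : ℂ) * gauss x := by
  have h := (GaussianFourier.integrable_cexp_neg_mul_sq_norm_add (b := 1 / 2) (by simp) 0 (0 : E3)).norm
  refine h.mono' ?_ (Filter.Eventually.of_forall fun x => ?_)
  · refine Continuous.aestronglyMeasurable ?_
    have := continuous_gauss
    fun_prop
  · rw [norm_mul, norm_gauss, Complex.norm_exp, Complex.norm_real]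
    -- Half of the Gaussian decay absorbs the coordinate; the other half remains integrable.
    have h1 : ‖x i‖ ≤ Real.exp (‖x‖ ^ 2 / 2) := by
      refine (PiLp.norm_apply_le x i).trans ?_
      have := Real.add_one_le_exp (‖x‖ ^ 2 / 2)
      nlinarith [sq_nonneg (‖x‖ - 1)]
    have h2 : (-(1 / 2 : ℂ) * (‖x‖ : ℂ) ^ 2 + 0 * ((inner ℝ (0 : E3) x : ℝ) : ℂ)).re =
        ‖x‖ ^ 2 / 2 + -‖x‖ ^ 2 := by
      have : (-(1 / 2 : ℂ) * (‖x‖ : ℂ) ^ 2 + 0 * ((inner ℝ (0 : E3) x : ℝ) : ℂ)) =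
          ((‖x‖ ^ 2 / 2 + -‖x‖ ^ 2 : ℝ) : ℂ) := by
        push_cast; ring
      rw [this, Complex.ofReal_re]
    rw [h2, Real.exp_add]
    gcongr

/-- Integration by parts, using `∂_i e^{-|x|²} = -2 x_i e^{-|x|²}`. -/
theorem integral_planeWave_mul_coord_mul_gauss (s : ℝ) (ξ : S2) (i : Fin 3) :
    ∫ x : E3, planeWave s (-x) ξ * ((x i : ℂ) * gauss x) =
      Complex.I * s / 2 * gaussHat s * (ξ.1 i : ℂ) := by
  have hg : ∀ x : E3, HasFDerivAt gauss ((-2 * gauss x) • Complex.ofRealCLM.comp (innerSL ℝ x)) x := by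
    intro x
    have h1 : HasFDerivAt (fun x : E3 => ((‖x‖ ^ 2 : ℝ) : ℂ))
        (Complex.ofRealCLM.comp (2 • innerSL ℝ x)) x :=
      Complex.ofRealCLM.hasFDerivAt.comp x (hasStrictFDerivAt_norm_sq x).hasFDerivAt
    have h2 := (h1.const_mul (-1)).cexp
    have h3 : (fun x : E3 => Complex.exp (-1 * ((‖x‖ ^ 2 : ℝ) : ℂ))) = gauss := by
      funext x; simp [gauss]
    rw [h3] at h2
    refine h2.congr_fderiv ?_
    ext v
    simp [gauss]
    ring
  have hf : ∀ x : E3, HasFDerivAt (fun x => planeWave s (-x) ξ)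
      ((Complex.I * s * planeWave s (-x) ξ) • Complex.ofRealCLM.comp (innerSL ℝ ξ.1)) x := by
    intro x
    have h1 : HasFDerivAt (fun x : E3 => ((inner ℝ ξ.1 x : ℝ) : ℂ))
        (Complex.ofRealCLM.comp (innerSL ℝ ξ.1)) x :=
      (Complex.ofRealCLM.comp (innerSL ℝ ξ.1)).hasFDerivAt
    have h2 := (h1.const_mul (Complex.I * s)).cexp
    simp only [planeWave_neg]
    refine h2.congr_fderiv ?_
    ext v
    simp
    ring
  have hf' : ∀ x, fderiv ℝ (fun x => planeWave s (-x) ξ) x (EuclideanSpace.single i 1) =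
      Complex.I * s * (ξ.1 i : ℂ) * planeWave s (-x) ξ := fun x => by
    rw [(hf x).fderiv]
    simp [EuclideanSpace.inner_single_right]
    ring
  have hg' : ∀ x, fderiv ℝ gauss x (EuclideanSpace.single i 1) = -2 * ((x i : ℂ) * gauss x) :=
    fun x => by
      rw [(hg x).fderiv]
      simp [EuclideanSpace.inner_single_right]
      ring
  have hint : Integrable fun x : E3 => planeWave s (-x) ξ * gauss x :=
    integrable_planeWave_smul s integrable_gauss ξ
  have hint2 : Integrable fun x : E3 => planeWave s (-x) ξ * ((x i : ℂ) * gauss x) :=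
    integrable_planeWave_smul s (integrable_coord_mul_gauss i) ξ
  have h := integral_mul_fderiv_eq_neg_fderiv_mul_of_integrable (μ := (volume : Measure E3))
    (f := fun x => planeWave s (-x) ξ) (g := gauss) (v := EuclideanSpace.single i 1)
    (by simp only [hf', mul_assoc]; exact (hint.const_mul _).const_mul _ |>.const_mul _)
    (by simp only [hg', mul_left_comm _ (-2 : ℂ)]; exact hint2.const_mul (-2)) hint
    (fun x _ => (hf x).differentiableAt) (fun x _ => (hg x).differentiableAt)
  simp only [hf', hg', mul_left_comm _ (-2 : ℂ), mul_assoc (Complex.I * s * (ξ.1 i : ℂ)),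
    integral_const_mul, integral_planeWave_mul_gauss] at h
  linear_combination (-1 / 2 : ℂ) * h

section

variable {V : Type*} [NormedAddCommGroup V] [NormedSpace ℂ V]

theorem memL1_gauss (τ : SO3 →* (V →L[ℂ] V)) :
    MemL1 τ fun x => gauss x • (1 : V →L[ℂ] V) := by
  refine ⟨integrable_gauss.smul_const _, fun k => Filter.Eventually.of_forall fun x => ?_⟩
  beta_reduce
  rw [gauss_rot, mul_smul_comm, mul_one, smul_mul_assoc, ← map_mul, mul_inv_cancel,
    map_one]

theorem ft_gauss [CompleteSpace V] (s : ℝ) (ξ : S2) :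
    ft s (fun x => gauss x • (1 : V →L[ℂ] V)) ξ = gaussHat s • 1 := by
  simp only [ft, smul_smul]
  rw [integral_smul_const, integral_planeWave_mul_gauss]

end

theorem memL1_gauss_smul_dtau (m : ℕ) : MemL1 (tau m) fun x => gauss x • dtau m x := by
  refine ⟨?_, fun k => Filter.Eventually.of_forall fun x => ?_⟩
  · simp only [dtau, Finset.smul_sum, smul_smul, mul_comm (gauss _)]
    exact integrable_finsetSum _ fun i _ => (integrable_coord_mul_gauss i).smul_const _
  · beta_reduce
    rw [gauss_rot, mul_smul_comm, tau_mul_dtau, smul_mul_assoc, mul_assoc,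
      ← map_mul, mul_inv_cancel, map_one, mul_one]

theorem ft_gauss_smul_dtau (m : ℕ) (s : ℝ) (ξ : S2) :
    ft s (fun x => gauss x • dtau m x) ξ = (Complex.I * s / 2 * gaussHat s) • dtau m ξ.1 := by
  have hi : ∀ i ∈ Finset.univ, Integrable fun x : E3 =>
      (planeWave s (-x) ξ * ((x i : ℂ) * gauss x)) • dtauY m i := fun i _ =>
    (integrable_planeWave_smul s (integrable_coord_mul_gauss i) ξ).smul_const _
  simp only [ft, dtau, Finset.smul_sum, smul_smul, mul_comm (gauss _)]
  rw [integral_finsetSum _ hi]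
  refine Finset.sum_congr rfl fun i _ => ?_
  rw [integral_smul_const, integral_planeWave_mul_coord_mul_gauss]

/-! ### The characters attached to the `P_j` and their independence -/

/-- The projections `P_j` as continuous functions on the sphere. -/
def projC (m : ℕ) (j : Fin (2 * m + 1)) : C(S2, H m →L[ℂ] H m) :=
  ⟨fun ξ => proj m (wt m j) ξ.1, (continuous_proj m _).comp continuous_subtype_val⟩

theorem projC_apply (m : ℕ) (j : Fin (2 * m + 1)) (ξ : S2) :
    projC m j ξ = proj m (wt m j) ξ.1 := rfl

theorem isZonal_projC (m : ℕ) (j : Fin (2 * m + 1)) : IsZonal (tau m) (projC m j) where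
  rot k ξ := by
    rw [conjRep_apply, projC_apply, projC_apply, tau_mul_proj, mul_assoc, ← map_mul,
      mul_inv_cancel, map_one, mul_one]
    rfl
  tr_eq ξ := tr_proj (norm_S2 ξ) j
  tr_mul ξ _ _ hB hC := tr_mul_proj_mul (norm_S2 ξ) hB hC j

/-- The test functions `F * ⋯ * F * e^{-|x|²}` with `F(x) = e^{-|x|²} dτ_m(x)`. -/
def testFun (m : ℕ) : ℕ → E3 → (H m →L[ℂ] H m)
  | 0 => fun x => gauss x • 1
  | l + 1 => conv (fun x => gauss x • dtau m x) (testFun m l)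

theorem memL1_testFun (m l : ℕ) : MemL1 (tau m) (testFun m l) := by
  induction l with
  | zero => exact memL1_gauss _
  | succ l ih => exact (memL1_gauss_smul_dtau m).conv ih

/-- The value of the characters at `e^{-|x|²} dτ_m(x)`. -/
def charVal (m : ℕ) (s : ℝ) (j : Fin (2 * m + 1)) : ℂ :=
  Complex.I * s / 2 * gaussHat s * (Complex.I * (wt m j : ℂ))

theorem charVal_injective (m : ℕ) {s : ℝ} (hs : s ≠ 0) : Function.Injective (charVal m s) := by
  intro j k h
  have h0 : Complex.I * s / 2 * gaussHat s ≠ 0 := by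
    simp [Complex.I_ne_zero, hs, gaussHat_ne_zero]
  have h1 := mul_left_cancel₀ Complex.I_ne_zero (mul_left_cancel₀ h0 h)
  exact wt_injective m (by exact_mod_cast h1)

theorem tr_ft_gauss_smul_dtau (m : ℕ) (s : ℝ) (j : Fin (2 * m + 1)) (ξ : S2) :
    tr (ft s (fun x => gauss x • dtau m x) ξ * projC m j ξ) = charVal m s j := by
  rw [ft_gauss_smul_dtau, smul_mul_assoc, projC_apply, dtau_mul_proj (norm_S2 ξ), map_smul,
    map_smul, tr_proj (norm_S2 ξ), smul_eq_mul, smul_eq_mul, mul_one, charVal]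

theorem tr_ft_testFun (m : ℕ) (s : ℝ) (l : ℕ) (j : Fin (2 * m + 1)) (ξ : S2) :
    tr (ft s (testFun m l) ξ * projC m j ξ) = gaussHat s * charVal m s j ^ l := by
  induction l with
  | zero =>
    rw [testFun, ft_gauss, smul_mul_assoc, one_mul, map_smul, (isZonal_projC m j).tr_eq, pow_zero,
      smul_eq_mul]
  | succ l ih =>
    rw [testFun, ft_conv s (memL1_gauss_smul_dtau m).1 (memL1_testFun m l).1,
      (isZonal_projC m j).tr_mul ξ _ _ (ft_commStab s (memL1_gauss_smul_dtau m) ξ)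
      (ft_commStab s (memL1_testFun m l) ξ), ih, tr_ft_gauss_smul_dtau]
    ring

/-- On the test functions the characters take the values `gaussHat s * charVal m s j ^ l`: up to a
nonzero constant, powers of distinct numbers, so Vandermonde applies. -/
theorem eq_zero_of_sum_tr_ft_testFun {m : ℕ} {s : ℝ} (hs : s ≠ 0) (ξ : S2)
    (c : Fin (2 * m + 1) → ℂ)
    (h : ∀ l, ∑ j, c j * tr (ft s (testFun m l) ξ * projC m j ξ) = 0) : c = 0 := by
  refine Matrix.eq_zero_of_forall_pow_sum_mul_pow_eq_zero (charVal_injective m hs) fun l => ?_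
  have h1 := h l
  simp only [tr_ft_testFun, mul_left_comm _ (gaussHat s), ← Finset.mul_sum] at h1
  exact (mul_eq_zero.1 h1).resolve_left (gaussHat_ne_zero s)

/-- The function `∑ c_j P_j` on the sphere. -/
def projSum {m : ℕ} (c : Fin (2 * m + 1) → ℂ) : C(S2, H m →L[ℂ] H m) := ∑ j, c j • projC m j

theorem projSum_rot {m : ℕ} (c : Fin (2 * m + 1) → ℂ) (k : SO3) (ξ : S2) :
    projSum c (rotS k ξ) = conjRep (tau m) k (projSum c ξ) := by
  simp only [projSum, ContinuousMap.sum_apply, ContinuousMap.smul_apply, (isZonal_projC m _).rot,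
    map_sum, map_smul]

theorem finrank_H_ne_zero (m : ℕ) : Module.finrank ℂ (H m) ≠ 0 := by
  rw [finrank_H]; omega

theorem sphTransform_projSum {m : ℕ} (s : ℝ) (c : Fin (2 * m + 1) → ℂ)
    {F : E3 → (H m →L[ℂ] H m)} (hF : MemL1 (tau m) F) (ξ : S2) :
    sphTransform (zonal s (projSum c)).1 F = ∑ j, c j * tr (ft s F ξ * projC m j ξ) := by
  rw [sphTransform_zonal (finrank_H_ne_zero m) s (projSum_rot c) hF ξ]
  simp only [projSum, ContinuousMap.sum_apply, ContinuousMap.smul_apply, Finset.mul_sum,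
    mul_smul_comm, map_sum, map_smul, smul_eq_mul]

theorem zonal_projSum {m : ℕ} (s : ℝ) (c : Fin (2 * m + 1) → ℂ) :
    zonal s (projSum c) = ∑ j, c j • zonal s (projC m j) := by
  simp only [zonal, projSum, map_sum, map_smul, Finset.smul_sum, smul_comm (c _)]

theorem linearIndependent_zonal (m : ℕ) {s : ℝ} (hs : s ≠ 0) :
    LinearIndependent ℂ fun j => zonal s (projC m j) := by
  rw [Fintype.linearIndependent_iff]
  intro c hc
  have h0 : c = 0 := by
    let ξ : S2 := ⟨e3, by simp⟩
    refine eq_zero_of_sum_tr_ft_testFun hs ξ c fun l => ?_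
    rw [← sphTransform_projSum s c (memL1_testFun m l), zonal_projSum, hc]
    simp [sphTransform]
  exact congrFun h0

/-- Dedekind's argument. If `χ = ∑ c_i χ_i` is multiplicative, then `∑ c_i (χ_i(F) - χ(F)) χ_i(G) =
0` for all test functions `G`, so `χ_i = χ` whenever `c_i ≠ 0`. The `χ_i` being distinct, one term
survives, and the Gaussian forces its coefficient to be `1`. -/
theorem eq_zonal_of_isSpherical {m : ℕ} {s : ℝ} (hs : s ≠ 0) (c : Fin (2 * m + 1) → ℂ)
    (h : IsSpherical (tau m) (zonal s (projSum c)).1) :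
    ∃ j, zonal s (projSum c) = zonal s (projC m j) := by
  let ξ : S2 := ⟨e3, by simp⟩
  have hne : ∃ j, c j ≠ 0 := by
    by_contra hcon
    push Not at hcon
    apply h.2.1
    have : zonal s (projSum c) = 0 := by rw [zonal_projSum]; simp [hcon]
    rw [this]
    rfl
  obtain ⟨j, hj⟩ := hne
  have key : ∀ F, MemL1 (tau m) F → ∀ i, c i * (tr (ft s F ξ * projC m i ξ) -
      sphTransform (zonal s (projSum c)).1 F) = 0 := by
    intro F hF i
    refine congrFun (eq_zero_of_sum_tr_ft_testFun hs ξ (fun i => c i *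
      (tr (ft s F ξ * projC m i ξ) - sphTransform (zonal s (projSum c)).1 F)) fun l => ?_) i
    have h1 := h.2.2 F (testFun m l) hF (memL1_testFun m l)
    rw [sphTransform_projSum s c (hF.conv (memL1_testFun m l)) ξ,
      sphTransform_projSum s c (memL1_testFun m l) ξ, Finset.mul_sum,
      ft_conv s hF.1 (memL1_testFun m l).1] at h1
    rw [← sub_eq_zero, ← Finset.sum_sub_distrib] at h1
    rw [← h1]
    refine Finset.sum_congr rfl fun i _ => ?_
    rw [(isZonal_projC m i).tr_mul ξ _ _ (ft_commStab s hF ξ)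
      (ft_commStab s (memL1_testFun m l) ξ)]
    ring
  have hχ : ∀ F, MemL1 (tau m) F → ∀ i, c i ≠ 0 →
      tr (ft s F ξ * projC m i ξ) = sphTransform (zonal s (projSum c)).1 F := fun F hF i hi =>
    sub_eq_zero.1 ((mul_eq_zero.1 (key F hF i)).resolve_left hi)
  have hother : ∀ i, i ≠ j → c i = 0 := by
    intro i hij
    by_contra hi
    have h1 := (hχ _ (memL1_gauss_smul_dtau m) i hi).trans
      (hχ _ (memL1_gauss_smul_dtau m) j hj).symm
    rw [tr_ft_gauss_smul_dtau, tr_ft_gauss_smul_dtau] at h1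
    exact hij (charVal_injective m hs h1)
  have hcj : c j = 1 := by
    have h1 := hχ _ (memL1_testFun m 0) j hj
    rw [sphTransform_projSum s c (memL1_testFun m 0) ξ, Finset.sum_eq_single j
      (fun i _ hi => by rw [hother i hi, zero_mul]) (by simp), tr_ft_testFun, pow_zero, mul_one] at h1
    have h2 : gaussHat s * (1 - c j) = 0 := by linear_combination h1
    exact (sub_eq_zero.1 ((mul_eq_zero.1 h2).resolve_left (gaussHat_ne_zero s))).symm
  refine ⟨j, ?_⟩
  rw [zonal_projSum, Finset.sum_eq_single j (fun i _ hi => by rw [hother i hi, zero_smul])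
    (by simp), hcj, one_smul]

/-! ### Classification of the spherical functions of type `τ_m` -/

theorem exists_sum_mul_pow {n : ℕ} {a : Fin n → ℂ} (ha : Function.Injective a) (b : Fin n → ℂ) :
    ∃ c : Fin n → ℂ, ∀ l : Fin n, ∑ j, c j * a j ^ (l : ℕ) = b l := by
  have hdet : IsUnit (Matrix.vandermonde a).transpose.det := by
    rw [Matrix.det_transpose, isUnit_iff_ne_zero]
    exact Matrix.det_vandermonde_ne_zero_iff.2 ha
  obtain ⟨c, hc⟩ := Matrix.mulVec_surjective_iff_isUnit.2
    ((Matrix.isUnit_iff_isUnit_det _).2 hdet) b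
  refine ⟨c, fun l => ?_⟩
  rw [← hc]
  simp only [Matrix.mulVec, dotProduct, Matrix.transpose_apply, Matrix.vandermonde_apply, mul_comm]

theorem exists_sum_mul_pow_eq_ite {n : ℕ} {a : Fin n → ℂ} (ha : Function.Injective a) (j : Fin n) :
    ∃ d : Fin n → ℂ, ∀ i, ∑ l, d l * a i ^ (l : ℕ) = if i = j then 1 else 0 := by
  have hdet : IsUnit (Matrix.vandermonde a).det := by
    rw [isUnit_iff_ne_zero]
    exact Matrix.det_vandermonde_ne_zero_iff.2 ha
  obtain ⟨d, hd⟩ := Matrix.mulVec_surjective_iff_isUnit.2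
    ((Matrix.isUnit_iff_isUnit_det _).2 hdet) fun i => if i = j then 1 else 0
  refine ⟨d, fun i => ?_⟩
  have h := congrFun hd i
  simp only [Matrix.mulVec, dotProduct, Matrix.vandermonde_apply] at h
  simp only [← h, mul_comm]

theorem DtauEnd_zonal (m : ℕ) (s : ℝ) (j : Fin (2 * m + 1)) :
    DtauEnd m (zonal s (projC m j)) = (s * (wt m j : ℂ)) • zonal s (projC m j) := by
  rw [zonal, map_smul, DtauEnd, firstOrder_smoothWave (leftMul m) s sig (projC m j) (wt m j : ℂ),
    smul_comm]
  intro ξ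
  have h := dtau_mul_proj (norm_S2 ξ) j
  rw [dtau, Finset.sum_mul] at h
  simp only [smul_mul_assoc] at h
  exact h

theorem DtauEnd_pow_zonal (m : ℕ) (s : ℝ) (j : Fin (2 * m + 1)) (l : ℕ) :
    (DtauEnd m ^ l) (zonal s (projC m j)) = (s * (wt m j : ℂ)) ^ l • zonal s (projC m j) := by
  induction l with
  | zero => rw [pow_zero, pow_zero, one_smul, Module.End.one_apply]
  | succ l ih =>
    rw [pow_succ', Module.End.mul_apply, ih, map_smul, DtauEnd_zonal, smul_smul, ← pow_succ]

theorem injective_mul_wt (m : ℕ) {s : ℝ} (hs : s ≠ 0) :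
    Function.Injective fun j : Fin (2 * m + 1) => (s * (wt m j : ℂ) : ℂ) := by
  intro j k h
  have h1 := mul_left_cancel₀ (Complex.ofReal_ne_zero.2 hs) h
  exact wt_injective m (by exact_mod_cast h1)

section

variable {V : Type*} [NormedAddCommGroup V] [NormedSpace ℂ V]

/-- Continuity upgrades the almost everywhere identity to every point. -/
theorem MemLinf.isEquiv {τ : SO3 →* (V →L[ℂ] V)} {f : Smooth (V →L[ℂ] V)} (h : MemLinf τ f.1) :
    IsEquiv (conjRep τ) f.1 := by
  intro k x
  refine congrFun ((Continuous.ae_eq_iff_eq volume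
    ((Smooth.contDiff f).continuous.comp (rot k).continuous)
    ((conjRep τ k).continuous.comp (Smooth.contDiff f).continuous)).1 ?_) x
  filter_upwards [h.2 k] with y hy
  simp only [Function.comp_apply, hy, conjRep_apply]

theorem lap_DtauEnd_pow {m : ℕ} {f : Smooth (H m →L[ℂ] H m)} {c : ℂ} (h : lap f = c • f) (l : ℕ) :
    lap ((DtauEnd m ^ l) f) = c • (DtauEnd m ^ l) f := by
  induction l with
  | zero => exact h
  | succ l ih => rw [pow_succ', Module.End.mul_apply, DtauEnd, lap_firstOrder, ← DtauEnd, ih, map_smul]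

end

theorem tr_DtauEnd_pow_zonal_projSum {m : ℕ} (s : ℝ) (c : Fin (2 * m + 1) → ℂ) (l : ℕ) :
    tr (((DtauEnd m ^ l) (zonal s (projSum c))).1 0) =
      (Module.finrank ℂ (H m) : ℂ) * ∑ j, c j * (s * (wt m j : ℂ)) ^ l := by
  have h : ∀ j, tr ((zonal s (projC m j)).1 0) = (Module.finrank ℂ (H m) : ℂ) := fun j =>
    tr_zonal_zero (isZonal_projC m j).tr_eq s
  rw [zonal_projSum, map_sum]
  simp only [map_smul, DtauEnd_pow_zonal, AddSubmonoidClass.coe_finsetSum, Finset.sum_apply,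
    Submodule.coe_smul, Pi.smul_apply, map_sum, h, smul_eq_mul, Finset.mul_sum]
  exact Finset.sum_congr rfl fun j _ => by ring

theorem exists_eq_zonal_projSum {m : ℕ} {s : ℝ} (hs : s ≠ 0) (f : Smooth (H m →L[ℂ] H m))
    (hf : IsEquiv (conjRep (tau m)) f.1) (hlap : lap f = (-(s : ℂ) ^ 2) • f) :
    ∃ c : Fin (2 * m + 1) → ℂ, f = zonal s (projSum c) := by
  have hd : (Module.finrank ℂ (H m) : ℂ) ≠ 0 := by exact_mod_cast finrank_H_ne_zero m
  -- The `c_j` solve the transposed Vandermonde system making `Tr(D_τ^l ·)(0)`, `l ≤ 2m`, the same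
  -- for `f` and for `∑ c_j Φ_{s,j}`.
  obtain ⟨c, hc⟩ := exists_sum_mul_pow (injective_mul_wt m hs)
    fun l => tr (((DtauEnd m ^ (l : ℕ)) f).1 0) / (Module.finrank ℂ (H m) : ℂ)
  refine ⟨c, sub_eq_zero.1 ?_⟩
  have hΨ : IsEquiv (conjRep (tau m)) (f - zonal s (projSum c)).1 := by
    rw [isEquiv_iff_kAct] at hf ⊢
    have hz := (isEquiv_iff_kAct _ _).1 (isEquiv_zonal (projSum_rot c) s)
    intro k
    rw [map_sub, hf, hz]
  have hlapΨ : lap (f - zonal s (projSum c)) = (-(s : ℂ) ^ 2) • (f - zonal s (projSum c)) := by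
    rw [map_sub, hlap, lap_zonal, smul_sub]
  refine eq_zero_of_tr_DtauEnd_pow _ hΨ fun l hl x => ?_
  -- The trace of an equivariant function is radial, and `D_τ` preserves both equivariance and the
  -- Laplace eigenvalue. So the value at the origin, zero by the choice of `c`, decides.
  have h0 : post tr ((DtauEnd m ^ l) (f - zonal s (projSum c))) = 0 := by
    refine eq_zero_of_radial_helmholtz hs _ (fun k x => ?_) ?_ ?_
    · change tr (((DtauEnd m ^ l) (f - zonal s (projSum c))).1 (rot k x)) =
        tr (((DtauEnd m ^ l) (f - zonal s (projSum c))).1 x)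
      rw [hΨ.DtauEnd_pow l k x, conjRep_apply, tr_conj]
    · rw [lap_post, lap_DtauEnd_pow hlapΨ, map_smul]
    · change tr (((DtauEnd m ^ l) (f - zonal s (projSum c))).1 0) = 0
      rw [map_sub]
      change tr (((DtauEnd m ^ l) f).1 0 - ((DtauEnd m ^ l) (zonal s (projSum c))).1 0) = 0
      rw [map_sub, tr_DtauEnd_pow_zonal_projSum, hc ⟨l, by omega⟩, mul_div_cancel₀ _ hd, sub_self]
  exact congrFun (congrArg Subtype.val h0) x

theorem Phi_eq_zonal (m : ℕ) (s : ℝ) (j : Fin (2 * m + 1)) :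
    Phi m s (wt m j) = (zonal s (projC m j)).1 := by
  funext x
  rw [zonal_apply, finrank_H]
  push_cast
  rfl

theorem image_Phi (m : ℕ) (s : ℝ) :
    Phi m s '' Set.Icc (-(m : ℤ)) m = Set.range fun j => (zonal s (projC m j)).1 := by
  rw [← range_wt, ← Set.range_comp]
  congr 1
  funext j
  exact Phi_eq_zonal m s j

theorem setOf_isSpherical (m : ℕ) {s : ℝ} (hs : s ≠ 0) :
    {Φ : E3 → (H m →L[ℂ] H m) |
      IsSpherical (tau m) Φ ∧ HasLaplaceEigenvalue Φ (-(s : ℂ) ^ 2)} =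
      Set.range fun j => (zonal s (projC m j)).1 := by
  ext Φ
  constructor
  · rintro ⟨h, hΦ⟩
    obtain ⟨f, rfl⟩ : ∃ f : Smooth (H m →L[ℂ] H m), f.1 = Φ := ⟨⟨Φ, hΦ.1⟩, rfl⟩
    obtain ⟨c, rfl⟩ := exists_eq_zonal_projSum hs f h.1.isEquiv ((hasLaplaceEigenvalue_iff f _).1 hΦ)
    obtain ⟨j, hj⟩ := eq_zonal_of_isSpherical hs c h
    exact ⟨j, (congrArg Subtype.val hj).symm⟩
  · rintro ⟨j, rfl⟩
    exact ⟨(isZonal_projC m j).isSpherical (finrank_H_ne_zero m),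
      (hasLaplaceEigenvalue_iff _ _).2 (lap_zonal s _)⟩

/-! ### Classical spherical functions -/

/-- The classical spherical function `∫ e^{-√-1 s⟨x,ξ⟩} dσ(ξ)`. -/
def sphericalWave (s : ℝ) : Smooth ℂ := smoothWave s sig 1

theorem sphericalWave_zero (s : ℝ) : (sphericalWave s).1 0 = 1 := by
  rw [sphericalWave, smoothWave_apply]
  simp [planeWave_zero]

theorem zonal_smul_one (s : ℝ) (c : ℂ) :
    (zonal s (c • 1 : C(S2, ℂ →L[ℂ] ℂ))).1 = fun x => (c • sphericalWave s).1 x • 1 := by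
  funext x
  rw [zonal_apply, Module.finrank_self, Nat.cast_one, one_smul]
  change ∫ ξ, planeWave s x ξ • (c • (1 : ℂ →L[ℂ] ℂ)) ∂sig =
    (c • ∫ ξ, planeWave s x ξ • (1 : ℂ) ∂sig) • (1 : ℂ →L[ℂ] ℂ)
  rw [integral_smul_const, integral_smul_const, smul_eq_mul (b := (1 : ℂ)), mul_one, smul_smul,
    smul_eq_mul, mul_comm]

theorem isZonal_one : IsZonal (1 : SO3 →* (ℂ →L[ℂ] ℂ)) 1 where
  rot k ξ := by
    rw [conjRep_apply]
    simp
  tr_eq ξ := by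
    rw [ContinuousMap.one_apply, tr_one, Module.finrank_self, Nat.cast_one]
  tr_mul ξ B C _ _ := by
    have h : ∀ B : ℂ →L[ℂ] ℂ, B = B 1 • 1 := fun B => by ext; simp
    rw [ContinuousMap.one_apply, mul_one, mul_one, mul_one, h B, h C, smul_mul_assoc, mul_smul_comm,
      one_mul, map_smul, map_smul, map_smul, tr_one, Module.finrank_self]
    simp

theorem isClassicalSpherical_sphericalWave (s : ℝ) : IsClassicalSpherical (sphericalWave s).1 := by
  have h := isZonal_one.isSpherical (s := s) (by simp)
  have h1 := zonal_smul_one s 1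
  rw [one_smul, one_smul] at h1
  rwa [h1] at h

/-- Uniqueness of radial solutions gives `φ = c φ_s`. Multiplicativity on the Gaussian convolved
with itself gives `c² = c`, and `c ≠ 0` because `φ` is non-trivial. -/
theorem eq_sphericalWave {s : ℝ} (hs : s ≠ 0) {φ : E3 → ℂ} (h : IsClassicalSpherical φ)
    (hφ : HasLaplaceEigenvalue φ (-(s : ℂ) ^ 2)) : φ = (sphericalWave s).1 := by
  obtain ⟨f, rfl⟩ : ∃ f : Smooth ℂ, f.1 = φ := ⟨⟨φ, hφ.1⟩, rfl⟩
  have hrot : ∀ (f : Smooth ℂ) (_ : MemLinf (1 : SO3 →* (ℂ →L[ℂ] ℂ)) fun x => f.1 x • 1) (k : SO3)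
      (x : E3), f.1 (rot k x) = f.1 x := fun f hf k x => by
    have h1 := MemLinf.isEquiv (f := scalarId f.1 (Smooth.contDiff f)) hf k x
    have h2 := congrArg (fun A : ℂ →L[ℂ] ℂ => A 1) h1
    simpa [scalarId, conjRep_apply] using h2
  have hw := isClassicalSpherical_sphericalWave s
  obtain ⟨c, rfl⟩ : ∃ c : ℂ, f = c • sphericalWave s := by
    refine ⟨f.1 0, sub_eq_zero.1 (eq_zero_of_radial_helmholtz hs _ (fun k x => ?_) ?_ ?_)⟩
    · change f.1 (rot k x) - f.1 0 • (sphericalWave s).1 (rot k x) =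
        f.1 x - f.1 0 • (sphericalWave s).1 x
      rw [hrot f h.1, hrot _ hw.1]
    · rw [map_sub, (hasLaplaceEigenvalue_iff f _).1 hφ, map_smul, sphericalWave, lap_smoothWave,
        smul_sub, smul_comm]
    · change f.1 0 - f.1 0 • (sphericalWave s).1 0 = 0
      rw [sphericalWave_zero, smul_eq_mul, mul_one, sub_self]
  have hc : c ≠ 0 := by
    rintro rfl
    refine h.2.1 (Filter.Eventually.of_forall fun x => ?_)
    simp
  have hmul := h.2.2 _ _ (memL1_gauss _) (memL1_gauss _)
  rw [← zonal_smul_one] at hmul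
  have hP : ∀ k ξ, (c • 1 : C(S2, ℂ →L[ℂ] ℂ)) (rotS k ξ) =
      conjRep 1 k ((c • 1 : C(S2, ℂ →L[ℂ] ℂ)) ξ) := fun k ξ => by
    rw [conjRep_apply]
    change c • (1 : ℂ →L[ℂ] ℂ) = 1 * (c • 1) * 1
    rw [mul_one, one_mul]
  let ξ : S2 := ⟨e3, by simp⟩
  rw [sphTransform_zonal (by simp) s hP ((memL1_gauss _).conv (memL1_gauss _)) ξ,
    sphTransform_zonal (by simp) s hP (memL1_gauss _) ξ,
    ft_conv s (memL1_gauss 1).1 (memL1_gauss 1).1, ft_gauss] at hmul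
  have htr : ∀ a : ℂ, tr (a • (1 : ℂ →L[ℂ] ℂ)) = a := fun a => by
    rw [map_smul, tr_one, Module.finrank_self]; simp
  rw [ContinuousMap.smul_apply, ContinuousMap.one_apply] at hmul
  simp only [mul_smul_comm, mul_one, smul_smul, htr] at hmul
  have h1 : gaussHat s * gaussHat s * c * (1 - c) = 0 := by linear_combination hmul
  have h2 : c = 1 := (sub_eq_zero.1 ((mul_eq_zero.1 h1).resolve_left (mul_ne_zero
    (mul_ne_zero (gaussHat_ne_zero s) (gaussHat_ne_zero s)) hc))).symm
  rw [h2, one_smul]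

theorem existsUnique_isClassicalSpherical {s : ℝ} (hs : s ≠ 0) :
    ∃! φ : E3 → ℂ, IsClassicalSpherical φ ∧ HasLaplaceEigenvalue φ (-(s : ℂ) ^ 2) :=
  ⟨(sphericalWave s).1, ⟨isClassicalSpherical_sphericalWave s,
    (hasLaplaceEigenvalue_iff _ _).2 (lap_smoothWave s sig 1)⟩,
    fun _ h => eq_sphericalWave hs h.1 h.2⟩

/-! ### The space `𝔻_τ φ` -/

/-- At one point `ξ` the value commutes with the stabilizer, hence is a combination of the `P_j(ξ)`.
Equivariance carries the same coefficients over the whole sphere. -/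
theorem exists_eq_projSum {m : ℕ} (p : C(S2, H m →L[ℂ] H m))
    (hp : ∀ k ξ, p (rotS k ξ) = conjRep (tau m) k (p ξ)) :
    ∃ c : Fin (2 * m + 1) → ℂ, p = projSum c := by
  let ξ : S2 := ⟨e3, by simp⟩
  refine ⟨fun j => tr (p ξ * proj m (wt m j) ξ.1), ContinuousMap.ext fun η => ?_⟩
  have hstab : CommStab (tau m) ξ.1 (p ξ) := by
    intro g hg
    have h := hp g ξ
    rw [show rotS g ξ = ξ from Subtype.ext hg, conjRep_apply] at h
    conv_lhs => rw [h]
    rw [mul_assoc, ← map_mul, inv_mul_cancel, map_one, mul_one]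
  have h0 : p ξ = projSum (fun j => tr (p ξ * proj m (wt m j) ξ.1)) ξ := by
    rw [projSum, ContinuousMap.sum_apply]
    exact hstab.eq_sum_proj (norm_S2 ξ)
  obtain ⟨k, rfl⟩ := exists_rotS ξ η
  rw [hp, projSum_rot, ← h0]

section

variable {V : Type*} [NormedAddCommGroup V] [NormedSpace ℂ V] [FiniteDimensional ℂ V]
  [CompleteSpace V]

omit [FiniteDimensional ℂ V] in
theorem column_scalarId (s : ℝ) (h : ContDiff ℝ ∞ (sphericalWave s).1) (v : V) :
    column (scalarId (sphericalWave s).1 h) v = smoothWave s sig (ContinuousMap.const _ v) := by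
  refine Subtype.ext (funext fun x => ?_)
  change (∫ ξ, planeWave s x ξ • (1 : ℂ) ∂sig) • v = ∫ ξ, planeWave s x ξ • v ∂sig
  rw [integral_smul_const, integral_smul_const, smul_eq_mul, mul_one]

theorem applyEnd_scalarId (s : ℝ) (h : ContDiff ℝ ∞ (sphericalWave s).1)
    {D : Module.End ℂ (Smooth V)} {p : C(S2, V →L[ℂ] V)}
    (hp : ∀ B : C(S2, V), D (smoothWave s sig B) = smoothWave s sig (symAct p B)) :
    applyEnd (scalarId (sphericalWave s).1 h) D = (smoothWave s sig p).1 := by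
  funext x
  ext v
  change (D (column (scalarId (sphericalWave s).1 h) v)).1 x = _
  rw [column_scalarId, hp, smoothWave_apply, smoothWave_apply,
    ContinuousLinearMap.integral_apply (integrable_wave s sig p.continuous x)]
  rfl

theorem applyEnd_mem_span_zonal {m : ℕ} (s : ℝ) (h : ContDiff ℝ ∞ (sphericalWave s).1)
    {D : Module.End ℂ (Smooth (H m))} (hD : D ∈ DD (tau m)) :
    applyEnd (scalarId (sphericalWave s).1 h) D ∈
      Submodule.span ℂ (Set.range fun j => (zonal s (projC m j)).1) := by
  obtain ⟨p, hp⟩ := exists_symbol s D hD.1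
  obtain ⟨c, rfl⟩ := exists_eq_projSum p fun k ξ => by
    rw [conjRep_apply, ← symbol_equivariant (tau m) s D hD p hp, mul_assoc, ← map_mul,
      mul_inv_cancel, map_one, mul_one]
  have hd : (Module.finrank ℂ (H m) : ℂ) ≠ 0 := by exact_mod_cast finrank_H_ne_zero m
  have h1 : smoothWave s sig (projSum c) =
      (Module.finrank ℂ (H m) : ℂ)⁻¹ • zonal s (projSum c) := by
    rw [zonal, smul_smul, inv_mul_cancel₀ hd, one_smul]
  rw [applyEnd_scalarId s h (hp sig), h1, zonal_projSum]
  refine Submodule.smul_mem _ _ ?_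
  simp only [AddSubmonoidClass.coe_finsetSum]
  exact Submodule.sum_mem _ fun j _ => Submodule.smul_mem _ _ (Submodule.subset_span ⟨j, rfl⟩)

end

theorem column_DtauEnd {m : ℕ} (F : Smooth (H m →L[ℂ] H m)) (v : H m) :
    column (DtauEnd m F) v = Dtau m (column F v) := by
  refine Subtype.ext (funext fun x => ?_)
  change (DtauEnd m F).1 x v = (firstOrder (dtauY m) (column F v)).1 x
  rw [DtauEnd, firstOrder_apply, firstOrder_apply, sum_apply]
  refine Finset.sum_congr rfl fun i _ => ?_
  have h := congrArg (fun f : Smooth (H m) => f.1 x)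
    (pd_post (ContinuousLinearMap.apply ℂ (H m) v) i F)
  exact (congrArg (dtauY m i) h).symm

theorem column_DtauEnd_pow {m : ℕ} (F : Smooth (H m →L[ℂ] H m)) (l : ℕ) (v : H m) :
    column ((DtauEnd m ^ l) F) v = (Dtau m ^ l) (column F v) := by
  induction l with
  | zero => rfl
  | succ l ih => rw [pow_succ', pow_succ', Module.End.mul_apply, Module.End.mul_apply,
      column_DtauEnd, ih]

theorem applyEnd_Dtau_pow {m : ℕ} (F : Smooth (H m →L[ℂ] H m)) (l : ℕ) :
    applyEnd F (Dtau m ^ l) = ((DtauEnd m ^ l) F).1 := by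
  funext x
  ext v
  exact congrArg (fun f : Smooth (H m) => f.1 x) (column_DtauEnd_pow F l v).symm

theorem Dtau_mem_DD (m : ℕ) : Dtau m ∈ DD (tau m) := by
  refine ⟨Subalgebra.sum_mem _ fun i _ => Subalgebra.mul_mem _
    (Algebra.subset_adjoin (Or.inr ⟨_, rfl⟩)) (Algebra.subset_adjoin (Or.inl ⟨_, rfl⟩)), ?_⟩
  refine (Subalgebra.mem_centralizer_iff ℂ).2 ?_
  rintro _ ⟨k, rfl⟩
  exact kAct_firstOrder (tau m) (dtauY m) (tau_mul_dtauY m) k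

/-- Integrated form of `∑ P_j(ξ) = I`; it is the decomposition of `φ_s I` into eigenfunctions of
`D_τ`. -/
theorem scalarId_sphericalWave (m : ℕ) (s : ℝ) (h : ContDiff ℝ ∞ (sphericalWave s).1) :
    scalarId (V := H m) (sphericalWave s).1 h =
      (Module.finrank ℂ (H m) : ℂ)⁻¹ • ∑ j, zonal s (projC m j) := by
  have hd : (Module.finrank ℂ (H m) : ℂ) ≠ 0 := by exact_mod_cast finrank_H_ne_zero m
  have h1 : ∑ j, projC m j = ContinuousMap.const _ 1 := ContinuousMap.ext fun ξ => by
    rw [ContinuousMap.sum_apply]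
    exact sum_proj (norm_S2 ξ)
  simp only [zonal, ← Finset.smul_sum, ← map_sum, h1, smul_smul, inv_mul_cancel₀ hd, one_smul]
  refine Subtype.ext (funext fun x => ?_)
  change (∫ ξ, planeWave s x ξ • (1 : ℂ) ∂sig) • (1 : H m →L[ℂ] H m) =
    ∫ ξ, planeWave s x ξ • (1 : H m →L[ℂ] H m) ∂sig
  rw [integral_smul_const, integral_smul_const, smul_eq_mul, mul_one]

theorem applyEnd_Dtau_pow_sphericalWave (m : ℕ) (s : ℝ) (h : ContDiff ℝ ∞ (sphericalWave s).1)
    (l : ℕ) : applyEnd (scalarId (sphericalWave s).1 h) (Dtau m ^ l) =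
      (Module.finrank ℂ (H m) : ℂ)⁻¹ •
        ∑ j, (s * (wt m j : ℂ)) ^ l • (zonal s (projC m j)).1 := by
  rw [applyEnd_Dtau_pow, scalarId_sphericalWave, map_smul, map_sum]
  simp only [DtauEnd_pow_zonal, Submodule.coe_smul, AddSubmonoidClass.coe_finsetSum]

/-- Interpolation at the distinct eigenvalues `s n` gives a polynomial in `D_τ` of degree at most
`2m` that picks the `j`-th component out of `φ_s I`. -/
theorem zonal_mem_span_Dtau_pow (m : ℕ) {s : ℝ} (hs : s ≠ 0)
    (h : ContDiff ℝ ∞ (sphericalWave s).1) (j : Fin (2 * m + 1)) :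
    (zonal s (projC m j)).1 ∈ Submodule.span ℂ (Set.range fun l : Fin (2 * m + 1) =>
      applyEnd (scalarId (sphericalWave s).1 h) (Dtau m ^ (l : ℕ))) := by
  have hd : (Module.finrank ℂ (H m) : ℂ) ≠ 0 := by exact_mod_cast finrank_H_ne_zero m
  obtain ⟨d, hd'⟩ := exists_sum_mul_pow_eq_ite (injective_mul_wt m hs) j
  have key : (zonal s (projC m j)).1 = (Module.finrank ℂ (H m) : ℂ) • ∑ l : Fin (2 * m + 1),
      d l • applyEnd (scalarId (sphericalWave s).1 h) (Dtau m ^ (l : ℕ)) := by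
    simp only [applyEnd_Dtau_pow_sphericalWave, smul_comm (d _), ← Finset.smul_sum]
    rw [smul_smul, mul_inv_cancel₀ hd, one_smul]
    simp only [Finset.smul_sum, smul_smul]
    rw [Finset.sum_comm]
    simp only [← Finset.sum_smul, hd', ite_smul, one_smul, zero_smul, Finset.sum_ite_eq',
      Finset.mem_univ, if_true]
  rw [key]
  exact Submodule.smul_mem _ _ (Submodule.sum_mem _ fun l _ =>
    Submodule.smul_mem _ _ (Submodule.subset_span ⟨l, rfl⟩))

theorem span_Dtau_pow (m : ℕ) {s : ℝ} (hs : s ≠ 0) (h : ContDiff ℝ ∞ (sphericalWave s).1) :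
    Submodule.span ℂ (Set.range fun l : Fin (2 * m + 1) =>
      applyEnd (scalarId (sphericalWave s).1 h) (Dtau m ^ (l : ℕ))) =
      Submodule.span ℂ (Set.range fun j => (zonal s (projC m j)).1) := by
  refine le_antisymm (Submodule.span_le.2 ?_) (Submodule.span_le.2 ?_)
  · rintro _ ⟨l, rfl⟩
    exact applyEnd_mem_span_zonal s h (Subalgebra.pow_mem _ (Dtau_mem_DD m) _)
  · rintro _ ⟨j, rfl⟩
    exact zonal_mem_span_Dtau_pow m hs h j

theorem DDφ_eq_span (m : ℕ) {s : ℝ} (hs : s ≠ 0) (h : ContDiff ℝ ∞ (sphericalWave s).1) :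
    DDφ (tau m) (sphericalWave s).1 h =
      Submodule.span ℂ (Set.range fun j => (zonal s (projC m j)).1) := by
  refine le_antisymm ?_ ?_
  · rintro _ ⟨D, hD, rfl⟩
    exact applyEnd_mem_span_zonal s h hD
  · rw [← span_Dtau_pow m hs h]
    refine Submodule.span_le.2 ?_
    rintro _ ⟨l, rfl⟩
    exact ⟨_, Subalgebra.pow_mem _ (Dtau_mem_DD m) _, rfl⟩

theorem finrank_span_zonal (m : ℕ) {s : ℝ} (hs : s ≠ 0) :
    Module.finrank ℂ (Submodule.span ℂ (Set.range fun j => (zonal s (projC m j)).1)) =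
      2 * m + 1 := by
  have h := (linearIndependent_zonal m hs).map' (Smooth (H m →L[ℂ] H m)).subtype
    (Submodule.ker_subtype _)
  exact (finrank_span_eq_card h).trans (Fintype.card_fin _)

end TauSph

end

/-! ### The main theorem -/

open TauSph in
theorem mainTheorem8 (m : ℕ) (s : ℝ) (hs : 0 < s) :
    (∃! φ : E3 → ℂ, IsClassicalSpherical φ ∧ HasLaplaceEigenvalue φ (-(s : ℂ) ^ 2)) ∧
    ∀ (φ : E3 → ℂ) (_ : IsClassicalSpherical φ) (hφ : HasLaplaceEigenvalue φ (-(s : ℂ) ^ 2)),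
      Module.finrank ℂ (DDφ (tau m) φ hφ.1) = 2 * m + 1 ∧
      Submodule.span ℂ (Set.range fun l : Fin (2 * m + 1) =>
        applyEnd (scalarId φ hφ.1) (Dtau m ^ (l : ℕ))) = DDφ (tau m) φ hφ.1 ∧
      {Φ : E3 → (H m →L[ℂ] H m) |
          IsSpherical (tau m) Φ ∧ HasLaplaceEigenvalue Φ (-(s : ℂ) ^ 2)} =
        Phi m s '' Set.Icc (-(m : ℤ)) m ∧
      Submodule.span ℂ (Phi m s '' Set.Icc (-(m : ℤ)) m) = DDφ (tau m) φ hφ.1 := by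
  refine ⟨existsUnique_isClassicalSpherical hs.ne', fun φ h hφ => ?_⟩
  obtain rfl := eq_sphericalWave hs.ne' h hφ
  rw [DDφ_eq_span m hs.ne', image_Phi, span_Dtau_pow m hs.ne', setOf_isSpherical m hs.ne']
  exact ⟨finrank_span_zonal m hs.ne', rfl, rfl, rfl⟩
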